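/- Let $A$ be an abelian group with a homomorphism $d\mapsto |d|\in\mathbb Z/2$ (for instance $A=\mathbb Z$ with reduction mod $2$, or $A=\mathbb Z/2$ with the identity), let $X$ be a topological space (for instance a manifold), and let $n\ge 1$. Bundles are complex topological vector bundles of finite, locally constant rank; an $A$-graded bundle has local frames consisting of homogeneous vectors of locally constant degrees. $GK(X)$ denotes the Grothendieck group of isomorphism classes of $A$-graded vector bundles on $X$ under direct sum (isomorphisms preserve degrees), and degrees add in tensor products and exterior powers. For a finite group $G$ acting on a space $M$, a graded $G$-vector bundle $V$ on $M$ and $g\in G$, let $\phi_g(V)=\sum_\xi \xi\,[V_\xi]\in GK(M^g)\otimes\mathbb C$, where $V_\xi\subset V|_{M^g}$ is the eigenbundle of $g$ for the eigenvalue $\xi$. For a graded vector bundle $E$ on $X$, the symmetric group $S_n$ acts graded anti-symmetrically on $E^{\otimes n}$ (over $X$ with the trivial action) and on $E^{\boxtimes n}$ (over $X^n$ with $\sigma(x_1,\dots,x_n)=(x_{\sigma^{-1}(1)},\dots,x_{\sigma^{-1}(n)})$) by $$\sigma(v_1\otimes\cdots\otimes v_n)=\pm\, v_{\sigma^{-1}(1)}\otimes\cdots\otimes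 v_{\sigma^{-1}(n)}$$ for homogeneous $v_i$, where the sign is the product of $(-1)^{|v_i||v_j|}$ over all pairs $i<j$ with $\sigma(i)>\sigma(j)$; similarly for $\boxtimes$. Let $\sigma_n=(1\,2\cdots n)$, so that $X^{\sigma_n}=X$ for the trivial action and $(X^n)^{\sigma_n}$ is the diagonal, and let $i:X\to (X^n)^{\sigma_n}$, $x\mapsto(x,\dots,x)$. Let $\psi^n(E)\in GK(X)$ be the Adams operation, defined from the (ungraded-sign) exterior powers by Newton's formula $\psi^n(E)=\sum_{i=1}^{n-1}(-1)^{i-1}[\Lambda^iE]\,\psi^{n-i}(E)+(-1)^{n-1}n[\Lambda^nE]$, and let the graded Adams operation be $$G\psi^n(E)=\psi^n(E_{\mathrm{even}})+(-1)^{n-1}\psi^n(E_{\mathrm{odd}})\in GK(X),$$ where $E_{\mathrm{even}}$, $E_{\mathrm{odd}}$ are the sums of the homogeneous pieces of even and odd degree. Then: 1. For every graded vector bundle $E$ on $X$, in $GK(X)\otimes\mathbb C$, $$\phi_{\sigma_n}(E^{\otimes n})=G\psi^n(E),\qquad i^*\phi_{\sigma_n}(E^{\boxtimes n})=G\psi^n(E).$$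 2. If $E\cong L_1\oplus\cdots\oplus L_r$ with $L_j$ a graded line bundle of degree $d_j$, then in $GK(X)$ $$G\psi^n(E)=\sum_{j=1}^r(-1)^{(n-1)|d_j|}[L_j^{\otimes n}].$$ -/

import Mathlib

open scoped TensorProduct

universe u v w

set_option linter.unusedSectionVars false

namespace GradedK

/-!
# Graded vector bundles

Complex vector bundles are allowed to have locally constant (not necessarily constant) rank, as is
needed for eigenbundles and for `K`-theory over disconnected spaces. A bundle is presented by its
fibres together with an atlas of local frames whose transition matrices are continuous.
-/

/-- An `A`-graded (finite rank, complex, topological) vector bundle on `X`, given by an atlas of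
homogeneous local frames: every point `p` has an open neighbourhood `dom p` over which there is a
frame `frame p i`, `i ∈ idx p`, of the fibres, with dual coframe `coord p i`; the vector
`frame p i x` is homogeneous of degree `deg p i`. The transition matrices between two frames are
continuous (`continuousOn_transition`) and preserve degrees (`transition_deg`), so that
the homogeneous piece of degree `d` of the fibre at `x`, which is the span of the `frame p i x` with
`deg p i = d`, does not depend on the frame. The values of `frame p i x` and `coord p i x` for
`x` outside `dom p` are irrelevant. -/
structure GBundle (A : Type w) (X : Type u) [TopologicalSpace X] where
  fiber : X → Type v
  [addCommGroup : ∀ x, AddCommGroup (fiber x)]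
  [module : ∀ x, Module ℂ (fiber x)]
  dom : X → Set X
  isOpen_dom : ∀ p, IsOpen (dom p)
  mem_dom : ∀ p, p ∈ dom p
  idx : X → Type
  [fintype : ∀ p, Fintype (idx p)]
  deg : ∀ p, idx p → A
  frame : ∀ p, idx p → ∀ x, fiber x
  coord : ∀ p, idx p → ∀ x, fiber x →ₗ[ℂ] ℂ
  sum_coord_frame : ∀ p, ∀ x ∈ dom p, ∀ v : fiber x, ∑ i, coord p i x v • frame p i x = v
  coord_frame_self : ∀ p, ∀ x ∈ dom p, ∀ i, coord p i x (frame p i x) = 1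
  coord_frame_ne : ∀ p, ∀ x ∈ dom p, ∀ i j, i ≠ j → coord p j x (frame p i x) = 0
  continuousOn_transition : ∀ p q i j,
    ContinuousOn (fun x => coord q j x (frame p i x)) (dom p ∩ dom q)
  transition_deg : ∀ p q, ∀ x ∈ dom p ∩ dom q, ∀ i j, deg p i ≠ deg q j →
    coord q j x (frame p i x) = 0

attribute [instance] GBundle.addCommGroup GBundle.module GBundle.fintype

variable {A : Type w} {X : Type u} [TopologicalSpace X]

/-- A fibrewise linear map `f : E → F` is a homomorphism of graded bundles if its matrices in the
local frames are continuous and it preserves degrees. -/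
structure IsHom (E F : GBundle.{u, v, w} A X)
    (f : ∀ x, E.fiber x →ₗ[ℂ] F.fiber x) : Prop where
  continuousOn : ∀ p q i j,
    ContinuousOn (fun x => F.coord q j x (f x (E.frame p i x))) (E.dom p ∩ F.dom q)
  deg : ∀ p q, ∀ x ∈ E.dom p ∩ F.dom q, ∀ i j, E.deg p i ≠ F.deg q j →
    F.coord q j x (f x (E.frame p i x)) = 0

namespace IsHom

variable {E F G : GBundle.{u, v, w} A X}

theorem id (E : GBundle.{u, v, w} A X) : IsHom E E fun _ => LinearMap.id :=
  ⟨E.continuousOn_transition, E.transition_deg⟩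

theorem congr {f g : ∀ x, E.fiber x →ₗ[ℂ] F.fiber x} (hg : IsHom E F g)
    (h : ∀ x v, f x v = g x v) : IsHom E F f := by
  have : f = g := funext fun x => LinearMap.ext (h x)
  rwa [this]

theorem coord_comp {x : X} (g : F.fiber x →ₗ[ℂ] G.fiber x) (v : F.fiber x) {t : X}
    (hx : x ∈ F.dom t) (q : X) (j : G.idx q) :
    G.coord q j x (g v) = ∑ k, F.coord t k x v * G.coord q j x (g (F.frame t k x)) := by
  conv_lhs => rw [← F.sum_coord_frame t x hx v]
  simp

theorem comp {f : ∀ x, E.fiber x →ₗ[ℂ] F.fiber x} {g : ∀ x, F.fiber x →ₗ[ℂ] G.fiber x}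
    (hg : IsHom F G g) (hf : IsHom E F f) : IsHom E G fun x => g x ∘ₗ f x := by
  constructor
  · intro p q i j t ht
    have hN : E.dom p ∩ F.dom t ∩ G.dom q ∈ nhds t :=
      (((E.isOpen_dom p).inter (F.isOpen_dom t)).inter (G.isOpen_dom q)).mem_nhds
        ⟨⟨ht.1, F.mem_dom t⟩, ht.2⟩
    have key : ContinuousOn (fun x => ∑ k, F.coord t k x (f x (E.frame p i x)) *
        G.coord q j x (g x (F.frame t k x))) (E.dom p ∩ F.dom t ∩ G.dom q) := by
      refine continuousOn_finsetSum _ fun k _ => ContinuousOn.mul ?_ ?_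
      · exact (hf.continuousOn p t i k).mono fun x hx => hx.1
      · exact (hg.continuousOn t q k j).mono fun x hx => ⟨hx.1.2, hx.2⟩
    refine ContinuousAt.continuousWithinAt ((key.continuousAt hN).congr ?_)
    filter_upwards [hN] with x hx
    exact (coord_comp (g x) _ hx.1.2 q j).symm
  · intro p q x hx i j hij
    simp only [LinearMap.comp_apply]
    rw [coord_comp (g x) _ (F.mem_dom x) q j]
    refine Finset.sum_eq_zero fun k _ => ?_
    by_cases h : E.deg p i = F.deg x k
    · rw [hg.deg x q x ⟨F.mem_dom x, hx.2⟩ k j (h ▸ hij), mul_zero]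
    · rw [hf.deg p x x ⟨hx.1, F.mem_dom x⟩ i k h, zero_mul]

theorem add {f g : ∀ x, E.fiber x →ₗ[ℂ] F.fiber x} (hf : IsHom E F f) (hg : IsHom E F g) :
    IsHom E F fun x => f x + g x := by
  constructor
  · intro p q i j
    exact ((hf.continuousOn p q i j).add (hg.continuousOn p q i j)).congr
      fun x _ => map_add (F.coord q j x) _ _
  · intro p q x hx i j hij
    simp [hf.deg p q x hx i j hij, hg.deg p q x hx i j hij]

theorem smul {f : ∀ x, E.fiber x →ₗ[ℂ] F.fiber x} (c : ℂ) (hf : IsHom E F f) :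
    IsHom E F fun x => c • f x := by
  constructor
  · intro p q i j
    simpa using (hf.continuousOn p q i j).const_mul c
  · intro p q x hx i j hij
    simp [hf.deg p q x hx i j hij]

theorem zero : IsHom E F fun _ => 0 :=
  ⟨fun p q i j => by simpa using continuousOn_const, fun p q x hx i j hij => by simp⟩

theorem sum {κ : Type*} (s : Finset κ) {f : κ → ∀ x, E.fiber x →ₗ[ℂ] F.fiber x}
    (hf : ∀ k, IsHom E F (f k)) : IsHom E F fun x => ∑ k ∈ s, f k x := by
  classical
  induction s using Finset.induction_on with
  | empty => simpa using zero
  | insert a s ha ih => simpa [Finset.sum_insert ha] using (hf a).add ih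

theorem pow {f : ∀ x, E.fiber x →ₗ[ℂ] E.fiber x} (hf : IsHom E E f) (k : ℕ) :
    IsHom E E fun x => (f x : Module.End ℂ (E.fiber x)) ^ k := by
  induction k with
  | zero => exact id E
  | succ k ih => simp only [pow_succ]; exact ih.comp hf

end IsHom

/-- Isomorphism of graded vector bundles. -/
def Iso (E F : GBundle.{u, v, w} A X) : Prop :=
  ∃ f : ∀ x, E.fiber x ≃ₗ[ℂ] F.fiber x,
    IsHom E F (fun x => (f x).toLinearMap) ∧ IsHom F E (fun x => (f x).symm.toLinearMap)

theorem Iso.refl (E : GBundle.{u, v, w} A X) : Iso E E :=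
  ⟨fun _ => LinearEquiv.refl ℂ _, IsHom.id E, IsHom.id E⟩

theorem Iso.symm {E F : GBundle.{u, v, w} A X} : Iso E F → Iso F E :=
  fun ⟨f, h, h'⟩ => ⟨fun x => (f x).symm, h', h⟩

theorem Iso.trans {E F G : GBundle.{u, v, w} A X} : Iso E F → Iso F G → Iso E G :=
  fun ⟨f, h, h'⟩ ⟨g, k, k'⟩ => ⟨fun x => (f x).trans (g x), k.comp h, h'.comp k'⟩

/-- Graded vector bundles up to isomorphism. -/
def isoSetoid (A : Type w) (X : Type u) [TopologicalSpace X] :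
    Setoid (GBundle.{u, v, w} A X) :=
  ⟨Iso, ⟨Iso.refl, Iso.symm, Iso.trans⟩⟩

/-! ## Direct sums and the Grothendieck group -/

/-- The zero bundle. -/
def zeroBundle (A : Type w) (X : Type u) [TopologicalSpace X] : GBundle.{u, v, w} A X where
  fiber _ := PUnit.{v + 1}
  dom _ := Set.univ
  isOpen_dom _ := isOpen_univ
  mem_dom _ := trivial
  idx _ := Empty
  deg _ i := i.elim
  frame _ i := i.elim
  coord _ i := i.elim
  sum_coord_frame _ _ _ _ := rfl
  coord_frame_self _ _ _ i := i.elim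
  coord_frame_ne _ _ _ i := i.elim
  continuousOn_transition _ _ i := i.elim
  transition_deg _ _ _ _ i := i.elim

/-- The direct sum of two graded vector bundles. -/
def directSum (E F : GBundle.{u, v, w} A X) : GBundle.{u, v, w} A X where
  fiber x := E.fiber x × F.fiber x
  dom p := E.dom p ∩ F.dom p
  isOpen_dom p := (E.isOpen_dom p).inter (F.isOpen_dom p)
  mem_dom p := ⟨E.mem_dom p, F.mem_dom p⟩
  idx p := E.idx p ⊕ F.idx p
  deg p := Sum.elim (E.deg p) (F.deg p)
  frame p i x := Sum.elim (fun i => (E.frame p i x, 0)) (fun i => (0, F.frame p i x)) i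
  coord p i x := Sum.elim (fun i => E.coord p i x ∘ₗ LinearMap.fst ℂ _ _)
    (fun i => F.coord p i x ∘ₗ LinearMap.snd ℂ _ _) i
  sum_coord_frame p x hx v := by
    have h1 := E.sum_coord_frame p x hx.1 v.1
    have h2 := F.sum_coord_frame p x hx.2 v.2
    ext
    · simpa [Fintype.sum_sum_type, Prod.fst_sum, Prod.snd_sum] using h1
    · simpa [Fintype.sum_sum_type, Prod.fst_sum, Prod.snd_sum] using h2
  coord_frame_self p x hx i := by
    rcases i with i | i
    · simpa using E.coord_frame_self p x hx.1 i
    · simpa using F.coord_frame_self p x hx.2 i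
  coord_frame_ne p x hx i j hij := by
    rcases i with i | i <;> rcases j with j | j
    · simpa using E.coord_frame_ne p x hx.1 i j (fun h => hij (h ▸ rfl))
    · simp
    · simp
    · simpa using F.coord_frame_ne p x hx.2 i j (fun h => hij (h ▸ rfl))
  continuousOn_transition p q i j := by
    rcases i with i | i <;> rcases j with j | j
    · simpa using (E.continuousOn_transition p q i j).mono fun x hx => ⟨hx.1.1, hx.2.1⟩
    · simpa using continuousOn_const
    · simpa using continuousOn_const
    · simpa using (F.continuousOn_transition p q i j).mono fun x hx => ⟨hx.1.2, hx.2.2⟩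
  transition_deg p q x hx i j hij := by
    rcases i with i | i <;> rcases j with j | j
    · simpa using E.transition_deg p q x ⟨hx.1.1, hx.2.1⟩ i j hij
    · simp
    · simp
    · simpa using F.transition_deg p q x ⟨hx.1.2, hx.2.2⟩ i j hij

section directSum

variable {E F G H : GBundle.{u, v, w} A X}

theorem IsHom.inl : IsHom E (directSum E F) fun _ => LinearMap.inl ℂ _ _ := by
  constructor
  · rintro p q i (j | j)
    · exact (E.continuousOn_transition p q i j).mono fun x hx => ⟨hx.1, hx.2.1⟩
    · exact continuousOn_const.congr fun x _ => map_zero (F.coord q j x)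
  · rintro p q x hx i (j | j) hij
    · exact E.transition_deg p q x ⟨hx.1, hx.2.1⟩ i j hij
    · exact map_zero (F.coord q j x)

theorem IsHom.inr : IsHom F (directSum E F) fun _ => LinearMap.inr ℂ _ _ := by
  constructor
  · rintro p q i (j | j)
    · exact continuousOn_const.congr fun x _ => map_zero (E.coord q j x)
    · exact (F.continuousOn_transition p q i j).mono fun x hx => ⟨hx.1, hx.2.2⟩
  · rintro p q x hx i (j | j) hij
    · exact map_zero (E.coord q j x)
    · exact F.transition_deg p q x ⟨hx.1, hx.2.2⟩ i j hij

theorem IsHom.fst : IsHom (directSum E F) E fun _ => LinearMap.fst ℂ _ _ := by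
  constructor
  · rintro p q (i | i) j
    · exact (E.continuousOn_transition p q i j).mono fun x hx => ⟨hx.1.1, hx.2⟩
    · exact continuousOn_const.congr fun x _ => map_zero (E.coord q j x)
  · rintro p q x hx (i | i) j hij
    · exact E.transition_deg p q x ⟨hx.1.1, hx.2⟩ i j hij
    · exact map_zero (E.coord q j x)

theorem IsHom.snd : IsHom (directSum E F) F fun _ => LinearMap.snd ℂ _ _ := by
  constructor
  · rintro p q (i | i) j
    · exact continuousOn_const.congr fun x _ => map_zero (F.coord q j x)
    · exact (F.continuousOn_transition p q i j).mono fun x hx => ⟨hx.1.2, hx.2⟩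
  · rintro p q x hx (i | i) j hij
    · exact map_zero (F.coord q j x)
    · exact F.transition_deg p q x ⟨hx.1.2, hx.2⟩ i j hij

theorem IsHom.prod {f : ∀ x, E.fiber x →ₗ[ℂ] F.fiber x} {g : ∀ x, E.fiber x →ₗ[ℂ] G.fiber x}
    (hf : IsHom E F f) (hg : IsHom E G g) :
    IsHom E (directSum F G) fun x => (f x).prod (g x) := by
  have := (IsHom.inl (F := G).comp hf).add (IsHom.inr (E := F).comp hg)
  refine this.congr fun x v => ?_
  exact Prod.ext (add_zero (f x v)).symm (zero_add (g x v)).symm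

theorem Iso.directSum_congr : Iso E F → Iso G H → Iso (directSum E G) (directSum F H) :=
  fun ⟨f, h, h'⟩ ⟨g, k, k'⟩ => ⟨fun x => (f x).prodCongr (g x),
    (h.comp IsHom.fst).prod (k.comp IsHom.snd), (h'.comp IsHom.fst).prod (k'.comp IsHom.snd)⟩

theorem Iso.directSum_comm (E F : GBundle.{u, v, w} A X) :
    Iso (directSum E F) (directSum F E) :=
  ⟨fun _ => LinearEquiv.prodComm ℂ _ _, IsHom.snd.prod IsHom.fst, IsHom.snd.prod IsHom.fst⟩

theorem Iso.directSum_assoc (E F G : GBundle.{u, v, w} A X) :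
    Iso (directSum (directSum E F) G) (directSum E (directSum F G)) :=
  ⟨fun _ => LinearEquiv.prodAssoc ℂ _ _ _,
    (IsHom.fst.comp IsHom.fst).prod ((IsHom.snd.comp IsHom.fst).prod IsHom.snd),
    (IsHom.fst.prod (IsHom.fst.comp IsHom.snd)).prod (IsHom.snd.comp IsHom.snd)⟩

theorem Iso.zero_directSum (E : GBundle.{u, v, w} A X) :
    Iso (directSum (zeroBundle A X) E) E :=
  ⟨fun x => (LinearEquiv.uniqueProd : (PUnit.{v + 1} × E.fiber x) ≃ₗ[ℂ] E.fiber x), IsHom.snd, IsHom.zero.prod (IsHom.id E)⟩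

end directSum

/-- The commutative monoid (under direct sum) of isomorphism classes of graded vector bundles. -/
def IsoClass (A : Type w) (X : Type u) [TopologicalSpace X] :=
  Quotient (isoSetoid.{u, v, w} A X)

/-- The isomorphism class of a graded vector bundle. -/
def IsoClass.mk (E : GBundle.{u, v, w} A X) : IsoClass.{u, v, w} A X :=
  Quotient.mk (isoSetoid A X) E

theorem IsoClass.sound {E F : GBundle.{u, v, w} A X} (h : Iso E F) :
    IsoClass.mk E = IsoClass.mk F := Quotient.sound h

instance : Zero (IsoClass.{u, v, w} A X) := ⟨IsoClass.mk (zeroBundle A X)⟩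

instance : Add (IsoClass.{u, v, w} A X) :=
  ⟨Quotient.map₂ directSum fun _ _ h _ _ k => Iso.directSum_congr h k⟩

instance : AddCommMonoid (IsoClass.{u, v, w} A X) where
  add_assoc := by
    rintro ⟨E⟩ ⟨F⟩ ⟨G⟩
    exact IsoClass.sound (Iso.directSum_assoc E F G)
  zero_add := by
    rintro ⟨E⟩
    exact IsoClass.sound (Iso.zero_directSum E)
  add_zero := by
    rintro ⟨E⟩
    exact IsoClass.sound ((Iso.directSum_comm _ _).trans (Iso.zero_directSum E))
  add_comm := by
    rintro ⟨E⟩ ⟨F⟩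
    exact IsoClass.sound (Iso.directSum_comm E F)
  nsmul := nsmulRec

/-- The graded `K`-group of `X`: the Grothendieck group of graded vector bundles on `X`. -/
abbrev GK (A : Type w) (X : Type u) [TopologicalSpace X] :=
  Algebra.GrothendieckAddGroup (IsoClass.{u, v, w} A X)

/-- The class in `GK` of a graded vector bundle. -/
def GK.of (E : GBundle.{u, v, w} A X) : GK.{u, v, w} A X :=
  Algebra.GrothendieckAddGroup.of (IsoClass.mk E)

/-- The homomorphism out of `GK` induced by an additive isomorphism invariant of bundles. -/
noncomputable def GK.induced {A : Type w} {X : Type u} [TopologicalSpace X]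
    {B : Type*} [AddCommGroup B] (Φ : GBundle.{u, v, w} A X → B)
    (hiso : ∀ E F, Iso E F → Φ E = Φ F) (hzero : Φ (zeroBundle A X) = 0)
    (hadd : ∀ E F, Φ (directSum E F) = Φ E + Φ F) :
    GK.{u, v, w} A X →+ B :=
  Algebra.GrothendieckAddGroup.lift
    { toFun := Quotient.lift Φ hiso
      map_zero' := hzero
      map_add' := by
        rintro ⟨E⟩ ⟨F⟩
        exact hadd E F }

theorem GK.of_eq {E F : GBundle.{u, v, w} A X} (h : Iso E F) : GK.of E = GK.of F :=
  congrArg Algebra.GrothendieckAddGroup.of (IsoClass.sound h)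

theorem GK.of_zero : GK.of (zeroBundle.{u, v, w} A X) = 0 :=
  map_zero (Algebra.GrothendieckAddGroup.of (M := IsoClass.{u, v, w} A X))

theorem GK.of_directSum (E F : GBundle.{u, v, w} A X) :
    GK.of (directSum E F) = GK.of E + GK.of F :=
  map_add (Algebra.GrothendieckAddGroup.of (M := IsoClass.{u, v, w} A X)) (IsoClass.mk E) (IsoClass.mk F)

theorem GK.induced_of {B : Type*} [AddCommGroup B] (Φ : GBundle.{u, v, w} A X → B)
    (hiso hzero hadd) (E : GBundle.{u, v, w} A X) :
    GK.induced Φ hiso hzero hadd (GK.of E) = Φ E := by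
  unfold GK.induced GK.of
  rw [← AddMonoidHom.comp_apply]
  exact DFunLike.congr_fun (Algebra.GrothendieckAddGroup.lift.symm_apply_apply _) (IsoClass.mk E)

/-! ## Pullback -/
section pullback

variable {Y : Type u} [TopologicalSpace Y]

/-- The pullback of a graded vector bundle along a continuous map. -/
def pullback (φ : X → Y) (hφ : Continuous φ) (E : GBundle.{u, v, w} A Y) :
    GBundle.{u, v, w} A X where
  fiber x := E.fiber (φ x)
  dom p := φ ⁻¹' E.dom (φ p)
  isOpen_dom p := (E.isOpen_dom (φ p)).preimage hφ
  mem_dom p := E.mem_dom (φ p)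
  idx p := E.idx (φ p)
  deg p := E.deg (φ p)
  frame p i x := E.frame (φ p) i (φ x)
  coord p i x := E.coord (φ p) i (φ x)
  sum_coord_frame p x hx v := E.sum_coord_frame (φ p) (φ x) hx v
  coord_frame_self p x hx i := E.coord_frame_self (φ p) (φ x) hx i
  coord_frame_ne p x hx i j hij := E.coord_frame_ne (φ p) (φ x) hx i j hij
  continuousOn_transition p q i j :=
    (E.continuousOn_transition (φ p) (φ q) i j).comp hφ.continuousOn fun _ hx => hx
  transition_deg p q x hx i j hij := E.transition_deg (φ p) (φ q) (φ x) hx i j hij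

variable (φ : X → Y) (hφ : Continuous φ)

theorem IsHom.pullback {E F : GBundle.{u, v, w} A Y} {f : ∀ y, E.fiber y →ₗ[ℂ] F.fiber y}
    (hf : IsHom E F f) : IsHom (pullback φ hφ E) (pullback φ hφ F) fun x => f (φ x) :=
  ⟨fun p q i j => (hf.continuousOn (φ p) (φ q) i j).comp hφ.continuousOn fun _ hx => hx,
    fun p q x hx i j hij => hf.deg (φ p) (φ q) (φ x) hx i j hij⟩

theorem Iso.pullback {E F : GBundle.{u, v, w} A Y} :
    Iso E F → Iso (pullback φ hφ E) (pullback φ hφ F) :=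
  fun ⟨f, h, h'⟩ => ⟨fun x => f (φ x), h.pullback φ hφ, h'.pullback φ hφ⟩

/-- The homomorphism `φ^* : GK(Y) → GK(X)` induced by a continuous map `φ : X → Y`. -/
noncomputable def GK.pullback : GK.{u, v, w} A Y →+ GK.{u, v, w} A X :=
  GK.induced (fun E => GK.of (GradedK.pullback φ hφ E))
    (fun _ _ h => GK.of_eq (h.pullback φ hφ))
    (by
      rw [← GK.of_zero]
      exact GK.of_eq ⟨fun _ => LinearEquiv.refl ℂ _, ⟨fun _ _ i => i.elim, fun _ _ _ _ i => i.elim⟩,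
        ⟨fun _ _ i => i.elim, fun _ _ _ _ i => i.elim⟩⟩)
    (fun E F => GK.of_directSum (GradedK.pullback φ hφ E) (GradedK.pullback φ hφ F))

end pullback


/-! ## Subbundles -/
section subbundle

/-- The family of subspaces `W x` of the fibres of `E` is the image of a (continuous, degree
preserving) projector of `E`. -/
def IsSubbundle (E : GBundle.{u, v, w} A X) (W : ∀ x, Submodule ℂ (E.fiber x)) : Prop :=
  ∃ P : ∀ x, E.fiber x →ₗ[ℂ] E.fiber x, IsHom E E P ∧ ∀ x, LinearMap.IsProj (W x) (P x)

theorem inv_graded {ι : Type*} [Fintype ι] [DecidableEq ι] (M : Matrix ι ι ℂ) (δ ε : ι → A)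
    (hM : IsUnit M.det) (h : ∀ i k, ε i ≠ δ k → M i k = 0) (k i : ι) (hki : δ k ≠ ε i) :
    M⁻¹ k i = 0 := by
  classical
  let D : Matrix ι ι ℂ := Matrix.diagonal fun l => if δ l = δ k then 1 else 0
  let D' : Matrix ι ι ℂ := Matrix.diagonal fun l => if ε l = δ k then 1 else 0
  have h1 : M * D = D' * M := by
    ext a b
    simp only [D, D', Matrix.mul_diagonal, Matrix.diagonal_mul]
    by_cases hab : ε a = δ b
    · simp [hab]
    · simp [h a b hab]
  have h2 : D * M⁻¹ = M⁻¹ * D' := by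
    calc D * M⁻¹ = M⁻¹ * (M * D) * M⁻¹ := by
          rw [← mul_assoc, Matrix.nonsing_inv_mul _ hM, one_mul]
      _ = M⁻¹ * D' := by
          rw [h1, mul_assoc, mul_assoc, Matrix.mul_nonsing_inv _ hM, mul_one]
  have h3 := congrFun (congrFun h2 k) i
  simpa [D, D', Matrix.mul_diagonal, Matrix.diagonal_mul, hki.symm] using h3

/-- A homogeneous local frame near `p` of the image `W` of a projector `P` of `E`, continuous with
respect to the frames of `E`. -/
structure SubFrame (E : GBundle.{u, v, w} A X) (W : ∀ x, Submodule ℂ (E.fiber x))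
    (P : ∀ x, E.fiber x →ₗ[ℂ] E.fiber x) (hW : ∀ x, LinearMap.IsProj (W x) (P x)) (p : X) where
  dom : Set X
  isOpen_dom : IsOpen dom
  mem_dom : p ∈ dom
  idx : Type
  [fintype : Fintype idx]
  deg : idx → A
  frame : idx → ∀ x, W x
  coord : idx → ∀ x, W x →ₗ[ℂ] ℂ
  sum_coord_frame : ∀ x ∈ dom, ∀ v : W x, ∑ i, coord i x v • frame i x = v
  coord_frame_self : ∀ x ∈ dom, ∀ i, coord i x (frame i x) = 1
  coord_frame_ne : ∀ x ∈ dom, ∀ i j, i ≠ j → coord j x (frame i x) = 0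
  continuousOn_frame : ∀ q i j,
    ContinuousOn (fun x => E.coord q j x (frame i x)) (dom ∩ E.dom q)
  frame_deg : ∀ q, ∀ x ∈ dom ∩ E.dom q, ∀ i j, deg i ≠ E.deg q j → E.coord q j x (frame i x) = 0
  continuousOn_coord : ∀ q i j,
    ContinuousOn (fun x => coord j x ((hW x).codRestrict (E.frame q i x))) (E.dom q ∩ dom)
  coord_deg : ∀ q, ∀ x ∈ E.dom q ∩ dom, ∀ i j, E.deg q i ≠ deg j →
    coord j x ((hW x).codRestrict (E.frame q i x)) = 0

theorem exists_subFrame (E : GBundle.{u, v, w} A X) (W : ∀ x, Submodule ℂ (E.fiber x))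
    (P : ∀ x, E.fiber x →ₗ[ℂ] E.fiber x) (hP : IsHom E E P)
    (hW : ∀ x, LinearMap.IsProj (W x) (P x)) (p : X) : Nonempty (SubFrame E W P hW p) := by
  classical
  have hPP : ∀ x v, P x (P x v) = P x v := fun x v => (hW x).map_id _ ((hW x).map_mem v)
  let Q : ∀ x, E.fiber x →ₗ[ℂ] E.fiber x := fun x => LinearMap.id + (-1 : ℂ) • P x
  have hQ : IsHom E E Q := (IsHom.id E).add (hP.smul (-1))
  have hQv : ∀ x v, Q x v = v - P x v := fun x v => by simp [Q, sub_eq_add_neg]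
  obtain ⟨J, a, -, haspan, hali⟩ := exists_linearIndependent' ℂ fun i => P p (E.frame p i p)
  obtain ⟨K, b, -, hbspan, hbli⟩ := exists_linearIndependent' ℂ fun i => Q p (E.frame p i p)
  let g : J ⊕ K → ∀ x, E.fiber x := fun l x =>
    Sum.elim (fun j => P x (E.frame p (a j) x)) (fun k => Q x (E.frame p (b k) x)) l
  let δ : J ⊕ K → A := Sum.elim (fun j => E.deg p (a j)) (fun k => E.deg p (b k))
  have hgc : ∀ q i l, ContinuousOn (fun x => E.coord q i x (g l x)) (E.dom p ∩ E.dom q) := by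
    rintro q i (j | k)
    · exact hP.continuousOn p q (a j) i
    · exact hQ.continuousOn p q (b k) i
  have hgd : ∀ q, ∀ x ∈ E.dom p ∩ E.dom q, ∀ i l, δ l ≠ E.deg q i →
      E.coord q i x (g l x) = 0 := by
    rintro q x hx i (j | k) h
    · exact hP.deg p q x hx (a j) i h
    · exact hQ.deg p q x hx (b k) i h
  -- the frame at `p`
  have hEli : LinearIndependent ℂ fun i => E.frame p i p := by
    rw [Fintype.linearIndependent_iff]
    intro c hc i
    have := congrArg (E.coord p i p) hc
    rw [map_sum, map_zero, Finset.sum_eq_single i] at this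
    · simpa [E.coord_frame_self p p (E.mem_dom p)] using this
    · intro j _ hj
      simp [E.coord_frame_ne p p (E.mem_dom p) j i hj]
    · simp
  have hEspan : ⊤ ≤ Submodule.span ℂ (Set.range fun i => E.frame p i p) := by
    intro v _
    rw [← E.sum_coord_frame p p (E.mem_dom p) v]
    exact Submodule.sum_mem _ fun i _ => Submodule.smul_mem _ _ (Submodule.subset_span ⟨i, rfl⟩)
  let bE := Module.Basis.mk hEli hEspan
  have hrange : ∀ (R : E.fiber p →ₗ[ℂ] E.fiber p) v,
      R v ∈ Submodule.span ℂ (Set.range fun i => R (E.frame p i p)) := by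
    intro R v
    rw [← E.sum_coord_frame p p (E.mem_dom p) v, map_sum]
    refine Submodule.sum_mem _ fun i _ => ?_
    rw [map_smul]
    exact Submodule.smul_mem _ _ (Submodule.subset_span ⟨i, rfl⟩)
  have hgspan : ⊤ ≤ Submodule.span ℂ (Set.range fun l => g l p) := by
    intro v _
    have hv : v = P p v + Q p v := by rw [hQv]; abel
    rw [hv]
    refine Submodule.add_mem _ ?_ ?_
    · have := hrange (P p) v
      rw [← haspan] at this
      refine Submodule.span_mono ?_ this
      rintro _ ⟨j, rfl⟩
      exact ⟨Sum.inl j, rfl⟩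
    · have := hrange (Q p) v
      rw [← hbspan] at this
      refine Submodule.span_mono ?_ this
      rintro _ ⟨j, rfl⟩
      exact ⟨Sum.inr j, rfl⟩
  have hgli : LinearIndependent ℂ fun l => g l p := by
    have : (fun l => g l p) = Sum.elim (fun j => P p (E.frame p (a j) p))
        (fun k => Q p (E.frame p (b k) p)) := by
      ext (l | l) <;> rfl
    rw [this]
    refine LinearIndependent.sum_type hali hbli ?_
    rw [Submodule.disjoint_def]
    intro v h1 h2
    have e1 : P p v = v := by
      have hle : Submodule.span ℂ (Set.range ((fun i => P p (E.frame p i p)) ∘ a)) ≤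
          LinearMap.eqLocus (P p) LinearMap.id := by
        rw [Submodule.span_le]
        rintro _ ⟨j, rfl⟩
        exact hPP p _
      exact hle h1
    have e2 : P p v = 0 := by
      have hle : Submodule.span ℂ (Set.range ((fun i => Q p (E.frame p i p)) ∘ b)) ≤
          LinearMap.ker (P p) := by
        rw [Submodule.span_le]
        rintro _ ⟨j, rfl⟩
        simp only [Function.comp_apply, SetLike.mem_coe, LinearMap.mem_ker]
        rw [hQv, map_sub, hPP, sub_self]
      exact hle h2
    rw [← e1, e2]
  let bg := Module.Basis.mk hgli hgspan
  let σ : E.idx p ≃ J ⊕ K := bE.indexEquiv bg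
  have : Fintype (J ⊕ K) := Fintype.ofEquiv _ σ
  have : Finite J := Finite.of_injective (Sum.inl : J → J ⊕ K) Sum.inl_injective
  have : Finite K := Finite.of_injective (Sum.inr : K → J ⊕ K) Sum.inr_injective
  have := Fintype.ofFinite J
  have := Fintype.ofFinite K
  let M : X → Matrix (E.idx p) (E.idx p) ℂ := fun x i k => E.coord p i x (g (σ k) x)
  have hMc : ContinuousOn M (E.dom p) := by
    refine continuousOn_pi.2 fun i => continuousOn_pi.2 fun k => ?_
    exact (hgc p i (σ k)).mono fun x hx => ⟨hx, hx⟩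
  have hMdet : ContinuousOn (fun x => (M x).det) (E.dom p) :=
    (continuous_id.matrix_det).comp_continuousOn hMc
  let U : Set X := E.dom p ∩ (fun x => (M x).det) ⁻¹' {0}ᶜ
  have hUo : IsOpen U := hMdet.isOpen_inter_preimage (E.isOpen_dom p) isOpen_compl_singleton
  have hUdet : ∀ x ∈ U, IsUnit (M x).det := fun x hx => isUnit_iff_ne_zero.2 hx.2
  have hUp : p ∈ U := by
    refine ⟨E.mem_dom p, ?_⟩
    have : M p = bE.toMatrix (bg.reindex σ.symm) := by
      ext i k
      have hcoord : ∀ v, bE.repr v i = E.coord p i p v := by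
        intro v
        conv_lhs => rw [← E.sum_coord_frame p p (E.mem_dom p) v]
        have hb : ∀ l, E.frame p l p = bE l := fun l => by simp [bE]
        simp only [hb, map_sum, map_smul, Module.Basis.repr_self, Finsupp.coe_finsetSum,
          Finset.sum_apply, Finsupp.smul_apply, Finsupp.single_apply]
        simp
      rw [Module.Basis.toMatrix_apply, hcoord]
      simp [M, bg]
    simp only [Set.mem_preimage, Set.mem_compl_iff, Set.mem_singleton_iff]
    rw [this]
    have h1 := bE.toMatrix_mul_toMatrix_flip (bg.reindex σ.symm)
    intro h0
    have h2 := congrArg Matrix.det h1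
    rw [Matrix.det_mul, h0, zero_mul, Matrix.det_one] at h2
    exact zero_ne_one h2
  let N : X → Matrix (E.idx p) (E.idx p) ℂ := fun x => (M x)⁻¹
  have hNc : ContinuousOn N U := by
    have h1 : ContinuousOn (fun x => ((M x).det)⁻¹ • (M x).adjugate) U := by
      refine ContinuousOn.smul (ContinuousOn.inv₀ (hMdet.mono Set.inter_subset_left) ?_) ?_
      · exact fun x hx => hx.2
      · exact (continuous_id.matrix_adjugate).comp_continuousOn (hMc.mono Set.inter_subset_left)
    refine h1.congr fun x _ => ?_
    simp [N, Matrix.inv_def, Ring.inverse_eq_inv']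
  have hNd : ∀ x ∈ U, ∀ k i, δ (σ k) ≠ E.deg p i → N x k i = 0 := by
    intro x hx k i h
    exact inv_graded (M x) (fun k => δ (σ k)) (E.deg p) (hUdet x hx)
      (fun i k h' => hgd p x ⟨hx.1, hx.1⟩ i (σ k) h'.symm) k i h
  -- the dual coframe of `g`
  let c : J ⊕ K → ∀ x, E.fiber x →ₗ[ℂ] ℂ := fun l x => ∑ i, N x (σ.symm l) i • E.coord p i x
  have hcg : ∀ x ∈ U, ∀ l m, c l x (g m x) = if l = m then 1 else 0 := by
    intro x hx l m
    have h1 : N x * M x = 1 := Matrix.nonsing_inv_mul _ (hUdet x hx)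
    have h2 := congrFun (congrFun h1 (σ.symm l)) (σ.symm m)
    rw [Matrix.mul_apply, Matrix.one_apply] at h2
    simpa [c, M] using h2
  have hsum : ∀ x ∈ U, ∀ v, ∑ l, c l x v • g l x = v := by
    intro x hx v
    have hsep : ∀ u u' : E.fiber x, (∀ i, E.coord p i x u = E.coord p i x u') → u = u' := by
      intro u u' h
      rw [← E.sum_coord_frame p x hx.1 u, ← E.sum_coord_frame p x hx.1 u']
      simp [h]
    apply hsep
    intro i
    have h1 : M x * N x = 1 := Matrix.mul_nonsing_inv _ (hUdet x hx)
    have h2 : (M x).mulVec ((N x).mulVec fun i => E.coord p i x v) = fun i => E.coord p i x v := by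
      rw [Matrix.mulVec_mulVec, h1, Matrix.one_mulVec]
    have h3 := congrFun h2 i
    rw [← h3, map_sum, ← σ.sum_comp]
    simp [Matrix.mulVec, dotProduct, c, M, mul_comm]
  have hcc : ∀ q i l, ContinuousOn (fun x => c l x (P x (E.frame q i x))) (E.dom q ∩ U) := by
    intro q i l
    have : ContinuousOn (fun x => ∑ k, N x (σ.symm l) k * E.coord p k x (P x (E.frame q i x)))
        (E.dom q ∩ U) := by
      refine continuousOn_finsetSum _ fun k _ => ContinuousOn.mul ?_ ?_
      · exact ((continuous_apply_apply (σ.symm l) k).comp_continuousOn hNc).mono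
          Set.inter_subset_right
      · exact (hP.continuousOn q p i k).mono fun x hx => ⟨hx.1, hx.2.1⟩
    refine this.congr fun x _ => ?_
    simp [c]
  have hcd : ∀ q, ∀ x ∈ E.dom q ∩ U, ∀ i l, E.deg q i ≠ δ l →
      c l x (P x (E.frame q i x)) = 0 := by
    intro q x hx i l h
    have : c l x (P x (E.frame q i x)) =
      ∑ k, N x (σ.symm l) k * E.coord p k x (P x (E.frame q i x)) := by simp [c]
    rw [this]
    refine Finset.sum_eq_zero fun k _ => ?_
    by_cases hk : E.deg q i = E.deg p k
    · rw [hNd x hx.2 (σ.symm l) k (by simpa [← hk] using h.symm), zero_mul]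
    · rw [hP.deg q p x ⟨hx.1, hx.2.1⟩ i k hk, mul_zero]
  exact ⟨{
    dom := U
    isOpen_dom := hUo
    mem_dom := hUp
    idx := J
    deg := fun j => E.deg p (a j)
    frame := fun j x => ⟨g (Sum.inl j) x, (hW x).map_mem _⟩
    coord := fun j x => c (Sum.inl j) x ∘ₗ (W x).subtype
    sum_coord_frame := by
      intro x hx v
      apply Subtype.ext
      have h1 : P x (v : E.fiber x) = v := (hW x).map_id _ v.2
      have h2 := congrArg (P x) (hsum x hx v)
      rw [h1, map_sum] at h2
      have e : ∀ s : Finset (J ⊕ K), ∀ _ : s = Finset.univ, (∑ l ∈ s, P x (c l x v • g l x)) =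
          ∑ j, c (Sum.inl j) x v • g (Sum.inl j) x := by
        intro s hs
        have hs' : s = Finset.univ.disjSum Finset.univ := by
          rw [hs]; ext (l | l) <;> simp
        rw [hs', Finset.sum_disjSum]
        have hK : ∀ k : K, P x (g (Sum.inr k) x) = 0 := by
          intro k
          change P x (Q x _) = 0
          rw [hQv, map_sub, hPP, sub_self]
        have hJ : ∀ j : J, P x (g (Sum.inl j) x) = g (Sum.inl j) x := fun j => hPP x _
        simp [hK, hJ]
      rw [e _ rfl] at h2
      simpa using h2
    coord_frame_self := by
      intro x hx i
      simpa using hcg x hx (Sum.inl i) (Sum.inl i)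
    coord_frame_ne := by
      intro x hx i j hij
      have := hcg x hx (Sum.inl j) (Sum.inl i)
      rw [if_neg (fun h => hij (Sum.inl_injective h).symm)] at this
      exact this
    continuousOn_frame := fun q i j =>
      (hgc q j (Sum.inl i)).mono fun x hx => ⟨hx.1.1, hx.2⟩
    frame_deg := fun q x hx i j h => hgd q x ⟨hx.1.1, hx.2⟩ j (Sum.inl i) h
    continuousOn_coord := fun q i j => hcc q i (Sum.inl j)
    coord_deg := fun q x hx i j h => hcd q x hx i (Sum.inl j) h }⟩

/-- The image `W` of a projector of `E`, as a graded vector bundle: its frames are continuous in `E`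
and homogeneous in `E`. -/
noncomputable def subbundle (E : GBundle.{u, v, w} A X) (W : ∀ x, Submodule ℂ (E.fiber x))
    (h : IsSubbundle E W) : GBundle.{u, v, w} A X :=
  let Φ : ∀ p, SubFrame E W h.choose h.choose_spec.2 p := fun p =>
    (exists_subFrame E W h.choose h.choose_spec.1 h.choose_spec.2 p).some
  have key : ∀ p q i j (t x : X), x ∈ E.dom t →
      (Φ q).coord j x ((Φ p).frame i x) = ∑ k, E.coord t k x ((Φ p).frame i x) *
        (Φ q).coord j x ((h.choose_spec.2 x).codRestrict (E.frame t k x)) := by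
    intro p q i j t x hx
    have h1 : (Φ p).frame i x = (h.choose_spec.2 x).codRestrict ((Φ p).frame i x : E.fiber x) :=
      ((h.choose_spec.2 x).codRestrict_apply_cod _).symm
    conv_lhs => rw [h1, ← E.sum_coord_frame t x hx ((Φ p).frame i x : E.fiber x)]
    simp
  { fiber := fun x => W x
    dom := fun p => (Φ p).dom
    isOpen_dom := fun p => (Φ p).isOpen_dom
    mem_dom := fun p => (Φ p).mem_dom
    idx := fun p => (Φ p).idx
    fintype := fun p => (Φ p).fintype
    deg := fun p => (Φ p).deg
    frame := fun p => (Φ p).frame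
    coord := fun p => (Φ p).coord
    sum_coord_frame := fun p => (Φ p).sum_coord_frame
    coord_frame_self := fun p => (Φ p).coord_frame_self
    coord_frame_ne := fun p => (Φ p).coord_frame_ne
    continuousOn_transition := by
      intro p q i j t ht
      have hN : (Φ p).dom ∩ E.dom t ∩ (Φ q).dom ∈ nhds t :=
        ((((Φ p).isOpen_dom).inter (E.isOpen_dom t)).inter (Φ q).isOpen_dom).mem_nhds
          ⟨⟨ht.1, E.mem_dom t⟩, ht.2⟩
      have hc : ContinuousOn (fun x => ∑ k, E.coord t k x ((Φ p).frame i x) *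
          (Φ q).coord j x ((h.choose_spec.2 x).codRestrict (E.frame t k x)))
          ((Φ p).dom ∩ E.dom t ∩ (Φ q).dom) := by
        refine continuousOn_finsetSum _ fun k _ => ContinuousOn.mul ?_ ?_
        · exact ((Φ p).continuousOn_frame t i k).mono fun x hx => hx.1
        · exact ((Φ q).continuousOn_coord t k j).mono fun x hx => ⟨hx.1.2, hx.2⟩
      refine ContinuousAt.continuousWithinAt ((hc.continuousAt hN).congr ?_)
      filter_upwards [hN] with x hx
      exact (key p q i j t x hx.1.2).symm
    transition_deg := by
      intro p q x hx i j hij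
      rw [key p q i j x x (E.mem_dom x)]
      refine Finset.sum_eq_zero fun k _ => ?_
      by_cases hk : (Φ p).deg i = E.deg x k
      · rw [(Φ q).coord_deg x x ⟨E.mem_dom x, hx.2⟩ k j (hk ▸ hij), mul_zero]
      · rw [(Φ p).frame_deg x x ⟨hx.1, E.mem_dom x⟩ i k hk, zero_mul] }

end subbundle

/-! ## Tensor products -/
section tensor

variable [AddMonoid A]

/-- The tensor product of two graded vector bundles; degrees add. -/
noncomputable def tensor (E F : GBundle.{u, v, w} A X) : GBundle.{u, v, w} A X where
  fiber x := E.fiber x ⊗[ℂ] F.fiber x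
  dom p := E.dom p ∩ F.dom p
  isOpen_dom p := (E.isOpen_dom p).inter (F.isOpen_dom p)
  mem_dom p := ⟨E.mem_dom p, F.mem_dom p⟩
  idx p := E.idx p × F.idx p
  deg p i := E.deg p i.1 + F.deg p i.2
  frame p i x := E.frame p i.1 x ⊗ₜ[ℂ] F.frame p i.2 x
  coord p i x := (TensorProduct.lid ℂ ℂ).toLinearMap ∘ₗ
    TensorProduct.map (E.coord p i.1 x) (F.coord p i.2 x)
  sum_coord_frame p x hx v := by
    induction v using TensorProduct.induction_on with
    | zero => simp
    | add a b ha hb => simp only [map_add, add_smul, Finset.sum_add_distrib, ha, hb]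
    | tmul a b =>
      conv_rhs => rw [← E.sum_coord_frame p x hx.1 a, ← F.sum_coord_frame p x hx.2 b]
      rw [TensorProduct.sum_tmul, Fintype.sum_prod_type]
      refine Finset.sum_congr rfl fun i _ => ?_
      rw [TensorProduct.tmul_sum]
      refine Finset.sum_congr rfl fun j _ => ?_
      simp [TensorProduct.smul_tmul_smul, -TensorProduct.tmul_smul]
  coord_frame_self p x hx i := by
    simp [E.coord_frame_self p x hx.1, F.coord_frame_self p x hx.2]
  coord_frame_ne p x hx i j hij := by
    by_cases h : i.1 = j.1
    · have h2 : i.2 ≠ j.2 := fun h' => hij (Prod.ext h h')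
      simp [F.coord_frame_ne p x hx.2 _ _ h2]
    · simp [E.coord_frame_ne p x hx.1 _ _ h]
  continuousOn_transition p q i j := by
    have h1 : ContinuousOn (fun x => E.coord q j.1 x (E.frame p i.1 x))
        (E.dom p ∩ F.dom p ∩ (E.dom q ∩ F.dom q)) :=
      (E.continuousOn_transition p q i.1 j.1).mono fun x hx => ⟨hx.1.1, hx.2.1⟩
    have h2 : ContinuousOn (fun x => F.coord q j.2 x (F.frame p i.2 x))
        (E.dom p ∩ F.dom p ∩ (E.dom q ∩ F.dom q)) :=
      (F.continuousOn_transition p q i.2 j.2).mono fun x hx => ⟨hx.1.2, hx.2.2⟩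
    exact (h1.mul h2).congr fun x _ => by simp
  transition_deg p q x hx i j hij := by
    by_cases h : E.deg p i.1 = E.deg q j.1
    · have h2 : F.deg p i.2 ≠ F.deg q j.2 := fun h' => hij (by rw [h, h'])
      simp [F.transition_deg p q x ⟨hx.1.2, hx.2.2⟩ _ _ h2]
    · simp [E.transition_deg p q x ⟨hx.1.1, hx.2.1⟩ _ _ h]

variable {E E' F F' : GBundle.{u, v, w} A X}

theorem IsHom.tensor {f : ∀ x, E.fiber x →ₗ[ℂ] E'.fiber x} {g : ∀ x, F.fiber x →ₗ[ℂ] F'.fiber x}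
    (hf : IsHom E E' f) (hg : IsHom F F' g) :
    IsHom (tensor E F) (tensor E' F') fun x => TensorProduct.map (f x) (g x) := by
  have key : ∀ p q x (i : (GradedK.tensor E F).idx p) (j : (GradedK.tensor E' F').idx q),
      (GradedK.tensor E' F').coord q j x (TensorProduct.map (f x) (g x) ((GradedK.tensor E F).frame p i x)) =
        E'.coord q j.1 x (f x (E.frame p i.1 x)) * F'.coord q j.2 x (g x (F.frame p i.2 x)) :=
    fun p q x i j => rfl
  constructor
  · intro p q i j
    have h1 : ContinuousOn (fun x => E'.coord q j.1 x (f x (E.frame p i.1 x)))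
        (E.dom p ∩ F.dom p ∩ (E'.dom q ∩ F'.dom q)) :=
      (hf.continuousOn p q i.1 j.1).mono fun x hx => ⟨hx.1.1, hx.2.1⟩
    have h2 : ContinuousOn (fun x => F'.coord q j.2 x (g x (F.frame p i.2 x)))
        (E.dom p ∩ F.dom p ∩ (E'.dom q ∩ F'.dom q)) :=
      (hg.continuousOn p q i.2 j.2).mono fun x hx => ⟨hx.1.2, hx.2.2⟩
    exact (h1.mul h2).congr fun x _ => key p q x i j
  · intro p q x hx i j hij
    refine (key p q x i j).trans ?_
    by_cases h : E.deg p i.1 = E'.deg q j.1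
    · have h2 : F.deg p i.2 ≠ F'.deg q j.2 := fun h' => hij (congrArg₂ (· + ·) h h')
      rw [hg.deg p q x ⟨hx.1.2, hx.2.2⟩ _ _ h2, mul_zero]
    · rw [hf.deg p q x ⟨hx.1.1, hx.2.1⟩ _ _ h, zero_mul]

theorem Iso.tensor_congr_left (h : Iso E E') (F : GBundle.{u, v, w} A X) :
    Iso (tensor F E) (tensor F E') := by
  obtain ⟨f, h, h'⟩ := h
  refine ⟨fun x => TensorProduct.congr (LinearEquiv.refl ℂ _) (f x),
    ((IsHom.id F).tensor h).congr fun x v => rfl, ((IsHom.id F).tensor h').congr fun x v => rfl⟩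

theorem prodRight_eq {V V₁ V₂ : Type*} [AddCommGroup V] [Module ℂ V] [AddCommGroup V₁]
    [Module ℂ V₁] [AddCommGroup V₂] [Module ℂ V₂] (a : V ⊗[ℂ] (V₁ × V₂)) :
    TensorProduct.prodRight ℂ ℂ V V₁ V₂ a =
      (TensorProduct.map LinearMap.id (LinearMap.fst ℂ V₁ V₂) a,
        TensorProduct.map LinearMap.id (LinearMap.snd ℂ V₁ V₂) a) := by
  induction a using TensorProduct.induction_on with
  | zero => simp only [map_zero]; rfl
  | add a b ha hb => simp only [map_add, ha, hb, Prod.mk_add_mk]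
  | tmul a b => simp

theorem prodRight_symm_eq {V V₁ V₂ : Type*} [AddCommGroup V] [Module ℂ V] [AddCommGroup V₁]
    [Module ℂ V₁] [AddCommGroup V₂] [Module ℂ V₂] (a : (V ⊗[ℂ] V₁) × (V ⊗[ℂ] V₂)) :
    (TensorProduct.prodRight ℂ ℂ V V₁ V₂).symm a =
      TensorProduct.map LinearMap.id (LinearMap.inl ℂ V₁ V₂) a.1 +
        TensorProduct.map LinearMap.id (LinearMap.inr ℂ V₁ V₂) a.2 := by
  rw [LinearEquiv.symm_apply_eq, prodRight_eq]
  simp only [map_add, ← LinearMap.comp_apply, ← TensorProduct.map_comp]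
  simp

theorem Iso.tensor_directSum (F E E' : GBundle.{u, v, w} A X) :
    Iso (tensor F (directSum E E')) (directSum (tensor F E) (tensor F E')) :=
  ⟨fun x => TensorProduct.prodRight ℂ ℂ (F.fiber x) (E.fiber x) (E'.fiber x),
    IsHom.congr (((IsHom.id F).tensor (IsHom.fst (E := E) (F := E'))).prod
      ((IsHom.id F).tensor (IsHom.snd (E := E) (F := E')))) fun _ v => prodRight_eq v,
    IsHom.congr ((((IsHom.id F).tensor (IsHom.inl (E := E) (F := E'))).comp IsHom.fst).add
      (((IsHom.id F).tensor (IsHom.inr (E := E) (F := E'))).comp IsHom.snd))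
        fun _ v => prodRight_symm_eq v⟩

theorem Iso.tensor_zero (F : GBundle.{u, v, w} A X) :
    Iso (tensor F (zeroBundle A X)) (zeroBundle A X) := by
  have hs : ∀ x, Subsingleton (F.fiber x ⊗[ℂ] PUnit.{v + 1}) := fun x =>
    inferInstance
  refine ⟨fun x => ⟨0, fun _ => 0, fun v => (hs x).elim _ _, fun _ => rfl⟩,
    IsHom.zero, IsHom.zero⟩

/-- Multiplication by the class of `F` on `GK(X)`, that is `[E] ↦ [F ⊗ E]`. -/
noncomputable def GK.tensorLeft (F : GBundle.{u, v, w} A X) :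
    GK.{u, v, w} A X →+ GK.{u, v, w} A X :=
  GK.induced (fun E => GK.of (tensor F E)) (fun _ _ h => GK.of_eq (h.tensor_congr_left F))
    ((GK.of_eq (Iso.tensor_zero F)).trans GK.of_zero)
    (fun E E' => (GK.of_eq (Iso.tensor_directSum F E E')).trans (GK.of_directSum _ _))

end tensor

/-! ## Exterior powers -/
section exterior

variable [AddCommMonoid A]

/-- An auxiliary linear order on the index set of a frame. -/
@[reducible] noncomputable def idxOrder (E : GBundle.{u, v, w} A X) (p : X) : LinearOrder (E.idx p) :=
  LinearOrder.lift' (Fintype.equivFin (E.idx p)) (Fintype.equivFin (E.idx p)).injective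

attribute [local instance] idxOrder

open exteriorPower in
theorem sum_pairingDual {V ι : Type*} [AddCommGroup V] [Module ℂ V] [Fintype ι] [LinearOrder ι]
    (e : ι → V) (c : ι → V →ₗ[ℂ] ℂ) (h : ∀ v, ∑ i, c i v • e i = v) (h1 : ∀ i, c i (e i) = 1)
    (h0 : ∀ i j, i ≠ j → c j (e i) = 0) (k : ℕ) [Fintype (Fin k ↪o ι)] (v : ⋀[ℂ]^k V) :
    ∑ s : Fin k ↪o ι, pairingDual ℂ V k (ιMulti ℂ k fun j => c (s j)) v •
      ιMulti ℂ k (fun j => e (s j)) = v := by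
  classical
  have hspan : Submodule.span ℂ (Set.range e) = ⊤ := by
    rw [eq_top_iff]
    intro v _
    rw [← h v]
    exact Submodule.sum_mem _ fun i _ => Submodule.smul_mem _ _ (Submodule.subset_span ⟨i, rfl⟩)
  let T : ⋀[ℂ]^k V →ₗ[ℂ] ⋀[ℂ]^k V := ∑ s : Fin k ↪o ι,
    (pairingDual ℂ V k (ιMulti ℂ k fun j => c (s j))).smulRight (ιMulti ℂ k fun j => e (s j))
  have hT : T = LinearMap.id := by
    apply LinearMap.ext_on (ιMulti_family_span_of_span ℂ hspan)
    rintro _ ⟨t, rfl⟩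
    simp only [T, LinearMap.coe_sum, Finset.sum_apply, LinearMap.smulRight_apply,
      LinearMap.id_apply]
    rw [Finset.sum_eq_single (Set.powersetCard.ofFinEmbEquiv.symm t)]
    · rw [show (pairingDual ℂ V k (ιMulti ℂ k fun j =>
          c (Set.powersetCard.ofFinEmbEquiv.symm t j))) (ιMulti_family ℂ k e t) = 1 from
        pairingDual_apply_apply_eq_one e c h1 (fun i j h => h0 j i h.symm) k _, one_smul]
      rfl
    · intro s _ hs
      rw [show (pairingDual ℂ V k (ιMulti ℂ k fun j => c (s j))) (ιMulti_family ℂ k e t) = 0 from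
        pairingDual_apply_apply_eq_one_zero e c (fun i j h => h0 j i h.symm) k s _ hs, zero_smul]
    · simp
  have := LinearMap.congr_fun hT v
  simpa [T] using this

open exteriorPower in
/-- The `k`-th exterior power of (the vector bundle underlying) `E`, graded by the sum of the degrees:
`v_1 ∧ ⋯ ∧ v_k` has degree `|v_1| + ⋯ + |v_k|`. No signs from the grading enter here. -/
noncomputable def exteriorPow (E : GBundle.{u, v, w} A X) (k : ℕ) : GBundle.{u, v, w} A X where
  fiber x := ⋀[ℂ]^k (E.fiber x)
  dom := E.dom
  isOpen_dom := E.isOpen_dom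
  mem_dom := E.mem_dom
  idx p := Fin k ↪o E.idx p
  fintype p := Fintype.ofFinite _
  deg p s := ∑ j, E.deg p (s j)
  frame p s x := ιMulti ℂ k fun j => E.frame p (s j) x
  coord p s x := pairingDual ℂ (E.fiber x) k (ιMulti ℂ k fun j => E.coord p (s j) x)
  sum_coord_frame p x hx v := 
    letI := Fintype.ofFinite (Fin k ↪o E.idx p)
    sum_pairingDual (fun i => E.frame p i x) (fun i => E.coord p i x)
      (E.sum_coord_frame p x hx) (E.coord_frame_self p x hx)
      (fun i j h => E.coord_frame_ne p x hx i j h) k v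
  coord_frame_self p x hx s :=
    pairingDual_apply_apply_eq_one (fun i => E.frame p i x) (fun i => E.coord p i x)
      (E.coord_frame_self p x hx) (fun i j h => E.coord_frame_ne p x hx j i h.symm) k s
  coord_frame_ne p x hx s t hst :=
    pairingDual_apply_apply_eq_one_zero (fun i => E.frame p i x) (fun i => E.coord p i x)
      (fun i j h => E.coord_frame_ne p x hx j i h.symm) k t s hst.symm
  continuousOn_transition p q s t := by
    have : ContinuousOn (fun x => (Matrix.of fun i j =>
        E.coord q (t j) x (E.frame p (s i) x) : Matrix (Fin k) (Fin k) ℂ).det)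
        (E.dom p ∩ E.dom q) := by
      refine continuous_id.matrix_det.comp_continuousOn ?_
      exact continuousOn_pi.2 fun i => continuousOn_pi.2 fun j =>
        E.continuousOn_transition p q (s i) (t j)
    exact this.congr fun x _ => pairingDual_ιMulti_ιMulti _ _
  transition_deg p q x hx s t hst := by
    rw [pairingDual_ιMulti_ιMulti, Matrix.det_apply]
    refine Finset.sum_eq_zero fun σ _ => ?_
    have : ∃ i, E.deg p (s (σ i)) ≠ E.deg q (t i) := by
      by_contra! h
      apply hst
      rw [← Equiv.sum_comp σ]
      exact Finset.sum_congr rfl fun i _ => h i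
    obtain ⟨i, hi⟩ := this
    rw [Finset.prod_eq_zero (Finset.mem_univ i) (by simpa using E.transition_deg p q x hx _ _ hi),
      smul_zero]

end exterior


theorem GBundle.linearMap_ext (E : GBundle.{u, v, w} A X) {V : Type*} [AddCommGroup V] [Module ℂ V]
    {x : X} {f g : E.fiber x →ₗ[ℂ] V} (h : ∀ i, f (E.frame x i x) = g (E.frame x i x)) :
    f = g := by
  ext v
  rw [← E.sum_coord_frame x x (E.mem_dom x) v]
  simp [h]


/-! ## Even and odd part

The grading group `A` comes with a homomorphism `par : A → ℤ/2`, the parity of degrees; for `A = ℤ`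
this is reduction mod `2`, for `A = ℤ/2` it is the identity. -/
section parity

variable [AddCommMonoid A] (par : A →+ ZMod 2)

/-- The projection of the fibre at `x` onto its part of parity `ε`. -/
noncomputable def parityProj (E : GBundle.{u, v, w} A X) (ε : ZMod 2) (x : X) :
    E.fiber x →ₗ[ℂ] E.fiber x :=
  ∑ i, if par (E.deg x i) = ε then (E.coord x i x).smulRight (E.frame x i x) else 0

theorem parityProj_frame (E : GBundle.{u, v, w} A X) (ε : ZMod 2) {x q : X} (hx : x ∈ E.dom q)
    (j : E.idx q) : parityProj par E ε x (E.frame q j x) =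
      if par (E.deg q j) = ε then E.frame q j x else 0 := by
  have h1 : ∀ i, (if par (E.deg x i) = ε then (E.coord x i x).smulRight (E.frame x i x) else 0 :
      E.fiber x →ₗ[ℂ] E.fiber x) (E.frame q j x) =
      if par (E.deg q j) = ε then E.coord x i x (E.frame q j x) • E.frame x i x else 0 := by
    intro i
    by_cases h : E.deg q j = E.deg x i
    · rw [h]; split_ifs <;> simp
    · have := E.transition_deg q x x ⟨hx, E.mem_dom x⟩ j i h
      split_ifs <;> simp [this]
  rw [parityProj, LinearMap.sum_apply]
  simp only [h1]
  split_ifs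
  · exact E.sum_coord_frame x x (E.mem_dom x) _
  · simp

theorem parityProj_isHom (E : GBundle.{u, v, w} A X) (ε : ZMod 2) :
    IsHom E E (parityProj par E ε) := by
  constructor
  · intro p q i j
    refine ContinuousOn.congr (f := fun x => if par (E.deg p i) = ε then
      E.coord q j x (E.frame p i x) else 0) ?_ fun x hx => ?_
    · split_ifs
      · exact E.continuousOn_transition p q i j
      · exact continuousOn_const
    · rw [parityProj_frame par E ε hx.1]; split_ifs <;> simp
  · intro p q x hx i j hij
    rw [parityProj_frame par E ε hx.1]
    split_ifs
    · exact E.transition_deg p q x hx i j hij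
    · simp

theorem parityProj_parityProj (E : GBundle.{u, v, w} A X) (ε ε' : ZMod 2) (x : X)
    (v : E.fiber x) : parityProj par E ε x (parityProj par E ε' x v) =
      if ε = ε' then parityProj par E ε x v else 0 := by
  have : parityProj par E ε x ∘ₗ parityProj par E ε' x =
      if ε = ε' then parityProj par E ε x else 0 := by
    refine E.linearMap_ext fun i => ?_
    rw [LinearMap.comp_apply, parityProj_frame par E ε' (E.mem_dom x)]
    by_cases h : ε = ε'
    · subst h
      simp only [if_true]
      split_ifs with h'
      · rfl
      · rw [parityProj_frame par E ε (E.mem_dom x), if_neg h', map_zero]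
    · rw [if_neg h]
      split_ifs with h'
      · rw [parityProj_frame par E ε (E.mem_dom x), if_neg]
        · rfl
        · rw [h']; exact fun h'' => h h''.symm
      · simp
  have h := LinearMap.congr_fun this v
  rw [LinearMap.comp_apply] at h
  rw [h]
  split_ifs <;> rfl

theorem sum_parityProj (E : GBundle.{u, v, w} A X) (x : X) (v : E.fiber x) :
    ∑ ε, parityProj par E ε x v = v := by
  have : ∑ ε, parityProj par E ε x = LinearMap.id := by
    refine E.linearMap_ext fun i => ?_
    rw [LinearMap.sum_apply]
    simp [parityProj_frame par E _ (E.mem_dom x)]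
  simpa using LinearMap.congr_fun this v

theorem parityPart_isSubbundle (E : GBundle.{u, v, w} A X) (ε : ZMod 2) :
    IsSubbundle E fun x => LinearMap.range (parityProj par E ε x) :=
  ⟨parityProj par E ε, parityProj_isHom par E ε, fun x =>
    ⟨fun v => ⟨v, rfl⟩, by rintro _ ⟨v, rfl⟩; rw [parityProj_parityProj, if_pos rfl]⟩⟩

/-- The graded subbundle of `E` that consists of the homogeneous pieces whose degree has parity `ε`. -/
noncomputable def parityPart (E : GBundle.{u, v, w} A X) (ε : ZMod 2) : GBundle.{u, v, w} A X :=
  subbundle E (fun x => LinearMap.range (parityProj par E ε x)) (parityPart_isSubbundle par E ε)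

end parity

/-! ## Adams operations -/
section adams

variable [AddCommMonoid A]

/-- The Adams operation `ψ^n(E)`, `n ≥ 1`, defined from exterior powers by Newton's formula
`ψ^n - Λ^1 ψ^{n-1} + ⋯ + (-1)^{n-1} Λ^{n-1} ψ^1 + (-1)^n n Λ^n = 0`
(the value at `n = 0` is a dummy value). -/
noncomputable def adams (E : GBundle.{u, v, w} A X) : ℕ → GK.{u, v, w} A X
  | 0 => 0
  | n + 1 => ((-1) ^ n * (n + 1) : ℤ) • GK.of (exteriorPow E (n + 1)) +
      ∑ i : Fin n, ((-1) ^ (i : ℕ) : ℤ) •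
        GK.tensorLeft (exteriorPow E (i + 1)) (adams E (n - i))

/-- The graded Adams operation `Gψ^n(E) = ψ^n(E_even) + (-1)^(n-1) ψ^n(E_odd)`, `n ≥ 1`. -/
noncomputable def gradedAdams (par : A →+ ZMod 2) (n : ℕ) (E : GBundle.{u, v, w} A X) :
    GK.{u, v, w} A X :=
  adams (parityPart par E 0) n + ((-1) ^ (n - 1) : ℤ) • adams (parityPart par E 1) n

/-- `L` is a line bundle which is homogeneous of degree `d`. -/
def IsLine (L : GBundle.{u, v, w} A X) (d : A) : Prop :=
  ∀ p, Fintype.card (L.idx p) = 1 ∧ ∀ i, L.deg p i = d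

end adams

/-! ## Equivariant bundles and localization -/
section equivariant

/-- A graded `G`-vector bundle over the `G`-space `M`, where `G` acts on `M` through
`α : G →* (M ≃ₜ M)`. The element `g` acts by linear maps from the fibre at `x` to the fibre at
`y = g x`, the action covers that on `M`, is continuous, and preserves degrees. -/
structure EqBundle (A : Type w) {G : Type*} [Group G] {M : Type u} [TopologicalSpace M]
    (α : G →* (M ≃ₜ M)) extends GBundle.{u, v, w} A M where
  act : ∀ (g : G) {x y : M}, α g x = y → fiber x →ₗ[ℂ] fiber y
  act_one : ∀ {x : M} (h : α 1 x = x) (v : fiber x), act 1 h v = v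
  act_mul : ∀ (g g' : G) {x y z : M} (h' : α g' x = y) (h : α g y = z) (h'' : α (g * g') x = z)
    (v : fiber x), act (g * g') h'' v = act g h (act g' h' v)
  act_isHom : ∀ g : G, IsHom toGBundle (pullback (α g) (α g).continuous toGBundle)
    fun _ => act g rfl

variable {G : Type*} [Group G] {α : G →* (X ≃ₜ X)}

/-- The fixed point set `M^g`. -/
abbrev FixedPts (α : G →* (X ≃ₜ X)) (g : G) : Type u := {x : X // α g x = x}

/-- The restriction of `V` to the fixed point set of `g`. -/
def EqBundle.restrictFixed (V : EqBundle.{u, v, w} A α) (g : G) :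
    GBundle.{u, v, w} A (FixedPts α g) :=
  pullback Subtype.val continuous_subtype_val V.toGBundle

/-- The fibrewise action of `g` on the restriction of `V` to the fixed point set of `g`. -/
def EqBundle.fixedAct (V : EqBundle.{u, v, w} A α) (g : G) (x : FixedPts α g) :
    Module.End ℂ ((V.restrictFixed g).fiber x) :=
  V.act g x.2

theorem EqBundle.fixedAct_isHom (V : EqBundle.{u, v, w} A α) (g : G) :
    IsHom (V.restrictFixed g) (V.restrictFixed g) (V.fixedAct g) := by
  have key : ∀ (x y : X) (h : α g x = y) (q : X) (j : V.idx q) (v : V.fiber x),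
      V.coord q j y (V.act g h v) = V.coord q j (α g x) (V.act g rfl v) := by
    intro x y h q j v; subst h; rfl
  have hc : ∀ p q i j, ContinuousOn (fun x => V.coord q j (α g x) (V.act g rfl (V.frame p i x)))
      (V.dom p ∩ α g ⁻¹' V.dom q) := by
    intro p q
    obtain ⟨q, rfl⟩ := (α g).surjective q
    exact (V.act_isHom g).continuousOn p q
  have hd : ∀ p q, ∀ x ∈ V.dom p ∩ α g ⁻¹' V.dom q, ∀ i j, V.deg p i ≠ V.deg q j →
      V.coord q j (α g x) (V.act g rfl (V.frame p i x)) = 0 := by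
    intro p q
    obtain ⟨q, rfl⟩ := (α g).surjective q
    exact (V.act_isHom g).deg p q
  have hmem : ∀ (x : FixedPts α g) (q : X), (x : X) ∈ V.dom q → α g x ∈ V.dom q :=
    fun x q h => x.2.symm ▸ h
  constructor
  · intro p q i j
    refine ContinuousOn.congr (((hc p q i j).comp continuous_subtype_val.continuousOn)
      fun x hx => ⟨hx.1, hmem x q hx.2⟩) fun x _ => ?_
    exact key x x x.2 q j _
  · intro p q x hx i j hij
    exact (key x x x.2 q j _).trans (hd p q x ⟨hx.1, hmem x q hx.2⟩ i j hij)

theorem EqBundle.fixedAct_pow_orderOf (V : EqBundle.{u, v, w} A α) (g : G)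
    (x : FixedPts α g) : V.fixedAct g x ^ orderOf g = 1 := by
  have key : ∀ (k : ℕ) (h : α (g ^ k) x = x) (v : V.fiber x),
      (V.fixedAct g x ^ k) v = V.act (g ^ k) h v := by
    intro k
    induction k with
    | zero =>
      intro h v
      have e : ∀ (g' : G) (hg : g' = 1) (h : α g' x = x) (v : V.fiber x), V.act g' h v = v := by
        intro g' hg h v; subst hg; exact V.act_one h v
      rw [e _ (pow_zero g) h v, pow_zero]; rfl
    | succ k ih =>
      intro h v
      have hk : α (g ^ k) x = x := by
        rw [map_pow]
        clear ih h
        induction k with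
        | zero => rfl
        | succ k ih =>
          rw [pow_succ]
          change (α g ^ k) (α g x) = x
          rw [x.2, ih]
      have e : ∀ (g' : G) (hg : g' = g ^ k * g) (h : α g' x = x) (v : V.fiber x),
          V.act g' h v = V.act (g ^ k) hk (V.act g x.2 v) := by
        intro g' hg h v; subst hg; exact V.act_mul _ _ _ _ _ v
      rw [e _ (pow_succ g k) h v, pow_succ, ← ih hk]; rfl
  ext v
  have h1 : α (g ^ orderOf g) x = x := by rw [pow_orderOf_eq_one, map_one]; rfl
  have e : ∀ (g' : G) (hg : g' = 1) (h : α g' x = x) (v : V.fiber x), V.act g' h v = v := by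
    intro g' hg h v; subst hg; exact V.act_one h v
  exact (key _ h1 v).trans (e _ (pow_orderOf_eq_one g) h1 v)

theorem eigenspace_isSubbundle (E : GBundle.{u, v, w} A X) (T : ∀ x, Module.End ℂ (E.fiber x))
    (hT : IsHom E E T) {m : ℕ} (hm : 0 < m) (hTm : ∀ x, T x ^ m = 1) (ξ : ℂ) :
    IsSubbundle E fun x => Module.End.eigenspace (T x) ξ := by
  have hpow : ∀ x (v : E.fiber x), T x v = ξ • v → ∀ k : ℕ, (T x ^ k) v = ξ ^ k • v := by
    intro x v hv k
    induction k with
    | zero => simp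
    | succ k ih => rw [pow_succ, Module.End.mul_apply, hv, map_smul, ih, smul_smul, pow_succ']
  by_cases hξ : ξ ^ m = 1
  · have hξ0 : ξ ≠ 0 := by
      rintro rfl
      rw [zero_pow hm.ne'] at hξ
      exact zero_ne_one hξ
    refine ⟨fun x => (m : ℂ)⁻¹ • ∑ k ∈ Finset.range m, (ξ⁻¹) ^ k • (T x ^ k),
      (IsHom.sum _ fun k => (hT.pow k).smul _).smul _, fun x => ⟨fun v => ?_, fun v hv => ?_⟩⟩
    · rw [Module.End.mem_eigenspace_iff]
      let f : ℕ → E.fiber x := fun k => (ξ⁻¹) ^ k • (T x ^ k) v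
      have h1 : ∀ k, T x (f k) = ξ • f (k + 1) := by
        intro k
        simp only [f, map_smul, smul_smul, pow_succ' (T x), Module.End.mul_apply, pow_succ' ξ⁻¹]
        rw [← mul_assoc, mul_inv_cancel₀ hξ0, one_mul]
      have h2 : ∑ k ∈ Finset.range m, f (k + 1) = ∑ k ∈ Finset.range m, f k := by
        have h3 := Finset.sum_range_succ f m
        rw [Finset.sum_range_succ' f m] at h3
        have h4 : f m = f 0 := by simp [f, hTm, hξ]
        rw [h4] at h3
        exact add_right_cancel h3
      have h5 : ((m : ℂ)⁻¹ • ∑ k ∈ Finset.range m, (ξ⁻¹) ^ k • (T x ^ k)) v =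
          (m : ℂ)⁻¹ • ∑ k ∈ Finset.range m, f k := by simp [f]
      rw [h5, map_smul, map_sum, smul_comm ξ]
      simp only [h1]
      rw [← Finset.smul_sum, h2]
    · rw [Module.End.mem_eigenspace_iff] at hv
      have h5 : ((m : ℂ)⁻¹ • ∑ k ∈ Finset.range m, (ξ⁻¹) ^ k • (T x ^ k)) v =
          (m : ℂ)⁻¹ • ∑ k ∈ Finset.range m, (ξ⁻¹) ^ k • (T x ^ k) v := by simp
      rw [h5]
      have h6 : ∀ k, (ξ⁻¹) ^ k • (T x ^ k) v = v := by
        intro k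
        rw [hpow x v hv k, smul_smul, ← mul_pow, inv_mul_cancel₀ hξ0, one_pow, one_smul]
      simp only [h6, Finset.sum_const, Finset.card_range]
      rw [← Nat.cast_smul_eq_nsmul ℂ, smul_smul, inv_mul_cancel₀ (by exact_mod_cast hm.ne'),
        one_smul]
  · refine ⟨fun _ => 0, IsHom.zero, fun x => ⟨fun v => Submodule.zero_mem _, fun v hv => ?_⟩⟩
    rw [Module.End.mem_eigenspace_iff] at hv
    have h1 := hpow x v hv m
    rw [hTm] at h1
    by_contra h
    have h2 : (1 - ξ ^ m) • v = 0 := by rw [sub_smul, one_smul, ← h1]; simp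
    rcases smul_eq_zero.1 h2 with h3 | h3
    · exact hξ (sub_eq_zero.1 h3).symm
    · exact h h3.symm

/-- The eigenbundle `V_ξ` over `M^g` of the fibrewise action of `g`, for `ξ ∈ ℂ`. -/
noncomputable def EqBundle.eigenbundle [Finite G] (V : EqBundle.{u, v, w} A α) (g : G) (ξ : ℂ) :
    GBundle.{u, v, w} A (FixedPts α g) :=
  subbundle (V.restrictFixed g) (fun x => Module.End.eigenspace (V.fixedAct g x) ξ)
    (eigenspace_isSubbundle _ _ (V.fixedAct_isHom g) (orderOf_pos g)
      (V.fixedAct_pow_orderOf g) ξ)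

/-- `φ_g(V) = ∑_ξ ξ V_ξ` in `GK(M^g) ⊗ ℂ`, where `V_ξ` are the eigenbundles of the fibrewise action of
`g` on the restriction of `V` to `M^g`. All eigenvalues `ξ` are roots of unity of order dividing the
order of `g`. -/
noncomputable def phi [Finite G] (g : G) (V : EqBundle.{u, v, w} A α) :
    GK.{u, v, w} A (FixedPts α g) ⊗[ℤ] ℂ :=
  ∑ ξ ∈ Polynomial.nthRootsFinset (orderOf g) (1 : ℂ), GK.of (V.eigenbundle g ξ) ⊗ₜ[ℤ] ξ

/-- The homomorphism `φ^* : GK(Y) ⊗ ℂ → GK(X) ⊗ ℂ` induced by a continuous map `φ : X → Y`. -/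
noncomputable def GK.pullbackC {Y : Type u} [TopologicalSpace Y] (φ : X → Y) (hφ : Continuous φ) :
    GK.{u, v, w} A Y ⊗[ℤ] ℂ →ₗ[ℤ] GK.{u, v, w} A X ⊗[ℤ] ℂ :=
  LinearMap.rTensor ℂ (GK.pullback φ hφ).toIntLinearMap

end equivariant

/-! ## Tensor powers with the graded anti-symmetric action -/
section sign

/-- The Koszul sign of moving `v_1 ⊗ ⋯ ⊗ v_n`, with `|v_i|` of parity `ε i`, to the tensor with `v_i`
in position `σ i`: each pair of vectors `v_i`, `v_j` whose order is changed contributes a factor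
`(-1)^(|v_i| |v_j|)`. -/
def koszulSign {n : ℕ} (σ : Equiv.Perm (Fin n)) (ε : Fin n → ZMod 2) : ℤ :=
  ∏ ij : Fin n × Fin n, if ij.1 < ij.2 ∧ σ ij.2 < σ ij.1 then
    (-1) ^ ((ε ij.1).val * (ε ij.2).val) else 1

theorem koszulSign_one {n : ℕ} (ε : Fin n → ZMod 2) : koszulSign 1 ε = 1 := by
  refine Finset.prod_eq_one fun ij _ => if_neg ?_
  rintro ⟨h, h'⟩
  exact lt_asymm h h'

theorem koszulSign_mul {n : ℕ} (σ τ : Equiv.Perm (Fin n)) (ε : Fin n → ZMod 2) :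
    koszulSign (σ * τ) ε = koszulSign σ (fun i => ε (τ⁻¹ i)) * koszulSign τ ε := by
  let s : Fin n → Fin n → ℤ := fun i j => (-1) ^ ((ε i).val * (ε j).val)
  have hs : ∀ i j, s i j = s j i := fun i j => by simp only [s, mul_comm]
  have hss : ∀ i j, s i j * s i j = 1 := fun i j => by
    simp only [s, ← mul_pow]; norm_num
  have h1 : koszulSign σ (fun i => ε (τ⁻¹ i)) =
      ∏ ij : Fin n × Fin n, if τ ij.1 < τ ij.2 ∧ σ (τ ij.2) < σ (τ ij.1) then
        s ij.1 ij.2 else 1 := by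
    rw [koszulSign, ← (Equiv.prodCongr τ τ).prod_comp]
    simp [s]
  have h2 : (∏ ij : Fin n × Fin n, if τ ij.1 < τ ij.2 ∧ σ (τ ij.2) < σ (τ ij.1) then
        s ij.1 ij.2 else 1) =
      (∏ ij : Fin n × Fin n, if ij.1 < ij.2 ∧ τ ij.1 < τ ij.2 ∧ σ (τ ij.2) < σ (τ ij.1) then
        s ij.1 ij.2 else 1) *
      ∏ ij : Fin n × Fin n, if ij.2 < ij.1 ∧ τ ij.1 < τ ij.2 ∧ σ (τ ij.2) < σ (τ ij.1) then
        s ij.1 ij.2 else 1 := by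
    rw [← Finset.prod_mul_distrib]
    refine Finset.prod_congr rfl fun ij _ => ?_
    rcases lt_trichotomy ij.1 ij.2 with h | h | h
    · simp [h, h.not_gt]
    · simp [h]
    · simp [h, h.not_gt]
  have h3 : (∏ ij : Fin n × Fin n, if ij.2 < ij.1 ∧ τ ij.1 < τ ij.2 ∧ σ (τ ij.2) < σ (τ ij.1) then
        s ij.1 ij.2 else 1) =
      ∏ ij : Fin n × Fin n, if ij.1 < ij.2 ∧ τ ij.2 < τ ij.1 ∧ σ (τ ij.1) < σ (τ ij.2) then
        s ij.1 ij.2 else 1 := by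
    rw [← (Equiv.prodComm (Fin n) (Fin n)).prod_comp]
    refine Finset.prod_congr rfl fun ij _ => ?_
    simp [hs ij.2 ij.1]
  rw [h1, h2, h3, koszulSign, koszulSign, ← Finset.prod_mul_distrib, ← Finset.prod_mul_distrib]
  refine Finset.prod_congr rfl fun ij _ => ?_
  change (if ij.1 < ij.2 ∧ σ (τ ij.2) < σ (τ ij.1) then s ij.1 ij.2 else 1) = _ *
    (if ij.1 < ij.2 ∧ τ ij.2 < τ ij.1 then s ij.1 ij.2 else 1)
  by_cases h : ij.1 < ij.2
  · have hτ : τ ij.1 ≠ τ ij.2 := fun h' => h.ne (τ.injective h')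
    have hσ : σ (τ ij.1) ≠ σ (τ ij.2) := fun h' => hτ (σ.injective h')
    rcases lt_or_gt_of_ne hτ with h4 | h4 <;> rcases lt_or_gt_of_ne hσ with h5 | h5 <;>
      simp [h, h4, h5, h4.not_gt, h5.not_gt, hss]
  · simp [h]

end sign

section box

variable {Y : Type u} [TopologicalSpace Y]

theorem sum_tprod {ι : Type} [Fintype ι] [DecidableEq ι] {κ : ι → Type} [∀ i, Fintype (κ i)]
    {V : ι → Type v} [∀ i, AddCommGroup (V i)] [∀ i, Module ℂ (V i)]
    (e : ∀ i, κ i → V i) (c : ∀ i, κ i → V i →ₗ[ℂ] ℂ)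
    (h : ∀ i v, ∑ k, c i k v • e i k = v) (v : ⨂[ℂ] i, V i) :
    ∑ s : (∀ i, κ i), PiTensorProduct.lift ((MultilinearMap.mkPiAlgebra ℂ ι ℂ).compLinearMap
      fun i => c i (s i)) v • PiTensorProduct.tprod ℂ (fun i => e i (s i)) = v := by
  classical
  induction v using PiTensorProduct.induction_on with
  | add a b ha hb => simp only [map_add, add_smul, Finset.sum_add_distrib, ha, hb]
  | smul_tprod r m =>
    simp only [map_smul, smul_assoc, ← Finset.smul_sum]
    congr 1
    conv_rhs => rw [show m = fun i => ∑ k, c i k (m i) • e i k from funext fun i => (h i _).symm,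
      MultilinearMap.map_sum]
    refine Finset.sum_congr rfl fun s _ => ?_
    rw [MultilinearMap.map_smul_univ, PiTensorProduct.lift.tprod]
    simp

/-- The graded bundle `p_1^* E ⊗ ⋯ ⊗ p_n^* E` on `Y`, for continuous maps `p_i : Y → X`. -/
noncomputable def box [AddCommMonoid A] {n : ℕ} (E : GBundle.{u, v, w} A X) (p : Fin n → Y → X)
    (hp : ∀ i, Continuous (p i)) : GBundle.{u, v, w} A Y where
  fiber y := ⨂[ℂ] i, E.fiber (p i y)
  dom q := {y | ∀ i, p i y ∈ E.dom (p i q)}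
  isOpen_dom q := by
    rw [Set.ofPred_forall]
    exact isOpen_iInter_of_finite fun i => (E.isOpen_dom _).preimage (hp i)
  mem_dom q i := E.mem_dom _
  idx q := ∀ i, E.idx (p i q)
  deg q s := ∑ i, E.deg (p i q) (s i)
  frame q s y := PiTensorProduct.tprod ℂ fun i => E.frame (p i q) (s i) (p i y)
  coord q s y := PiTensorProduct.lift ((MultilinearMap.mkPiAlgebra ℂ (Fin n) ℂ).compLinearMap
      fun i => E.coord (p i q) (s i) (p i y))
  sum_coord_frame q y hy v := sum_tprod (fun i k => E.frame (p i q) k (p i y))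
    (fun i k => E.coord (p i q) k (p i y)) (fun i => E.sum_coord_frame _ _ (hy i)) v
  coord_frame_self q y hy s := by
    simp [PiTensorProduct.lift.tprod, E.coord_frame_self _ _ (hy _)]
  coord_frame_ne q y hy s t hst := by
    obtain ⟨i, hi⟩ := Function.ne_iff.1 hst
    rw [PiTensorProduct.lift.tprod]
    exact Finset.prod_eq_zero (Finset.mem_univ i) (E.coord_frame_ne _ _ (hy i) _ _ hi)
  continuousOn_transition q q' s t := by
    have : ContinuousOn (fun y => ∏ i, E.coord (p i q') (t i) (p i y)
        (E.frame (p i q) (s i) (p i y)))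
        ({y | ∀ i, p i y ∈ E.dom (p i q)} ∩ {y | ∀ i, p i y ∈ E.dom (p i q')}) :=
      continuousOn_finsetProd _ fun i _ =>
        (E.continuousOn_transition (p i q) (p i q') (s i) (t i)).comp (hp i).continuousOn
          fun y hy => ⟨hy.1 i, hy.2 i⟩
    exact this.congr fun y _ => by rw [PiTensorProduct.lift.tprod]; simp
  transition_deg q q' y hy s t hst := by
    have : ∃ i, E.deg (p i q) (s i) ≠ E.deg (p i q') (t i) := by
      by_contra! h
      exact hst (Finset.sum_congr rfl fun i _ => h i)
    obtain ⟨i, hi⟩ := this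
    rw [PiTensorProduct.lift.tprod]
    exact Finset.prod_eq_zero (Finset.mem_univ i)
      (E.transition_deg _ _ _ ⟨hy.1 i, hy.2 i⟩ _ _ hi)

/-- The identification of the fibres at equal points. -/
def fiberCast (E : GBundle.{u, v, w} A X) {x y : X} (h : x = y) : E.fiber x →ₗ[ℂ] E.fiber y :=
  h ▸ LinearMap.id

theorem fiberCast_trans (E : GBundle.{u, v, w} A X) {x y z : X} (h : x = y) (h' : y = z)
    (v : E.fiber x) : fiberCast E h' (fiberCast E h v) = fiberCast E (h.trans h') v := by
  subst h h'; rfl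

theorem coord_fiberCast (E : GBundle.{u, v, w} A X) {x y : X} (h : x = y) (q : X) (j : E.idx q)
    (v : E.fiber x) : E.coord q j y (fiberCast E h v) = E.coord q j x v := by
  subst h; rfl

variable [AddCommMonoid A] (par : A →+ ZMod 2)

theorem parityProj_fiberCast (E : GBundle.{u, v, w} A X) {x y : X} (h : x = y) (ε : ZMod 2)
    (v : E.fiber x) : parityProj par E ε y (fiberCast E h v) =
      fiberCast E h (parityProj par E ε x v) := by
  subst h; rfl

variable {n : ℕ} (E : GBundle.{u, v, w} A X) (p : Fin n → Y → X)

/-- The graded anti-symmetric action of `σ`, on homogeneous vectors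
`v_1 ⊗ ⋯ ⊗ v_n ↦ ± v_{σ⁻¹(1)} ⊗ ⋯ ⊗ v_{σ⁻¹(n)}` with the Koszul sign (see `boxAct_tprod`), from the
fibre of `p_1^* E ⊗ ⋯ ⊗ p_n^* E` at `y` to the fibre at a point `z` with `p_i(z) = p_{σ⁻¹(i)}(y)`. -/
noncomputable def boxAct (σ : Equiv.Perm (Fin n)) {y z : Y} (h : ∀ i, p (σ⁻¹ i) y = p i z) :
    (⨂[ℂ] i, E.fiber (p i y)) →ₗ[ℂ] ⨂[ℂ] i, E.fiber (p i z) :=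
  ∑ ε : Fin n → ZMod 2, (koszulSign σ ε : ℂ) •
    (PiTensorProduct.map (fun i => fiberCast E (h i)) ∘ₗ
      (PiTensorProduct.reindex ℂ (fun i => E.fiber (p i y)) σ).toLinearMap ∘ₗ
      PiTensorProduct.map fun i => parityProj par E (ε i) (p i y))

theorem boxAct_tprod (σ : Equiv.Perm (Fin n)) {y z : Y} (h : ∀ i, p (σ⁻¹ i) y = p i z)
    (ε : Fin n → ZMod 2) (v : ∀ i, E.fiber (p i y))
    (hv : ∀ i, parityProj par E (ε i) (p i y) (v i) = v i) :
    boxAct par E p σ h (PiTensorProduct.tprod ℂ v) =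
      (koszulSign σ ε : ℂ) • PiTensorProduct.tprod ℂ fun i => fiberCast E (h i) (v (σ⁻¹ i)) := by
  have h1 : ∀ ε' : Fin n → ZMod 2, (PiTensorProduct.map fun i => parityProj par E (ε' i) (p i y))
      (PiTensorProduct.tprod ℂ v) = if ε' = ε then PiTensorProduct.tprod ℂ v else 0 := by
    intro ε'
    rw [PiTensorProduct.map_tprod]
    split_ifs with h'
    · subst h'; exact congrArg _ (funext hv)
    · obtain ⟨i, hi⟩ := Function.ne_iff.1 h'
      refine MultilinearMap.map_coord_zero _ i ?_
      rw [← hv i, parityProj_parityProj, if_neg hi]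
  rw [boxAct, LinearMap.sum_apply, Finset.sum_eq_single ε]
  · rw [LinearMap.smul_apply, LinearMap.comp_apply, LinearMap.comp_apply, h1, if_pos rfl,
      LinearEquiv.coe_coe, PiTensorProduct.reindex_tprod, PiTensorProduct.map_tprod]
    rfl
  · intro ε' _ hε'
    rw [LinearMap.smul_apply, LinearMap.comp_apply, LinearMap.comp_apply, h1, if_neg hε']
    simp
  · simp

theorem box_linearMap_ext {y : Y} {V : Type*} [AddCommGroup V] [Module ℂ V]
    {f g : (⨂[ℂ] i, E.fiber (p i y)) →ₗ[ℂ] V}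
    (h : ∀ (ε : Fin n → ZMod 2) (v : ∀ i, E.fiber (p i y)),
      (∀ i, parityProj par E (ε i) (p i y) (v i) = v i) →
      f (PiTensorProduct.tprod ℂ v) = g (PiTensorProduct.tprod ℂ v)) : f = g := by
  refine PiTensorProduct.ext (MultilinearMap.ext fun v => ?_)
  simp only [LinearMap.compMultilinearMap_apply]
  have : PiTensorProduct.tprod ℂ v = ∑ ε : Fin n → ZMod 2, PiTensorProduct.tprod ℂ fun i =>
      parityProj par E (ε i) (p i y) (v i) := by
    rw [← MultilinearMap.map_sum (PiTensorProduct.tprod ℂ)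
      (fun i (ε : ZMod 2) => parityProj par E ε (p i y) (v i))]
    exact congrArg _ (funext fun i => (sum_parityProj par E _ _).symm)
  rw [this, map_sum, map_sum]
  exact Finset.sum_congr rfl fun ε _ => h ε _ fun i => by
    rw [parityProj_parityProj, if_pos rfl]

variable (hp : ∀ i, Continuous (p i)) (β : Equiv.Perm (Fin n) →* (Y ≃ₜ Y))
  (hβ : ∀ σ i y, p i (β σ y) = p (σ⁻¹ i) y)

theorem box_cond (β : Equiv.Perm (Fin n) →* (Y ≃ₜ Y))
    (hβ : ∀ σ i y, p i (β σ y) = p (σ⁻¹ i) y) (σ : Equiv.Perm (Fin n)) {y z : Y} (h : β σ y = z) (i : Fin n) :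
    p (σ⁻¹ i) y = p i z := by
  rw [← h, hβ]

/-- `p_1^* E ⊗ ⋯ ⊗ p_n^* E` with the graded anti-symmetric action, as a graded `S_n`-bundle. -/
noncomputable def boxEq : EqBundle.{u, v, w} A β where
  toGBundle := box E p hp
  act σ _ _ h := boxAct par E p σ (box_cond p β hβ σ h)
  act_one {y} h v := by
    have : boxAct par E p 1 (box_cond p β hβ 1 h) = LinearMap.id := by
      refine box_linearMap_ext par E p fun ε v hv => ?_
      rw [boxAct_tprod par E p _ _ ε v hv, koszulSign_one]
      simp only [Int.cast_one, one_smul]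
      rfl
    exact LinearMap.congr_fun this v
  act_mul σ τ x y z h' h h'' v := by
    have : boxAct par E p (σ * τ) (box_cond p β hβ (σ * τ) h'') =
        boxAct par E p σ (box_cond p β hβ σ h) ∘ₗ boxAct par E p τ (box_cond p β hβ τ h') := by
      refine box_linearMap_ext par E p fun ε v hv => ?_
      rw [LinearMap.comp_apply, boxAct_tprod par E p _ _ ε v hv, boxAct_tprod par E p _ _ ε v hv,
        map_smul, boxAct_tprod par E p _ _ (fun i => ε (τ⁻¹ i)) _ fun i => by
          rw [parityProj_fiberCast, hv], smul_smul, koszulSign_mul, Int.cast_mul, mul_comm]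
      congr 2
      funext i
      rw [fiberCast_trans]
      rfl
    exact LinearMap.congr_fun this v
  act_isHom σ := by
    have key : ∀ q q' y (s : (box E p hp).idx q) (t : (box E p hp).idx (β σ q')),
        y ∈ (box E p hp).dom q →
        (box E p hp).coord (β σ q') t (β σ y) (boxAct par E p σ (box_cond p β hβ σ rfl)
          ((box E p hp).frame q s y)) =
        (koszulSign σ fun i => par (E.deg (p i q) (s i)) : ℂ) *
          ∏ i, E.coord (p i (β σ q')) (t i) (p (σ⁻¹ i) y)
            (E.frame (p (σ⁻¹ i) q) (s (σ⁻¹ i)) (p (σ⁻¹ i) y)) := by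
      intro q q' y s t hy
      have h1 : boxAct par E p σ (box_cond p β hβ σ (rfl : β σ y = β σ y))
          ((box E p hp).frame q s y) = _ :=
        boxAct_tprod par E p σ _ (fun i => par (E.deg (p i q) (s i))) _ fun i => by
          rw [parityProj_frame par E _ (hy i), if_pos rfl]
      rw [h1]
      refine (map_smul (PiTensorProduct.lift ((MultilinearMap.mkPiAlgebra ℂ (Fin n) ℂ).compLinearMap
        fun i => E.coord (p i (β σ q')) (t i) (p i (β σ y)))) _ _).trans ?_
      rw [smul_eq_mul, PiTensorProduct.lift.tprod]
      simp only [MultilinearMap.compLinearMap_apply, MultilinearMap.mkPiAlgebra_apply,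
        coord_fiberCast]
    have hmem : ∀ y q' , β σ y ∈ (box E p hp).dom (β σ q') → ∀ i,
        p (σ⁻¹ i) y ∈ E.dom (p i (β σ q')) := fun y q' h i => by
      rw [← hβ]; exact h i
    constructor
    · intro q q' s t
      have : ContinuousOn (fun y => (koszulSign σ fun i => par (E.deg (p i q) (s i)) : ℂ) *
          ∏ i, E.coord (p i (β σ q')) (t i) (p (σ⁻¹ i) y)
            (E.frame (p (σ⁻¹ i) q) (s (σ⁻¹ i)) (p (σ⁻¹ i) y)))
          ((box E p hp).dom q ∩ (pullback (β σ) (β σ).continuous (box E p hp)).dom q') := by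
        refine continuousOn_const.mul (continuousOn_finsetProd _ fun i _ => ?_)
        exact (E.continuousOn_transition _ _ (s (σ⁻¹ i)) (t i)).comp (hp _).continuousOn
          fun y hy => ⟨hy.1 _, hmem y q' hy.2 i⟩
      exact this.congr fun y hy => key q q' y s t hy.1
    · intro q q' y hy s t hst
      refine (key q q' y s t hy.1).trans ?_
      have : ∃ i, E.deg (p (σ⁻¹ i) q) (s (σ⁻¹ i)) ≠ E.deg (p i (β σ q')) (t i) := by
        by_contra! h
        apply hst
        change ∑ i, E.deg (p i q) (s i) = ∑ i, E.deg (p i (β σ q')) (t i)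
        rw [← Equiv.sum_comp σ⁻¹]
        exact Finset.sum_congr rfl fun i _ => h i
      obtain ⟨i, hi⟩ := this
      rw [Finset.prod_eq_zero (Finset.mem_univ i)
        (E.transition_deg _ _ _ ⟨hy.1 _, hmem y q' hy.2 i⟩ _ _ hi), mul_zero]

end box

section final

/-- The action `(σ x)_i = x_{σ⁻¹(i)}` of `S_n` on `X^n`. -/
def permAction (n : ℕ) (X : Type u) [TopologicalSpace X] :
    Equiv.Perm (Fin n) →* ((Fin n → X) ≃ₜ (Fin n → X)) where
  toFun σ :=
    { toFun := fun x i => x (σ⁻¹ i)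
      invFun := fun x i => x (σ i)
      left_inv := fun x => by simp
      right_inv := fun x => by simp
      continuous_toFun := by fun_prop
      continuous_invFun := by fun_prop }
  map_one' := rfl
  map_mul' σ τ := by ext x i; simp [mul_inv_rev]

variable [AddCommMonoid A] (par : A →+ ZMod 2) (n : ℕ)

/-- The external tensor power `E^{⊠ n}` with the graded anti-symmetric action of `S_n`, a graded
`S_n`-bundle on `X^n`. -/
noncomputable def extTensorPow (E : GBundle.{u, v, w} A X) :
    EqBundle.{u, v, w} A (permAction n X) :=
  boxEq par E (fun i x => x i) (fun i => continuous_apply i) (permAction n X) fun _ _ _ => rfl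

/-- The tensor power `E^{⊗ n}` with the graded anti-symmetric action of `S_n`, a graded `S_n`-bundle
on `X` with the trivial action; its fibre at `x` is `⨂[ℂ] i : Fin n, E.fiber x`. -/
noncomputable def tensorPow (E : GBundle.{u, v, w} A X) :
    EqBundle.{u, v, w} A (1 : Equiv.Perm (Fin n) →* (X ≃ₜ X)) :=
  boxEq par E (fun _ x => x) (fun _ => continuous_id) 1 fun _ _ _ => rfl

/-- The identification of `X` with the fixed point set of `g` for the trivial action on `X`. -/
def toFixed {G : Type*} [Group G] (g : G) : X → FixedPts (1 : G →* (X ≃ₜ X)) g :=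
  fun x => ⟨x, rfl⟩

/-- The diagonal `x ↦ (x, …, x)`, as a map to the fixed point set of `σ` on `X^n`. -/
def diag (σ : Equiv.Perm (Fin n)) : X → FixedPts (permAction n X) σ := fun x => ⟨fun _ => x, rfl⟩

theorem continuous_toFixed {G : Type*} [Group G] (g : G) : Continuous (toFixed (X := X) g) :=
  continuous_id.subtype_mk _

theorem continuous_diag (σ : Equiv.Perm (Fin n)) : Continuous (diag (X := X) n σ) :=
  (continuous_pi fun _ => continuous_id).subtype_mk _

end final

end GradedK

/-! Identity 1. Let T be the signed rotation of E^{⊗n}. Pulled back to X, both φ-classes become the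
sum over n-th roots of unity ξ of ξ times the class of the ξ-eigenbundle of T (`pullbackC_phi`). The
tensor power splits into summands indexed by parity patterns in (ℤ/2)^n, which T permutes
cyclically. On the sum of the patterns with k odd entries, let S act by ζ^(sum of the odd
positions), where ζ is a primitive n-th root of unity. Conjugating by S turns T into ζ^k T, so the
eigenbundles for ξ and ζ^(-k) ξ are isomorphic there. The weighted sum s therefore satisfies s = ζ^k
s, and it vanishes for 0 < k < n (`IsIdemInvariant.sum_smul_signedRotation`). Only the purely even
and purely odd patterns remain; T is the unsigned rotation on the first and (-1)^(n-1) times it on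
the second (`idemClass_eigenIdem_parityEnd`).

It remains to show that the unsigned rotation computes ψ^n (`rotClass_eq_adams`), and this uses no
splitting principle. The map sending an idempotent of ℂ[S_n] to the class of its image in E^{⊗n} is
additive on orthogonal idempotents and takes the same value on ab and ba. By Artin–Wedderburn such
an invariant is the restriction of a linear trace τ with values in ℂ ⊗ GK
(`IsIdemInvariant.exists_trace`). Since the rotation is the sum of ξ times its spectral projectors,
its trace is the weighted sum of eigenbundles. The trace of the antisymmetrizer is the class of Λ^n,
and the trace of the antisymmetrizer of S_m times a disjoint k-cycle is the product of Λ^m with the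
rotation class of E^{⊗k} (`idemClass_block`). Newton's formula for ψ^n thereby becomes an identity
between values of an arbitrary class function on S_n (`newton_classFunction`), proved by multiplying
a cycle with transpositions that meet it in one point.

Identity 2 is asserted in GK itself, where there may be torsion, so it is not read off from identity
1. For a line bundle L, Λ^{k+1}(F ⊕ L) is Λ^{k+1}F ⊕ L ⊗ Λ^k F. Hence multiplication by Λ^k of a sum
of lines is the k-th elementary symmetric polynomial in the commuting operators "multiply by L_j"
(`tensorLeft_exteriorPow_eq_esymm`), and the classical Newton identities turn the recursion for ψ^n
into the power sum (`adams_eq_sum`). Applying this to the lines of each parity gives the signs. -/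

namespace GradedK

/-! ### Additive invariants of idempotents and traces on semisimple algebras. -/

section idempotents

/-- An additive invariant of idempotents: it is additive on sums of orthogonal idempotents and takes
the same value on the idempotents `a * b` and `b * a`. -/
structure IsIdemInvariant {R V : Type*} [Ring R] [AddCommGroup V] (ν : R → V) : Prop where
  add : ∀ e f, IsIdempotentElem e → IsIdempotentElem f → e * f = 0 → f * e = 0 →
    ν (e + f) = ν e + ν f
  comm : ∀ a b, IsIdempotentElem (a * b) → IsIdempotentElem (b * a) → ν (a * b) = ν (b * a)

namespace IsIdemInvariant

variable {R V : Type*} [Ring R] [AddCommGroup V] {ν : R → V}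

theorem zero (h : IsIdemInvariant ν) : ν 0 = 0 := by
  have h0 : IsIdempotentElem (0 : R) := by simp [IsIdempotentElem]
  simpa using h.add 0 0 h0 h0 (by simp) (by simp)

/-- The homomorphism need not be unital: the inclusion of a Wedderburn factor is not, and this is
the intended use. -/
theorem comp (h : IsIdemInvariant ν) {S : Type*} [Ring S] (f : S →ₙ+* R) :
    IsIdemInvariant fun s => ν (f s) where
  add a b ha hb hab hba := by
    rw [map_add]
    exact h.add _ _ (ha.map f) (hb.map f) (by rw [← map_mul, hab, map_zero])
      (by rw [← map_mul, hba, map_zero])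
  comm a b hab hba := by
    rw [map_mul, map_mul]
    exact h.comm _ _ (by simpa using hab.map f) (by simpa using hba.map f)

theorem sum (h : IsIdemInvariant ν) {ι : Type*} (s : Finset ι) (e : ι → R)
    (he : ∀ i, IsIdempotentElem (e i)) (h0 : ∀ i j, i ≠ j → e i * e j = 0) :
    ν (∑ i ∈ s, e i) = ∑ i ∈ s, ν (e i) := by
  classical
  induction s using Finset.induction_on with
  | empty => simpa using h.zero
  | insert a s ha ih =>
    have h1 : ∀ i ∈ s, a ≠ i := fun i hi h => ha (h ▸ hi)
    have h2 : IsIdempotentElem (∑ i ∈ s, e i) := by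
      rw [IsIdempotentElem, Finset.sum_mul_sum]
      refine Finset.sum_congr rfl fun i hi => ?_
      rw [Finset.sum_eq_single i (fun j _ hj => h0 i j hj.symm) (fun h => absurd hi h)]
      exact he i
    rw [Finset.sum_insert ha, Finset.sum_insert ha, ← ih]
    refine h.add _ _ (he a) h2 ?_ ?_
    · rw [Finset.mul_sum]
      exact Finset.sum_eq_zero fun i hi => h0 a i (h1 i hi)
    · rw [Finset.sum_mul]
      exact Finset.sum_eq_zero fun i hi => h0 i a (h1 i hi).symm

/-- An idempotent matrix is an orthogonal sum of rank-one idempotents, their number is its trace,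
and each of them is of the form ab with ba equal to the fixed diagonal matrix unit. -/
theorem matrix [Module ℂ V] {n : Type*} [Fintype n] [DecidableEq n] (i₀ : n)
    {ν : Matrix n n ℂ → V} (h : IsIdemInvariant ν) (P : Matrix n n ℂ)
    (hP : IsIdempotentElem P) : ν P = P.trace • ν (Matrix.single i₀ i₀ 1) := by
  let T : (n → ℂ) →ₗ[ℂ] (n → ℂ) := Matrix.toLin' P
  have hTT : T ∘ₗ T = T := by
    rw [← Matrix.toLin'_mul, hP.eq]
  -- A basis of the range gives a rank factorization P = B C with C B = 1.
  let b := Module.finBasis ℂ (LinearMap.range T)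
  let f : (Fin _ → ℂ) →ₗ[ℂ] (n → ℂ) :=
    (LinearMap.range T).subtype ∘ₗ b.equivFun.symm.toLinearMap
  let g : (n → ℂ) →ₗ[ℂ] (Fin _ → ℂ) := b.equivFun.toLinearMap ∘ₗ T.rangeRestrict
  have hfg : f ∘ₗ g = T := by ext; simp [f, g]
  have hgf : g ∘ₗ f = LinearMap.id := by
    refine LinearMap.ext fun v => ?_
    have : T.rangeRestrict (b.equivFun.symm v : n → ℂ) = b.equivFun.symm v := by
      obtain ⟨w, hw⟩ := (b.equivFun.symm v).2
      apply Subtype.ext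
      change T (b.equivFun.symm v : n → ℂ) = _
      rw [← hw]
      exact LinearMap.congr_fun hTT w
    change b.equivFun (T.rangeRestrict (b.equivFun.symm v : n → ℂ)) = v
    rw [this, LinearEquiv.apply_symm_apply]
  let B := LinearMap.toMatrix' f
  let C := LinearMap.toMatrix' g
  have hBC : B * C = P := by
    rw [← LinearMap.toMatrix'_comp, hfg, LinearMap.toMatrix'_toLin']
  have hCB : C * B = 1 := by
    rw [← LinearMap.toMatrix'_comp, hgf, LinearMap.toMatrix'_id]
  -- Column k of B times row k of C: the relation C B = 1 makes these orthogonal idempotents, and B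
  -- C = P makes P their sum.
  let e := fun k => Matrix.vecMulVec (B.col k) (C.row k)
  have hee : ∀ k l, e k * e l = if k = l then e k else 0 := by
    intro k l
    have h1 : C.row k ⬝ᵥ B.col l = (1 : Matrix (Fin _) (Fin _) ℂ) k l := by rw [← hCB]; rfl
    simp only [e, Matrix.vecMulVec_mul_vecMulVec, h1, Matrix.one_apply]
    split_ifs with hkl
    · subst hkl; simp
    · ext i j; simp [Matrix.vecMulVec_apply]
  have hsum : P = ∑ k, e k := by
    rw [← hBC]; ext i j
    simp [e, Matrix.mul_apply, Matrix.sum_apply, Matrix.vecMulVec_apply]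
  have htr : P.trace = (Module.finrank ℂ (LinearMap.range T) : ℂ) := by
    rw [← hBC, Matrix.trace_mul_comm, hCB, Matrix.trace_one, Fintype.card_fin]
  have hk : ∀ k, ν (e k) = ν (Matrix.single i₀ i₀ 1) := by
    intro k
    -- Factoring through the basis vector at `i₀` exhibits the rank-one idempotent as ab, while ba
    -- is the matrix unit because row and column pair to 1.
    have h1 : e k = Matrix.vecMulVec (B.col k) (Pi.single i₀ 1) *
        Matrix.vecMulVec (Pi.single i₀ 1) (C.row k) := by
      rw [Matrix.vecMulVec_mul_vecMulVec]; simp [e]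
    have h2 : Matrix.vecMulVec (Pi.single i₀ 1) (C.row k) *
        Matrix.vecMulVec (B.col k) (Pi.single i₀ 1) = Matrix.single i₀ i₀ 1 := by
      have h3 : C.row k ⬝ᵥ B.col k = (1 : Matrix (Fin _) (Fin _) ℂ) k k := by rw [← hCB]; rfl
      rw [Matrix.vecMulVec_mul_vecMulVec, h3, Matrix.one_apply_eq]
      ext i j
      simp [Matrix.vecMulVec_apply, Matrix.single_apply, Pi.single_apply, ← ite_and, eq_comm,
        and_comm]
    rw [h1, h.comm _ _ _ _, h2]
    · rw [← h1, IsIdempotentElem, hee, if_pos rfl]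
    · rw [h2, IsIdempotentElem]; simp
  rw [htr, hsum, h.sum _ _ (fun k => by rw [IsIdempotentElem, hee, if_pos rfl])
    (fun k l hkl => by rw [hee, if_neg hkl])]
  simp [hk, Nat.cast_smul_eq_nsmul]

/-- An additive invariant of the idempotents of a finite dimensional semisimple algebra is the
restriction of a trace. -/
theorem exists_trace [Module ℂ V] {S : Type*} [Ring S] [Algebra ℂ S] [IsSemisimpleRing S]
    [FiniteDimensional ℂ S] {ν : S → V} (h : IsIdemInvariant ν) :
    ∃ τ : S →ₗ[ℂ] V, (∀ a b, τ (a * b) = τ (b * a)) ∧ ∀ e, IsIdempotentElem e → τ e = ν e := by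
  obtain ⟨n, d, hd, ⟨φ⟩⟩ := IsSemisimpleRing.exists_algEquiv_pi_matrix_of_isAlgClosed ℂ S
  -- Inclusion of the i-th matrix block of the Wedderburn decomposition; it preserves products but
  -- not the unit.
  let ι : ∀ i, Matrix (Fin (d i)) (Fin (d i)) ℂ →ₙ+* S := fun i =>
    { toFun := fun M => φ.symm (Pi.single i M)
      map_zero' := by simp
      map_add' := fun M N => by rw [Pi.single_add, map_add]
      map_mul' := fun M N => by rw [Pi.single_mul, map_mul] }
  let tr : ∀ i, S →ₗ[ℂ] ℂ := fun i =>
    Matrix.traceLinearMap _ ℂ ℂ ∘ₗ LinearMap.proj i ∘ₗ φ.toLinearMap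
  have htr : ∀ i a, tr i a = (φ a i).trace := fun i a => rfl
  -- On each block the invariant is the matrix trace times its value on a minimal idempotent, so the
  -- global trace is forced. The index 0 exists because `hd` excludes empty blocks.
  refine ⟨∑ i, (tr i).smulRight (ν (ι i (Matrix.single 0 0 1))), fun a b => ?_, fun e he => ?_⟩
  · simp only [LinearMap.sum_apply, LinearMap.smulRight_apply, htr, map_mul, Pi.mul_apply]
    exact Finset.sum_congr rfl fun i _ => by rw [Matrix.trace_mul_comm]
  · have h1 : e = ∑ i, ι i (φ e i) := by
      apply φ.injective
      rw [map_sum]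
      exact (Finset.univ_sum_single (φ e)).symm.trans
        (Finset.sum_congr rfl fun i _ => (φ.apply_symm_apply _).symm)
    have hi : ∀ i, IsIdempotentElem (φ e i) := fun i => congrFun (he.map φ) i
    conv_rhs => rw [h1]
    rw [h.sum _ _ (fun i => (hi i).map (ι i)), LinearMap.sum_apply]
    · refine Finset.sum_congr rfl fun i _ => ?_
      rw [(h.comp (ι i)).matrix 0 _ (hi i)]
      rfl
    · intro i j hij
      change φ.symm _ * φ.symm _ = 0
      rw [← map_mul, ← Pi.single_mul_left]
      simp [Pi.single_eq_of_ne hij]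

end IsIdemInvariant

end idempotents

/-! ### Homomorphisms of bundles, subbundles, and classes of images of idempotents. -/

section bundles

variable {A : Type w} {X : Type u} [TopologicalSpace X] {E F G : GBundle.{u, v, w} A X}

open Classical in
theorem GBundle.coord_frame (E : GBundle.{u, v, w} A X) {p x : X} (hx : x ∈ E.dom p)
    (i j : E.idx p) : E.coord p j x (E.frame p i x) = if i = j then 1 else 0 := by
  split_ifs with h
  · subst h; exact E.coord_frame_self p x hx i
  · exact E.coord_frame_ne p x hx i j h

/-- It suffices to check that a fibrewise linear map is a homomorphism at the centre of every chart
and with respect to the frames of that chart. -/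
theorem IsHom.of_local {f : ∀ x, E.fiber x →ₗ[ℂ] F.fiber x}
    (hc : ∀ p i j, ContinuousAt (fun x => F.coord p j x (f x (E.frame p i x))) p)
    (hd : ∀ p i j, E.deg p i ≠ F.deg p j → F.coord p j p (f p (E.frame p i p)) = 0) :
    IsHom E F f := by
  -- Rewriting the matrix entry in the frames of the chart at `t` reduces everything to transition
  -- matrices and the entries controlled by the hypotheses.
  have key : ∀ p q i j t x, x ∈ E.dom t → x ∈ F.dom t → F.coord q j x (f x (E.frame p i x)) =
      ∑ k, E.coord t k x (E.frame p i x) *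
        ∑ l, F.coord t l x (f x (E.frame t k x)) * F.coord q j x (F.frame t l x) := by
    intro p q i j t x hE hF
    conv_lhs => rw [← E.sum_coord_frame t x hE (E.frame p i x)]
    rw [map_sum, map_sum]
    refine Finset.sum_congr rfl fun k _ => ?_
    rw [map_smul, map_smul, smul_eq_mul]
    congr 1
    conv_lhs => rw [← F.sum_coord_frame t x hF (f x (E.frame t k x))]
    simp
  constructor
  · intro p q i j t ht
    refine ContinuousAt.continuousWithinAt (ContinuousAt.congr (f := fun x =>
      ∑ k, E.coord t k x (E.frame p i x) *
        ∑ l, F.coord t l x (f x (E.frame t k x)) * F.coord q j x (F.frame t l x)) ?_ ?_)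
    · refine tendsto_finsetSum _ fun k _ => ContinuousAt.mul ?_
        (tendsto_finsetSum _ fun l _ => ContinuousAt.mul (hc t k l) ?_)
      · exact (E.continuousOn_transition p t i k).continuousAt
          (((E.isOpen_dom p).inter (E.isOpen_dom t)).mem_nhds ⟨ht.1, E.mem_dom t⟩)
      · exact (F.continuousOn_transition t q l j).continuousAt
          (((F.isOpen_dom t).inter (F.isOpen_dom q)).mem_nhds ⟨F.mem_dom t, ht.2⟩)
    · filter_upwards [(E.isOpen_dom t).mem_nhds (E.mem_dom t),
        (F.isOpen_dom t).mem_nhds (F.mem_dom t)] with x hE hF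
      exact (key p q i j t x hE hF).symm
  · intro p q x hx i j hij
    rw [key p q i j x x (E.mem_dom x) (F.mem_dom x)]
    refine Finset.sum_eq_zero fun k _ => ?_
    by_cases h1 : E.deg p i = E.deg x k
    · rw [Finset.sum_eq_zero, mul_zero]
      intro l _
      by_cases h2 : E.deg x k = F.deg x l
      · rw [F.transition_deg x q x ⟨F.mem_dom x, hx.2⟩ l j (h2 ▸ h1 ▸ hij), mul_zero]
      · rw [hd x k l h2, zero_mul]
    · rw [E.transition_deg p x x ⟨hx.1, E.mem_dom x⟩ i k h1, zero_mul]

/-- A fibrewise linear map with constant degree preserving matrices in the frames of the charts is a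
homomorphism. -/
theorem IsHom.of_const {f : ∀ x, E.fiber x →ₗ[ℂ] F.fiber x} (c : ∀ p, E.idx p → F.idx p → ℂ)
    (hc : ∀ p i j, ∀ x ∈ E.dom p, x ∈ F.dom p →
      F.coord p j x (f x (E.frame p i x)) = c p i j)
    (hd : ∀ p i j, E.deg p i ≠ F.deg p j → c p i j = 0) : IsHom E F f := by
  refine IsHom.of_local (fun p i j => ?_) fun p i j h => ?_
  · refine ContinuousAt.congr (f := fun _ => c p i j) continuousAt_const ?_
    filter_upwards [(E.isOpen_dom p).mem_nhds (E.mem_dom p),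
      (F.isOpen_dom p).mem_nhds (F.mem_dom p)] with x hE hF
    exact (hc p i j x hE hF).symm
  · rw [hc p i j p (E.mem_dom p) (F.mem_dom p), hd p i j h]

/-- A fibrewise linear map that takes the frames of the charts to frames is a homomorphism. -/
theorem IsHom.of_frame {f : ∀ x, E.fiber x →ₗ[ℂ] F.fiber x} (c : ∀ p, E.idx p → F.idx p)
    (hc : ∀ p i, ∀ x ∈ E.dom p, x ∈ F.dom p → f x (E.frame p i x) = F.frame p (c p i) x)
    (hd : ∀ p i, E.deg p i = F.deg p (c p i)) : IsHom E F f := by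
  classical
  refine IsHom.of_const (fun p i j => if c p i = j then 1 else 0)
    (fun p i j x hE hF => ?_) fun p i j h => ?_
  · rw [hc p i x hE hF, F.coord_frame hF]
  · rw [if_neg]
    rintro rfl
    exact h (hd p i)

/-- The local frames of a subbundle were built with this continuity and homogeneity recorded in
`SubFrame`. The choices made in `subbundle` are repeated verbatim so that the charts agree. -/
theorem subbundle_subtype_isHom (E : GBundle.{u, v, w} A X) (W : ∀ x, Submodule ℂ (E.fiber x))
    (h : IsSubbundle E W) : IsHom (subbundle E W h) E fun x => (W x).subtype :=
  ⟨fun p => (exists_subFrame E W h.choose h.choose_spec.1 h.choose_spec.2 p).some.continuousOn_frame,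
    fun p => (exists_subFrame E W h.choose h.choose_spec.1 h.choose_spec.2 p).some.frame_deg⟩

theorem subbundle_proj_isHom (E : GBundle.{u, v, w} A X) (W : ∀ x, Submodule ℂ (E.fiber x))
    (h : IsSubbundle E W) :
    IsHom E (subbundle E W h) fun x => (h.choose_spec.2 x).codRestrict :=
  ⟨fun p q =>
    (exists_subFrame E W h.choose h.choose_spec.1 h.choose_spec.2 q).some.continuousOn_coord p,
    fun p q => (exists_subFrame E W h.choose h.choose_spec.1 h.choose_spec.2 q).some.coord_deg p⟩

theorem IsHom.codRestrict {W : ∀ x, Submodule ℂ (F.fiber x)} (h : IsSubbundle F W)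
    {f : ∀ x, E.fiber x →ₗ[ℂ] F.fiber x} (hf : IsHom E F f) (hW : ∀ x v, f x v ∈ W x) :
    IsHom E (subbundle F W h) fun x => (f x).codRestrict (W x) (hW x) := by
  refine ((subbundle_proj_isHom F W h).comp hf).congr fun x v => ?_
  exact ((h.choose_spec.2 x).codRestrict_apply_cod ⟨f x v, hW x v⟩).symm

theorem Iso.subbundle_congr {W : ∀ x, Submodule ℂ (E.fiber x)} {W' : ∀ x, Submodule ℂ (F.fiber x)}
    (h : IsSubbundle E W) (h' : IsSubbundle F W') {f : ∀ x, E.fiber x →ₗ[ℂ] F.fiber x}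
    {g : ∀ x, F.fiber x →ₗ[ℂ] E.fiber x} (hf : IsHom E F f) (hg : IsHom F E g)
    (hfW : ∀ x, ∀ v ∈ W x, f x v ∈ W' x) (hgW : ∀ x, ∀ v ∈ W' x, g x v ∈ W x)
    (hgf : ∀ x, ∀ v ∈ W x, g x (f x v) = v) (hfg : ∀ x, ∀ v ∈ W' x, f x (g x v) = v) :
    Iso (subbundle E W h) (subbundle F W' h') := by
  refine ⟨fun x => LinearEquiv.ofLinearMap
    ((f x ∘ₗ (W x).subtype).codRestrict (W' x) fun v => hfW x v v.2)
    ((g x ∘ₗ (W' x).subtype).codRestrict (W x) fun v => hgW x v v.2) ?_ ?_,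
    (hf.comp (subbundle_subtype_isHom E W h)).codRestrict h' fun x (v : W x) => hfW x v v.2,
    (hg.comp (subbundle_subtype_isHom F W' h')).codRestrict h fun x (v : W' x) => hgW x v v.2⟩
  · exact LinearMap.ext fun v : W' x => Subtype.ext (hfg x v v.2)
  · exact LinearMap.ext fun v : W x => Subtype.ext (hgf x v v.2)

/-- The case in which the second subbundle is all of `F`, stated separately so that the target is
`F` itself. -/
theorem Iso.subbundle_iso {W : ∀ x, Submodule ℂ (E.fiber x)} (h : IsSubbundle E W)
    {f : ∀ x, E.fiber x →ₗ[ℂ] F.fiber x} {g : ∀ x, F.fiber x →ₗ[ℂ] E.fiber x}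
    (hf : IsHom E F f) (hg : IsHom F E g) (hgW : ∀ x v, g x v ∈ W x)
    (hgf : ∀ x, ∀ v ∈ W x, g x (f x v) = v) (hfg : ∀ x v, f x (g x v) = v) :
    Iso (subbundle E W h) F := by
  refine ⟨fun x => LinearEquiv.ofLinearMap (f x ∘ₗ (W x).subtype)
    ((g x).codRestrict (W x) (hgW x)) ?_ ?_,
    hf.comp (subbundle_subtype_isHom E W h), hg.codRestrict h hgW⟩
  · exact LinearMap.ext fun v => hfg x v
  · exact LinearMap.ext fun v : W x => Subtype.ext (hgf x v v.2)

theorem Iso.subbundle_directSum {W W₁ W₂ : ∀ x, Submodule ℂ (E.fiber x)} (h : IsSubbundle E W)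
    (h₁ : IsSubbundle E W₁) (h₂ : IsSubbundle E W₂) {f g : ∀ x, E.fiber x →ₗ[ℂ] E.fiber x}
    (hf : IsHom E E f) (hg : IsHom E E g) (hfW : ∀ x v, f x v ∈ W₁ x) (hgW : ∀ x v, g x v ∈ W₂ x)
    (hW₁ : ∀ x, W₁ x ≤ W x) (hW₂ : ∀ x, W₂ x ≤ W x)
    (hfg : ∀ x, ∀ v ∈ W x, f x v + g x v = v) (hff : ∀ x, ∀ v ∈ W₁ x, f x v = v)
    (hgg : ∀ x, ∀ v ∈ W₂ x, g x v = v) (hf0 : ∀ x, ∀ v ∈ W₂ x, f x v = 0)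
    (hg0 : ∀ x, ∀ v ∈ W₁ x, g x v = 0) :
    Iso (subbundle E W h) (directSum (subbundle E W₁ h₁) (subbundle E W₂ h₂)) := by
  refine Iso.subbundle_iso h ((hf.codRestrict h₁ hfW).prod (hg.codRestrict h₂ hgW))
    (((subbundle_subtype_isHom E W₁ h₁).comp IsHom.fst).add
      ((subbundle_subtype_isHom E W₂ h₂).comp IsHom.snd)) ?_ ?_ ?_
  · rintro x ⟨v₁, v₂⟩
    exact (W x).add_mem (hW₁ x v₁.2) (hW₂ x v₂.2)
  · exact fun x v hv => hfg x v hv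
  · rintro x ⟨v₁, v₂⟩
    refine Prod.ext (Subtype.ext ?_) (Subtype.ext ?_)
    · change f x (v₁.1 + v₂.1) = v₁.1
      rw [map_add, hff x v₁.1 v₁.2, hf0 x v₂.1 v₂.2, add_zero]
    · change g x (v₁.1 + v₂.1) = v₂.1
      rw [map_add, hgg x v₂.1 v₂.2, hg0 x v₁.1 v₁.2, zero_add]

/-- The algebra of endomorphisms of a graded bundle. -/
def EndB (E : GBundle.{u, v, w} A X) : Subalgebra ℂ (∀ x, Module.End ℂ (E.fiber x)) where
  carrier := {f | IsHom E E f}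
  mul_mem' hf hg := IsHom.comp hf hg
  add_mem' hf hg := IsHom.add hf hg
  algebraMap_mem' c := ((IsHom.id E).smul c).congr fun x v => by
    simp [Algebra.algebraMap_eq_smul_one]

theorem EndB.idem {e : EndB E} (he : IsIdempotentElem e) (x : X) (v : E.fiber x) :
    e.1 x (e.1 x v) = e.1 x v :=
  LinearMap.congr_fun (congrFun (congrArg Subtype.val he.eq) x) v

theorem EndB.range_isSubbundle {e : EndB E} (he : IsIdempotentElem e) :
    IsSubbundle E fun x => LinearMap.range (e.1 x) :=
  ⟨e.1, e.2, fun x => ⟨fun v => ⟨v, rfl⟩, by rintro _ ⟨v, rfl⟩; exact EndB.idem he x v⟩⟩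

open Classical in
/-- The class in `GK` of the image of an idempotent endomorphism of `E`. -/
noncomputable def idemClass (E : GBundle.{u, v, w} A X) (e : EndB E) : GK.{u, v, w} A X :=
  if h : IsIdempotentElem e then GK.of (subbundle E _ (EndB.range_isSubbundle h)) else 0

/-- When gf = e and fg = e', the maps f and g restrict to mutually inverse isomorphisms between the
two images. Allowing different bundles makes this more than invariance under exchanging ab and ba
inside one endomorphism algebra. -/
theorem idemClass_comm {e : EndB E} {e' : EndB F} (he : IsIdempotentElem e)
    (he' : IsIdempotentElem e') {f : ∀ x, E.fiber x →ₗ[ℂ] F.fiber x}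
    {g : ∀ x, F.fiber x →ₗ[ℂ] E.fiber x} (hf : IsHom E F f) (hg : IsHom F E g)
    (hgf : ∀ x v, g x (f x v) = e.1 x v) (hfg : ∀ x v, f x (g x v) = e'.1 x v) :
    idemClass E e = idemClass F e' := by
  rw [idemClass, idemClass, dif_pos he, dif_pos he']
  refine GK.of_eq (Iso.subbundle_congr _ _ hf hg ?_ ?_ ?_ ?_)
  · rintro x _ ⟨v, rfl⟩; exact ⟨f x v, by rw [← hfg, hgf]⟩
  · rintro x _ ⟨v, rfl⟩; exact ⟨g x v, by rw [← hgf, hfg]⟩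
  · rintro x _ ⟨v, rfl⟩; rw [hgf, EndB.idem he]
  · rintro x _ ⟨v, rfl⟩; rw [hfg, EndB.idem he']

/-- The tool for recognizing images: a pair of maps splitting the idempotent through `F` identifies
its image with `F`. -/
theorem idemClass_eq_of {e : EndB E} (he : IsIdempotentElem e)
    {f : ∀ x, E.fiber x →ₗ[ℂ] F.fiber x} {g : ∀ x, F.fiber x →ₗ[ℂ] E.fiber x}
    (hf : IsHom E F f) (hg : IsHom F E g) (hgf : ∀ x v, g x (f x v) = e.1 x v)
    (hfg : ∀ x v, f x (g x v) = v) : idemClass E e = GK.of F := by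
  rw [idemClass, dif_pos he]
  refine GK.of_eq (Iso.subbundle_iso _ hf hg ?_ ?_ hfg)
  · exact fun x v => ⟨g x v, by rw [← hgf, hfg]⟩
  · rintro x _ ⟨v, rfl⟩; rw [hgf, EndB.idem he]

/-- Orthogonal idempotents give a direct sum decomposition of the image of their sum, and b, a
exchange the images of ab and ba. This makes the trace theorem for idempotent invariants applicable
to `GK`. -/
theorem idemClass_isIdemInvariant (E : GBundle.{u, v, w} A X) :
    IsIdemInvariant (idemClass E) where
  add e f he hf hef hfe := by
    have h : IsIdempotentElem (e + f) := by
      rw [IsIdempotentElem, add_mul, mul_add, mul_add, he.eq, hf.eq, hef, hfe, add_zero, zero_add]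
    have hef' : ∀ x v, e.1 x (f.1 x v) = 0 := fun x v =>
      LinearMap.congr_fun (congrFun (congrArg Subtype.val hef) x) v
    have hfe' : ∀ x v, f.1 x (e.1 x v) = 0 := fun x v =>
      LinearMap.congr_fun (congrFun (congrArg Subtype.val hfe) x) v
    rw [idemClass, idemClass, idemClass, dif_pos he, dif_pos hf, dif_pos h, ← GK.of_directSum]
    refine GK.of_eq (Iso.subbundle_directSum _ _ _ e.2 f.2 (fun x v => ⟨v, rfl⟩)
      (fun x v => ⟨v, rfl⟩) ?_ ?_ ?_ ?_ ?_ ?_ ?_)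
    · rintro x _ ⟨v, rfl⟩
      refine ⟨e.1 x v, ?_⟩
      change e.1 x (e.1 x v) + f.1 x (e.1 x v) = _
      rw [EndB.idem he, hfe', add_zero]
    · rintro x _ ⟨v, rfl⟩
      refine ⟨f.1 x v, ?_⟩
      change e.1 x (f.1 x v) + f.1 x (f.1 x v) = _
      rw [EndB.idem hf, hef', zero_add]
    · rintro x _ ⟨v, rfl⟩
      exact EndB.idem h x v
    · rintro x _ ⟨v, rfl⟩; exact EndB.idem he x v
    · rintro x _ ⟨v, rfl⟩; exact EndB.idem hf x v
    · rintro x _ ⟨v, rfl⟩; exact hef' x v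
    · rintro x _ ⟨v, rfl⟩; exact hfe' x v
  comm a b hab hba := idemClass_comm hab hba b.2 a.2 (fun _ _ => rfl) fun _ _ => rfl

end bundles

/-! ### Tensor powers of a bundle with the unsigned action of the group algebra of S_n. -/

section tensorPowers

variable {A : Type w} [AddCommMonoid A] {X : Type u} [TopologicalSpace X]
  {E F : GBundle.{u, v, w} A X}

/-- The tensor power of a graded bundle, without an action of the symmetric group. -/
noncomputable abbrev tpow (n : ℕ) (E : GBundle.{u, v, w} A X) : GBundle.{u, v, w} A X :=
  box E (fun (_ : Fin n) x => x) fun _ => continuous_id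

theorem coord_tpow_tprod {n : ℕ} (q : X) (t : Fin n → E.idx q) (x : X)
    (v : Fin n → E.fiber x) : (tpow n E).coord q t x (PiTensorProduct.tprod ℂ v) =
      ∏ i, E.coord q (t i) x (v i) := by
  refine (PiTensorProduct.lift.tprod v).trans ?_
  simp

theorem IsHom.tpow {n : ℕ} {f : Fin n → ∀ x, E.fiber x →ₗ[ℂ] F.fiber x}
    (hf : ∀ i, IsHom E F (f i)) :
    IsHom (tpow n E) (tpow n F) fun x => PiTensorProduct.map fun i => f i x := by
  have key : ∀ p q (s : Fin n → E.idx p) (t : Fin n → F.idx q) x,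
      (GradedK.tpow n F).coord q t x (PiTensorProduct.map (fun i => f i x)
        ((GradedK.tpow n E).frame p s x)) =
      ∏ i, F.coord q (t i) x (f i x (E.frame p (s i) x)) := by
    intro p q s t x
    refine (congrArg _ (PiTensorProduct.map_tprod _ _)).trans ?_
    exact coord_tpow_tprod q t x _
  constructor
  · intro p q s t
    refine ContinuousOn.congr (continuousOn_finsetProd Finset.univ fun i _ =>
      ((hf i).continuousOn p q (s i) (t i)).mono fun x hx => ?_) fun x _ => key p q s t x
    exact ⟨hx.1 i, hx.2 i⟩
  · intro p q x hx s t hst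
    have : ∃ i, E.deg p (s i) ≠ F.deg q (t i) := by
      by_contra! h
      exact hst (Finset.sum_congr (s₁ := Finset.univ) rfl fun i _ => h i)
    obtain ⟨i, hi⟩ := this
    refine (key p q s t x).trans ?_
    exact Finset.prod_eq_zero (Finset.mem_univ i) ((hf i).deg p q x ⟨hx.1 i, hx.2 i⟩ _ _ hi)

/-- The (unsigned) permutation of the factors of a tensor power. -/
noncomputable def permMap {V : Type*} [AddCommGroup V] [Module ℂ V] {n : ℕ}
    (σ : Equiv.Perm (Fin n)) : Module.End ℂ (⨂[ℂ] _ : Fin n, V) :=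
  (PiTensorProduct.reindex ℂ (fun _ => V) σ).toLinearMap

theorem permMap_tprod {V : Type*} [AddCommGroup V] [Module ℂ V] {n : ℕ}
    (σ : Equiv.Perm (Fin n)) (v : Fin n → V) :
    permMap σ (PiTensorProduct.tprod ℂ v) = PiTensorProduct.tprod ℂ fun i => v (σ⁻¹ i) :=
  PiTensorProduct.reindex_tprod _ _

theorem permMap_isHom (E : GBundle.{u, v, w} A X) {n : ℕ} (σ : Equiv.Perm (Fin n)) :
    IsHom (tpow n E) (tpow n E) fun _ => permMap σ :=
  IsHom.of_frame (fun _ s i => s (σ⁻¹ i)) (fun _ _ _ _ _ => permMap_tprod σ _)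
    fun p s => (Equiv.sum_comp σ⁻¹ fun i => E.deg p (s i)).symm

/-- The action of the symmetric group on a tensor power by unsigned permutations. -/
noncomputable def permHom (V : Type*) [AddCommGroup V] [Module ℂ V] (n : ℕ) :
    Equiv.Perm (Fin n) →* Module.End ℂ (⨂[ℂ] _ : Fin n, V) where
  toFun σ := permMap σ
  map_one' := PiTensorProduct.ext (MultilinearMap.ext fun v => permMap_tprod 1 v)
  map_mul' σ τ := by
    refine PiTensorProduct.ext (MultilinearMap.ext fun v => ?_)
    refine (permMap_tprod _ v).trans (Eq.symm ?_)
    refine (congrArg (permMap σ) (permMap_tprod τ v)).trans ((permMap_tprod σ _).trans ?_)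
    rfl

/-- The action of the group algebra of the symmetric group on a tensor power. -/
noncomputable def permLin (V : Type*) [AddCommGroup V] [Module ℂ V] (n : ℕ) :
    MonoidAlgebra ℂ (Equiv.Perm (Fin n)) →ₐ[ℂ] Module.End ℂ (⨂[ℂ] _ : Fin n, V) :=
  MonoidAlgebra.lift ℂ _ _ (permHom V n)

theorem permLin_of {V : Type*} [AddCommGroup V] [Module ℂ V] {n : ℕ} (σ : Equiv.Perm (Fin n)) :
    permLin V n (MonoidAlgebra.of ℂ _ σ) = permMap σ := by
  rw [permLin, MonoidAlgebra.lift_of]; rfl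

theorem permLin_isHom (E : GBundle.{u, v, w} A X) {n : ℕ}
    (a : MonoidAlgebra ℂ (Equiv.Perm (Fin n))) :
    IsHom (tpow n E) (tpow n E) fun x => permLin (E.fiber x) n a := by
  induction a using MonoidAlgebra.induction_on with
  | of σ =>
    refine (permMap_isHom E σ).congr fun x v => ?_
    rw [permLin_of]
  | add a b ha hb =>
    refine (ha.add hb).congr fun x v => ?_
    rw [map_add]
    rfl
  | smul r a ha =>
    refine (ha.smul r).congr fun x v => ?_
    rw [map_smul]
    rfl

/-- The action of the group algebra of the symmetric group on a tensor power of a bundle. -/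
noncomputable def permAlg (n : ℕ) (E : GBundle.{u, v, w} A X) :
    MonoidAlgebra ℂ (Equiv.Perm (Fin n)) →ₐ[ℂ] EndB (tpow n E) :=
  (AlgHom.pi fun x => permLin (E.fiber x) n).codRestrict _ (permLin_isHom E)

/-- Concatenation of tensors, for a splitting `e` of the set of indices. -/
noncomputable def concat (V : Type*) [AddCommGroup V] [Module ℂ V] {m k n : ℕ}
    (e : Fin m ⊕ Fin k ≃ Fin n) :
    ((⨂[ℂ] _ : Fin m, V) ⊗[ℂ] (⨂[ℂ] _ : Fin k, V)) ≃ₗ[ℂ] ⨂[ℂ] _ : Fin n, V :=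
  PiTensorProduct.tmulEquiv ℂ V ≪≫ₗ PiTensorProduct.reindex ℂ (fun _ => V) e

theorem concat_tprod {V : Type*} [AddCommGroup V] [Module ℂ V] {m k n : ℕ}
    (e : Fin m ⊕ Fin k ≃ Fin n) (a : Fin m → V) (b : Fin k → V) :
    concat V e (PiTensorProduct.tprod ℂ a ⊗ₜ PiTensorProduct.tprod ℂ b) =
      PiTensorProduct.tprod ℂ fun i => Sum.elim a b (e.symm i) := by
  rw [concat, LinearEquiv.trans_apply, PiTensorProduct.tmulEquiv_apply,
    PiTensorProduct.reindex_tprod]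

theorem concat_symm_tprod {V : Type*} [AddCommGroup V] [Module ℂ V] {m k n : ℕ}
    (e : Fin m ⊕ Fin k ≃ Fin n) (a : Fin n → V) :
    (concat V e).symm (PiTensorProduct.tprod ℂ a) =
      (PiTensorProduct.tprod ℂ fun i => a (e (Sum.inl i))) ⊗ₜ
        PiTensorProduct.tprod ℂ fun i => a (e (Sum.inr i)) := by
  rw [LinearEquiv.symm_apply_eq, concat_tprod]
  congr 1
  funext i
  obtain ⟨j | j, rfl⟩ := e.surjective i <;> simp

/-! ### Concatenation of tensors and block permutations. -/

section concat

variable {m k n : ℕ} (e : Fin m ⊕ Fin k ≃ Fin n)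

theorem concat_isHom (E : GBundle.{u, v, w} A X) :
    IsHom (tensor (tpow m E) (tpow k E)) (tpow n E) fun x => (concat (E.fiber x) e).toLinearMap := by
  refine IsHom.of_frame (fun _ s i => Sum.elim s.1 s.2 (e.symm i)) (fun p s x _ _ => ?_)
    fun p s => ?_
  · refine (concat_tprod e _ _).trans (congrArg _ (funext fun i => ?_))
    dsimp only
    rcases e.symm i with j | j <;> rfl
  · change ∑ i, E.deg p (s.1 i) + ∑ i, E.deg p (s.2 i) =
      ∑ i, E.deg p (Sum.elim s.1 s.2 (e.symm i))
    rw [Equiv.sum_comp e.symm fun i => E.deg p (Sum.elim s.1 s.2 i), Fintype.sum_sum_type]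
    rfl

theorem concat_symm_isHom (E : GBundle.{u, v, w} A X) :
    IsHom (tpow n E) (tensor (tpow m E) (tpow k E)) fun x =>
      (concat (E.fiber x) e).symm.toLinearMap := by
  refine IsHom.of_frame (fun _ s => (fun i => s (e (Sum.inl i)), fun i => s (e (Sum.inr i))))
    (fun p s x _ _ => concat_symm_tprod e _) fun p s => ?_
  change ∑ i, E.deg p (s i) =
    ∑ i, E.deg p (s (e (Sum.inl i))) + ∑ i, E.deg p (s (e (Sum.inr i)))
  rw [← Equiv.sum_comp e, Fintype.sum_sum_type]

theorem Iso.tensor_tpow (e : Fin m ⊕ Fin k ≃ Fin n) (E : GBundle.{u, v, w} A X) :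
    Iso (tensor (tpow m E) (tpow k E)) (tpow n E) :=
  ⟨fun x => concat (E.fiber x) e, concat_isHom e E, concat_symm_isHom e E⟩

/-- The permutation of the indices that is `σ` on the first and `τ` on the second part. -/
def blockPerm : Equiv.Perm (Fin m) × Equiv.Perm (Fin k) →* Equiv.Perm (Fin n) :=
  e.permCongrHom.toMonoidHom.comp (Equiv.Perm.sumCongrHom _ _)

theorem blockPerm_apply (σ : Equiv.Perm (Fin m)) (τ : Equiv.Perm (Fin k)) (i : Fin n) :
    blockPerm e (σ, τ) i = e (Sum.map σ τ (e.symm i)) := rfl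

theorem concat_permMap {V : Type*} [AddCommGroup V] [Module ℂ V]
    (σ : Equiv.Perm (Fin m)) (τ : Equiv.Perm (Fin k)) :
    (concat V e).toLinearMap ∘ₗ TensorProduct.map (permMap σ) (permMap τ) =
      permMap (blockPerm e (σ, τ)) ∘ₗ (concat V e).toLinearMap := by
  have key : ∀ (a : Fin m → V) (b : Fin k → V),
      concat V e (TensorProduct.map (permMap σ) (permMap τ)
        (PiTensorProduct.tprod ℂ a ⊗ₜ[ℂ] PiTensorProduct.tprod ℂ b)) =
      permMap (blockPerm e (σ, τ))
        (concat V e (PiTensorProduct.tprod ℂ a ⊗ₜ[ℂ] PiTensorProduct.tprod ℂ b)) := by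
    intro a b
    rw [TensorProduct.map_tmul, permMap_tprod, permMap_tprod, concat_tprod, concat_tprod,
      permMap_tprod]
    congr 1
    funext i
    rw [← map_inv, Prod.inv_mk, blockPerm_apply, Equiv.symm_apply_apply]
    rcases e.symm i with j | j <;> rfl
  apply TensorProduct.ext
  refine PiTensorProduct.ext (MultilinearMap.ext fun a => ?_)
  refine PiTensorProduct.ext (MultilinearMap.ext fun b => ?_)
  simpa using key a b

/-- The homomorphism of group algebras induced by the inclusion of the first block. -/
noncomputable def blockAlgLeft :
    MonoidAlgebra ℂ (Equiv.Perm (Fin m)) →ₐ[ℂ] MonoidAlgebra ℂ (Equiv.Perm (Fin n)) :=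
  MonoidAlgebra.mapDomainAlgHom ℂ ℂ ((blockPerm e).comp (MonoidHom.inl _ _))

/-- The homomorphism of group algebras induced by the inclusion of the second block. -/
noncomputable def blockAlgRight :
    MonoidAlgebra ℂ (Equiv.Perm (Fin k)) →ₐ[ℂ] MonoidAlgebra ℂ (Equiv.Perm (Fin n)) :=
  MonoidAlgebra.mapDomainAlgHom ℂ ℂ ((blockPerm e).comp (MonoidHom.inr _ _))

theorem blockAlgLeft_of (σ : Equiv.Perm (Fin m)) :
    blockAlgLeft e (MonoidAlgebra.of ℂ _ σ) = MonoidAlgebra.of ℂ _ (blockPerm e (σ, 1)) := by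
  simp [blockAlgLeft]

theorem blockAlgRight_of (τ : Equiv.Perm (Fin k)) :
    blockAlgRight e (MonoidAlgebra.of ℂ _ τ) = MonoidAlgebra.of ℂ _ (blockPerm e (1, τ)) := by
  simp [blockAlgRight]

/-- Permutations with disjoint supports commute. In particular the product of an idempotent of each
block is again idempotent. -/
theorem blockAlg_comm (a : MonoidAlgebra ℂ (Equiv.Perm (Fin m)))
    (b : MonoidAlgebra ℂ (Equiv.Perm (Fin k))) :
    blockAlgLeft e a * blockAlgRight e b = blockAlgRight e b * blockAlgLeft e a := by
  induction a using MonoidAlgebra.induction_on with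
  | of σ =>
    induction b using MonoidAlgebra.induction_on with
    | of τ =>
      rw [blockAlgLeft_of, blockAlgRight_of, ← map_mul, ← map_mul, ← map_mul, ← map_mul]
      simp
    | add a b ha hb => simp only [map_add, mul_add, add_mul, ha, hb]
    | smul r a ha => simp only [map_smul, mul_smul_comm, smul_mul_assoc, ha]
  | add a b ha hb => simp only [map_add, mul_add, add_mul, ha, hb]
  | smul r a ha => simp only [map_smul, mul_smul_comm, smul_mul_assoc, ha]

/-- Both sides are bilinear in the two group algebra elements, so this reduces to the block
permutation of a concatenated tensor. It turns images of products of block idempotents into tensor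
products of bundles. -/
theorem concat_permLin {V : Type*} [AddCommGroup V] [Module ℂ V]
    (a : MonoidAlgebra ℂ (Equiv.Perm (Fin m))) (b : MonoidAlgebra ℂ (Equiv.Perm (Fin k))) :
    (concat V e).toLinearMap ∘ₗ TensorProduct.map (permLin V m a) (permLin V k b) =
      permLin V n (blockAlgLeft e a * blockAlgRight e b) ∘ₗ (concat V e).toLinearMap := by
  induction a using MonoidAlgebra.induction_on with
  | of σ =>
    induction b using MonoidAlgebra.induction_on with
    | of τ =>
      rw [blockAlgLeft_of, blockAlgRight_of, ← map_mul, ← map_mul, permLin_of, permLin_of,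
        permLin_of, concat_permMap]
      simp
    | add a b ha hb =>
      rw [map_add, map_add, mul_add, map_add, TensorProduct.map_add_right, LinearMap.comp_add,
        LinearMap.add_comp, ha, hb]
    | smul r a ha =>
      rw [map_smul, map_smul, mul_smul_comm, map_smul, TensorProduct.map_smul_right,
        LinearMap.comp_smul, LinearMap.smul_comp, ha]
  | add a b ha hb =>
    rw [map_add, map_add, add_mul, map_add, TensorProduct.map_add_left, LinearMap.comp_add,
      LinearMap.add_comp, ha, hb]
  | smul r a ha =>
    rw [map_smul, map_smul, smul_mul_assoc, map_smul, TensorProduct.map_smul_left,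
      LinearMap.comp_smul, LinearMap.smul_comp, ha]

end concat

end tensorPowers

/-! ### Spectral projectors of an element of finite order. -/

section cyclic

variable {R : Type*} [Ring R] [Algebra ℂ R]

/-- The projector onto the `ξ`-eigenspace of an element `T` with `T ^ m = 1`. -/
noncomputable def eigenIdem (m : ℕ) (T : R) (ξ : ℂ) : R :=
  (m : ℂ)⁻¹ • ∑ k ∈ Finset.range m, (ξ⁻¹) ^ k • T ^ k

theorem map_eigenIdem {S : Type*} [Ring S] [Algebra ℂ S] (f : R →ₐ[ℂ] S) (m : ℕ) (T : R) (ξ : ℂ) :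
    f (eigenIdem m T ξ) = eigenIdem m (f T) ξ := by
  simp [eigenIdem]

theorem commute_eigenIdem {a T : R} (h : Commute a T) (m : ℕ) (ξ : ℂ) :
    Commute a (eigenIdem m T ξ) :=
  (Commute.sum_right _ _ _ fun k _ => (h.pow_right k).smul_right _).smul_right _

variable {m : ℕ} {T : R} {ξ η : ℂ}

/-- Multiplication by T shifts the index of summation and produces a factor ξ; the sum is periodic
because ξ^m = 1 and T^m = 1. -/
theorem mul_eigenIdem (hm : 0 < m) (hT : T ^ m = 1) (hξ : ξ ^ m = 1) :
    T * eigenIdem m T ξ = ξ • eigenIdem m T ξ := by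
  have hξ0 : ξ ≠ 0 := by
    rintro rfl
    rw [zero_pow hm.ne'] at hξ
    exact zero_ne_one hξ
  let f : ℕ → R := fun k => (ξ⁻¹) ^ k • T ^ k
  have h1 : ∀ k, T * f k = ξ • f (k + 1) := by
    intro k
    simp only [f, mul_smul_comm, smul_smul, pow_succ' T, pow_succ' ξ⁻¹]
    rw [← mul_assoc, mul_inv_cancel₀ hξ0, one_mul]
  have h2 : ∑ k ∈ Finset.range m, f (k + 1) = ∑ k ∈ Finset.range m, f k := by
    have h3 := Finset.sum_range_succ f m
    rw [Finset.sum_range_succ' f m, show f m = f 0 by simp [f, hT, hξ]] at h3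
    exact add_right_cancel h3
  change T * ((m : ℂ)⁻¹ • ∑ k ∈ Finset.range m, f k) = ξ • ((m : ℂ)⁻¹ • ∑ k ∈ Finset.range m, f k)
  rw [mul_smul_comm, Finset.mul_sum, smul_comm ξ]
  simp only [h1]
  rw [← Finset.smul_sum, h2]

/-- On an η-eigenvector the projector acts by the average of (ξ⁻¹ η)^k, which is 1 or a vanishing
geometric sum. -/
theorem eigenIdem_mul_of_eq {a : R} (hm : 0 < m) (hξ : ξ ^ m = 1) (hη : η ^ m = 1)
    (ha : T * a = η • a) : eigenIdem m T ξ * a = if ξ = η then a else 0 := by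
  have hξ0 : ξ ≠ 0 := by
    rintro rfl
    rw [zero_pow hm.ne'] at hξ
    exact zero_ne_one hξ
  have h1 : ∀ k, T ^ k * a = η ^ k • a := by
    intro k
    induction k with
    | zero => simp
    | succ k ih => rw [pow_succ, mul_assoc, ha, mul_smul_comm, ih, smul_smul, pow_succ']
  have h2 : eigenIdem m T ξ * a = ((m : ℂ)⁻¹ * ∑ k ∈ Finset.range m, (ξ⁻¹ * η) ^ k) • a := by
    rw [eigenIdem, smul_mul_assoc, Finset.sum_mul, mul_smul, Finset.sum_smul]
    simp only [smul_mul_assoc, h1, smul_smul, mul_pow]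
  rw [h2]
  split_ifs with h
  · subst h
    rw [inv_mul_cancel₀ hξ0]
    simp [hm.ne']
  · have h3 : ξ⁻¹ * η ≠ 1 := fun h' => h (by
      rw [inv_mul_eq_iff_eq_mul₀ hξ0, mul_one] at h'; exact h'.symm)
    rw [geom_sum_eq h3, mul_pow, inv_pow, hξ, hη]
    simp

theorem eigenIdem_mul_eigenIdem (hm : 0 < m) (hT : T ^ m = 1) (hξ : ξ ^ m = 1) (hη : η ^ m = 1) :
    eigenIdem m T ξ * eigenIdem m T η = if ξ = η then eigenIdem m T η else 0 :=
  eigenIdem_mul_of_eq hm hξ hη (mul_eigenIdem hm hT hη)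

theorem isIdempotentElem_eigenIdem (hm : 0 < m) (hT : T ^ m = 1) (hξ : ξ ^ m = 1) :
    IsIdempotentElem (eigenIdem m T ξ) := by
  rw [IsIdempotentElem, eigenIdem_mul_eigenIdem hm hT hξ hξ, if_pos rfl]

/-- Orthogonality of characters: reindexing by a primitive root ζ multiplies the sum by ζ^k, and ζ^k
≠ 1 for 0 < k < m. -/
theorem sum_nthRoots_inv_pow (hm : 0 < m) {k : ℕ} (hk : k < m) :
    ∑ ξ ∈ Polynomial.nthRootsFinset m (1 : ℂ), (ξ⁻¹) ^ k = if k = 0 then (m : ℂ) else 0 := by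
  have hζ := Complex.isPrimitiveRoot_exp m hm.ne'
  split_ifs with h
  · subst h
    simp [hζ.card_nthRootsFinset]
  · set ζ := Complex.exp (2 * Real.pi * Complex.I / m)
    have hζ0 : ζ ≠ 0 := hζ.ne_zero hm.ne'
    have h1 : ζ ^ k ≠ 1 := fun h' => h (Nat.eq_zero_of_dvd_of_lt ((hζ.pow_eq_one_iff_dvd k).1 h') hk)
    have h2 : ∑ ξ ∈ Polynomial.nthRootsFinset m (1 : ℂ), (ξ⁻¹) ^ k =
        ζ ^ k * ∑ ξ ∈ Polynomial.nthRootsFinset m (1 : ℂ), (ξ⁻¹) ^ k := by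
      rw [Finset.mul_sum]
      refine Finset.sum_nbij' (fun ξ => ζ * ξ) (fun ξ => ζ⁻¹ * ξ) ?_ ?_ ?_ ?_ ?_
      · intro ξ hξ
        rw [Polynomial.mem_nthRootsFinset hm] at hξ ⊢
        rw [mul_pow, hξ, hζ.pow_eq_one, one_mul]
      · intro ξ hξ
        rw [Polynomial.mem_nthRootsFinset hm] at hξ ⊢
        rw [mul_pow, hξ, inv_pow, hζ.pow_eq_one, inv_one, one_mul]
      · intro ξ _; rw [inv_mul_cancel_left₀ hζ0]
      · intro ξ _; rw [mul_inv_cancel_left₀ hζ0]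
      · intro ξ _
        rw [mul_inv, mul_pow, inv_pow ζ, mul_inv_cancel_left₀ (pow_ne_zero _ hζ0)]
    have h3 : (1 - ζ ^ k) * ∑ ξ ∈ Polynomial.nthRootsFinset m (1 : ℂ), (ξ⁻¹) ^ k = 0 := by
      rw [sub_mul, one_mul, ← h2, sub_self]
    exact (mul_eq_zero.1 h3).resolve_left (sub_ne_zero.2 h1.symm)

theorem sum_eigenIdem (hm : 0 < m) (T : R) :
    ∑ ξ ∈ Polynomial.nthRootsFinset m (1 : ℂ), eigenIdem m T ξ = 1 := by
  simp only [eigenIdem]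
  rw [← Finset.smul_sum, Finset.sum_comm]
  simp only [← Finset.sum_smul]
  rw [Finset.sum_congr rfl fun k hk => by
    rw [sum_nthRoots_inv_pow hm (Finset.mem_range.1 hk), ite_smul, zero_smul],
    Finset.sum_ite_eq' (Finset.range m) 0 fun k => (m : ℂ) • T ^ k, if_pos (Finset.mem_range.2 hm),
    pow_zero, smul_smul, inv_mul_cancel₀ (by exact_mod_cast hm.ne'), one_smul]

/-- The spectral decomposition of T. It writes T as a linear combination of idempotents, which is
how a trace known on idempotents gets evaluated at a permutation. -/
theorem sum_smul_eigenIdem (hm : 0 < m) (hT : T ^ m = 1) :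
    ∑ ξ ∈ Polynomial.nthRootsFinset m (1 : ℂ), ξ • eigenIdem m T ξ = T := by
  have h : T * ∑ ξ ∈ Polynomial.nthRootsFinset m (1 : ℂ), eigenIdem m T ξ = T := by
    rw [sum_eigenIdem hm, mul_one]
  rw [Finset.mul_sum] at h
  rw [← h]
  refine Finset.sum_congr rfl fun ξ hξ => ?_
  rw [h, mul_eigenIdem hm hT ((Polynomial.mem_nthRootsFinset hm _).1 hξ)]

end cyclic

/-! ### Exterior powers as images of antisymmetrizers. -/

section exteriorPowers

variable {V : Type*} [AddCommGroup V] [Module ℂ V]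

/-- The antisymmetrizer in the group algebra of the symmetric group. -/
noncomputable def antisym (m : ℕ) : MonoidAlgebra ℂ (Equiv.Perm (Fin m)) :=
  (m.factorial : ℂ)⁻¹ •
    ∑ σ : Equiv.Perm (Fin m), ((Equiv.Perm.sign σ : ℤ) : ℂ) • MonoidAlgebra.of ℂ _ σ

/-- The canonical map from a tensor power to the exterior power. -/
noncomputable def altMap (V : Type*) [AddCommGroup V] [Module ℂ V] (m : ℕ) :
    (⨂[ℂ] _ : Fin m, V) →ₗ[ℂ] ⋀[ℂ]^m V :=
  PiTensorProduct.lift (exteriorPower.ιMulti ℂ m (M := V)).toMultilinearMap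

theorem altMap_tprod {m : ℕ} (a : Fin m → V) :
    altMap V m (PiTensorProduct.tprod ℂ a) = exteriorPower.ιMulti ℂ m a :=
  PiTensorProduct.lift.tprod a

/-- All m! signed permutations of a decomposable tensor have the same image in the exterior power.
-/
theorem altMap_toTensorPower {m : ℕ} (a : ⋀[ℂ]^m V) :
    altMap V m (exteriorPower.toTensorPower ℂ V m a) = (m.factorial : ℂ) • a := by
  have : altMap V m ∘ₗ exteriorPower.toTensorPower ℂ V m =
      (m.factorial : ℂ) • LinearMap.id := by
    refine exteriorPower.linearMap_ext (AlternatingMap.ext fun v => ?_)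
    change altMap V m (exteriorPower.toTensorPower ℂ V m (exteriorPower.ιMulti ℂ m v)) =
      (m.factorial : ℂ) • exteriorPower.ιMulti ℂ m v
    rw [exteriorPower.toTensorPower_apply_ιMulti, map_sum]
    rw [Finset.sum_congr rfl fun σ _ => show altMap V m (Equiv.Perm.sign σ •
        PiTensorProduct.tprod ℂ fun i => v (σ i)) = exteriorPower.ιMulti ℂ m v from ?_]
    · rw [Finset.sum_const, Finset.card_univ, Fintype.card_perm, Fintype.card_fin,
        Nat.cast_smul_eq_nsmul]
    · rw [Units.smul_def, map_zsmul, altMap_tprod]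
      have := (exteriorPower.ιMulti ℂ m (M := V)).map_perm v σ
      rw [show (fun i => v (σ i)) = v ∘ σ from rfl, this, Units.smul_def, smul_smul,
        ← Units.val_mul, Int.units_mul_self, Units.val_one, one_smul]
  exact LinearMap.congr_fun this a

theorem toTensorPower_altMap {m : ℕ} (a : ⨂[ℂ] _ : Fin m, V) :
    exteriorPower.toTensorPower ℂ V m (altMap V m a) =
      (m.factorial : ℂ) • permLin V m (antisym m) a := by
  have : exteriorPower.toTensorPower ℂ V m ∘ₗ altMap V m =
      (m.factorial : ℂ) • permLin V m (antisym m) := by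
    refine PiTensorProduct.ext (MultilinearMap.ext fun v => ?_)
    change exteriorPower.toTensorPower ℂ V m (altMap V m (PiTensorProduct.tprod ℂ v)) =
      (m.factorial : ℂ) • permLin V m (antisym m) (PiTensorProduct.tprod ℂ v)
    have hm : (m.factorial : ℂ) ≠ 0 := by exact_mod_cast m.factorial_ne_zero
    -- The sum is reindexed by inversion, because `permMap` places the factor numbered σ⁻¹(i) in
    -- position i.
    rw [altMap_tprod, exteriorPower.toTensorPower_apply_ιMulti, antisym, map_smul,
      LinearMap.smul_apply, smul_smul, mul_inv_cancel₀ hm, one_smul, map_sum, LinearMap.sum_apply,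
      ← Equiv.sum_comp (Equiv.inv (Equiv.Perm (Fin m)))]
    refine Finset.sum_congr rfl fun σ _ => ?_
    rw [map_smul, LinearMap.smul_apply, permLin_of, permMap_tprod, Equiv.inv_apply,
      Equiv.Perm.sign_inv, Units.smul_def, Int.cast_smul_eq_zsmul]
  exact LinearMap.congr_fun this a

theorem of_mul_antisym {m : ℕ} (σ : Equiv.Perm (Fin m)) :
    MonoidAlgebra.of ℂ _ σ * antisym m = ((Equiv.Perm.sign σ : ℤ) : ℂ) • antisym m := by
  rw [antisym, mul_smul_comm, smul_comm, Finset.mul_sum]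
  congr 1
  rw [Finset.smul_sum]
  refine (Fintype.sum_equiv (Equiv.mulLeft σ) _ _ fun τ => ?_)
  rw [mul_smul_comm, ← map_mul, Equiv.coe_mulLeft, smul_smul, ← Int.cast_mul, ← Units.val_mul,
    Equiv.Perm.sign_mul, ← mul_assoc, Int.units_mul_self, one_mul]

theorem isIdempotentElem_antisym (m : ℕ) : IsIdempotentElem (antisym m) := by
  have hm : (m.factorial : ℂ) ≠ 0 := by exact_mod_cast m.factorial_ne_zero
  rw [IsIdempotentElem]
  conv_lhs =>
    enter [1]
    rw [antisym]
  rw [smul_mul_assoc, Finset.sum_mul]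
  simp only [smul_mul_assoc, of_mul_antisym, smul_smul, ← Int.cast_mul, ← Units.val_mul,
    Int.units_mul_self]
  simp only [Units.val_one, Int.cast_one, one_smul, Finset.sum_const, Finset.card_univ,
    Fintype.card_perm, Fintype.card_fin]
  rw [← Nat.cast_smul_eq_nsmul ℂ, smul_smul, inv_mul_cancel₀ hm, one_smul]

variable {A : Type w} [AddCommMonoid A] {X : Type u} [TopologicalSpace X]

attribute [local instance] idxOrder

/-- In the frames of a single chart the matrix entries are determinants of 0/1 matrices, independent
of the point. -/
theorem altMap_isHom (E : GBundle.{u, v, w} A X) (m : ℕ) :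
    IsHom (tpow m E) (exteriorPow E m) fun x => altMap (E.fiber x) m := by
  classical
  refine IsHom.of_const (fun p s (t : Fin m ↪o E.idx p) =>
    (Matrix.of fun i j => if s i = t j then (1 : ℂ) else 0).det) ?_ ?_
  · intro p s (t : Fin m ↪o E.idx p) x _ hx
    refine (congrArg _ (altMap_tprod _)).trans ?_
    refine (exteriorPower.pairingDual_ιMulti_ιMulti _ _).trans ?_
    congr 1
    ext i j
    simp only [Matrix.of_apply]
    rw [E.coord_frame hx]
    split_ifs <;> rfl
  · intro p s (t : Fin m ↪o E.idx p) h
    rw [Matrix.det_apply]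
    refine Finset.sum_eq_zero fun σ _ => ?_
    -- If the multi-indices agreed up to a permutation their total degrees would coincide; so every
    -- term of the determinant has a zero factor.
    have : ∃ i, s (σ i) ≠ t i := by
      by_contra! h'
      refine h ?_
      change ∑ i, E.deg p (s i) = ∑ i, E.deg p (t i)
      rw [← Equiv.sum_comp σ]
      exact Finset.sum_congr rfl fun i _ => by rw [h']
    obtain ⟨i, hi⟩ := this
    rw [Finset.prod_eq_zero (Finset.mem_univ i) (by simp [hi]), smul_zero]

theorem toTensorPower_isHom (E : GBundle.{u, v, w} A X) (m : ℕ) :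
    IsHom (exteriorPow E m) (tpow m E) fun x => exteriorPower.toTensorPower ℂ (E.fiber x) m := by
  classical
  refine IsHom.of_const (fun p (s : Fin m ↪o E.idx p) t => ∑ σ : Equiv.Perm (Fin m), (Equiv.Perm.sign σ : ℤ) •
    ∏ i, if s (σ i) = t i then (1 : ℂ) else 0) ?_ ?_
  · intro p (s : Fin m ↪o E.idx p) t x hx _
    refine (congrArg _ (exteriorPower.toTensorPower_apply_ιMulti ℂ
      fun i => E.frame p (s i) x)).trans ?_
    refine (map_sum ((tpow m E).coord p t x) _ _).trans (Finset.sum_congr rfl fun σ _ => ?_)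
    refine (map_zsmul ((tpow m E).coord p t x) _ _).trans (congrArg _ ?_)
    refine (coord_tpow_tprod p t x _).trans (Finset.prod_congr rfl fun i _ => ?_)
    rw [E.coord_frame hx]
    split_ifs <;> rfl
  · intro p (s : Fin m ↪o E.idx p) t h
    refine Finset.sum_eq_zero fun σ _ => ?_
    have : ∃ i, s (σ i) ≠ t i := by
      by_contra! h'
      refine h ?_
      change ∑ i, E.deg p (s i) = ∑ i, E.deg p (t i)
      rw [← Equiv.sum_comp σ]
      exact Finset.sum_congr rfl fun i _ => by rw [h']
    obtain ⟨i, hi⟩ := this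
    rw [Finset.prod_eq_zero (Finset.mem_univ i) (by simp [hi]), smul_zero]

theorem toTensorPower_smul_isHom (E : GBundle.{u, v, w} A X) (m : ℕ) :
    IsHom (exteriorPow E m) (tpow m E) fun x =>
      (m.factorial : ℂ)⁻¹ • exteriorPower.toTensorPower ℂ (E.fiber x) m :=
  (toTensorPower_isHom E m).smul _

theorem toTensorPower_smul_altMap {m : ℕ} (a : ⨂[ℂ] _ : Fin m, V) :
    ((m.factorial : ℂ)⁻¹ • exteriorPower.toTensorPower ℂ V m) (altMap V m a) =
      permLin V m (antisym m) a := by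
  rw [LinearMap.smul_apply, toTensorPower_altMap, smul_smul, inv_mul_cancel₀
    (by exact_mod_cast m.factorial_ne_zero), one_smul]

theorem altMap_toTensorPower_smul {m : ℕ} (a : ⋀[ℂ]^m V) :
    altMap V m (((m.factorial : ℂ)⁻¹ • exteriorPower.toTensorPower ℂ V m) a) = a := by
  rw [LinearMap.smul_apply, map_smul, altMap_toTensorPower, smul_smul, inv_mul_cancel₀
    (by exact_mod_cast m.factorial_ne_zero), one_smul]

/-- The quotient map to the exterior power and the normalized inclusion into the tensor power split
the antisymmetrizer. The factor 1/m! is what makes their composite on the exterior power the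
identity. -/
theorem idemClass_antisym (E : GBundle.{u, v, w} A X) (m : ℕ) :
    idemClass (tpow m E) (permAlg m E (antisym m)) = GK.of (exteriorPow E m) :=
  idemClass_eq_of ((isIdempotentElem_antisym m).map (permAlg m E)) (altMap_isHom E m)
    (toTensorPower_smul_isHom E m) (fun _ => toTensorPower_smul_altMap)
    fun _ => altMap_toTensorPower_smul

end exteriorPowers

/-! ### Newton's formula for class functions on the symmetric group. -/

section classFunctions

theorem blockPerm_inl {m k n : ℕ} (e : Fin m ⊕ Fin k ≃ Fin n) (σ : Equiv.Perm (Fin m))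
    (τ : Equiv.Perm (Fin k)) (i : Fin m) :
    blockPerm e (σ, τ) (e (Sum.inl i)) = e (Sum.inl (σ i)) := by
  simp [blockPerm_apply]

theorem blockPerm_inr {m k n : ℕ} (e : Fin m ⊕ Fin k ≃ Fin n) (σ : Equiv.Perm (Fin m))
    (τ : Equiv.Perm (Fin k)) (i : Fin k) :
    blockPerm e (σ, τ) (e (Sum.inr i)) = e (Sum.inr (τ i)) := by
  simp [blockPerm_apply]

theorem blockPerm_mul {m k n : ℕ} (e : Fin m ⊕ Fin k ≃ Fin n) (σ : Equiv.Perm (Fin m))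
    (τ : Equiv.Perm (Fin k)) :
    blockPerm e (σ, 1) * blockPerm e (1, τ) = blockPerm e (σ, τ) := by
  rw [← map_mul]; simp

theorem blockPerm_commute {m k n : ℕ} (e : Fin m ⊕ Fin k ≃ Fin n) (σ : Equiv.Perm (Fin m))
    (τ : Equiv.Perm (Fin k)) :
    blockPerm e (1, τ) * blockPerm e (σ, 1) = blockPerm e (σ, 1) * blockPerm e (1, τ) := by
  rw [← map_mul, ← map_mul]; simp

/-- The splitting of `Fin n` into the last `m` and the first `k` indices, in this order. -/
def lastFirst {m k n : ℕ} (h : k + m = n) : Fin m ⊕ Fin k ≃ Fin n :=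
  (Equiv.sumComm _ _).trans (finSumFinEquiv.trans (finCongr h))

theorem lastFirst_inl {m k n : ℕ} (h : k + m = n) (i : Fin m) :
    lastFirst h (Sum.inl i) = ⟨k + i, by omega⟩ := rfl

theorem lastFirst_inr {m k n : ℕ} (h : k + m = n) (i : Fin k) :
    lastFirst h (Sum.inr i) = ⟨i, by omega⟩ := rfl

/-- A permutation of the last m + 1 indices fixing the first of them only moves the last m; the
freed index joins the initial block. -/
theorem blockPerm_decomposeFin_zero {m k n : ℕ} (h : k + (m + 1) = n) (h' : k + 1 + m = n)
    (e : Equiv.Perm (Fin m)) :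
    blockPerm (lastFirst h) (Equiv.Perm.decomposeFin.symm (0, e), 1) =
      blockPerm (lastFirst h') (e, 1) := by
  ext1 i
  obtain ⟨a | b, rfl⟩ := (lastFirst h').surjective i
  · have h1 : ∀ c : Fin m, lastFirst h' (Sum.inl c) = lastFirst h (Sum.inl c.succ) := fun c => by
      rw [lastFirst_inl, lastFirst_inl]; ext; simp; omega
    rw [blockPerm_inl, h1, h1, blockPerm_inl, Equiv.Perm.decomposeFin_symm_apply_succ]
    simp
  · rw [blockPerm_inr]
    by_cases hb : (b : ℕ) < k
    · have h1 : lastFirst h' (Sum.inr b) = lastFirst h (Sum.inr ⟨b, hb⟩) := rfl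
      rw [Equiv.Perm.one_apply, h1, blockPerm_inr, Equiv.Perm.one_apply]
    · have h1 : lastFirst h' (Sum.inr b) = lastFirst h (Sum.inl 0) := by
        rw [lastFirst_inl, lastFirst_inr]; ext; simp; omega
      rw [Equiv.Perm.one_apply, h1, blockPerm_inl, Equiv.Perm.decomposeFin_symm_apply_zero]

/-- With indices starting at 0 this is (0 1 … k)(k k+1) = (0 1 … k+1): a transposition meeting the
cycle in its last index lengthens it by one. -/
theorem blockPerm_finRotate_succ {m k n : ℕ} (h : k + (m + 2) = n) (h' : k + 1 + (m + 1) = n)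
    (h'' : k + 2 + m = n) :
    blockPerm (lastFirst h') (1, finRotate (k + 1)) *
        blockPerm (lastFirst h) (Equiv.swap 0 1, 1) =
      blockPerm (lastFirst h'') (1, finRotate (k + 2)) := by
  ext1 i
  rw [Equiv.Perm.mul_apply]
  obtain ⟨a | b, rfl⟩ := (lastFirst h'').surjective i
  · have h1 : lastFirst h'' (Sum.inl a) = lastFirst h (Sum.inl a.succ.succ) := by
      rw [lastFirst_inl, lastFirst_inl]; ext; simp; omega
    have h2 : lastFirst h (Sum.inl a.succ.succ) = lastFirst h' (Sum.inl a.succ) := by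
      rw [lastFirst_inl, lastFirst_inl]; ext; simp; omega
    have h3 : a.succ.succ ≠ 1 := fun h => by simpa using congrArg Fin.val h
    rw [blockPerm_inl, h1, blockPerm_inl, Equiv.swap_apply_of_ne_of_ne (Fin.succ_ne_zero _) h3, h2,
      blockPerm_inl, Equiv.Perm.one_apply, Equiv.Perm.one_apply, ← h2, ← h1]
  · rw [blockPerm_inr]
    obtain ⟨b, hb⟩ := b
    rcases lt_trichotomy b k with h1 | rfl | h1
    · have e1 : lastFirst h'' (Sum.inr ⟨b, hb⟩) = lastFirst h (Sum.inr ⟨b, h1⟩) := rfl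
      have e2 : lastFirst h (Sum.inr ⟨b, h1⟩) = lastFirst h' (Sum.inr ⟨b, by omega⟩) := rfl
      rw [e1, blockPerm_inr, Equiv.Perm.one_apply, e2, blockPerm_inr, finRotate_of_lt (by omega),
        finRotate_of_lt (by omega)]
      rfl
    · have e1 : lastFirst h'' (Sum.inr ⟨b, hb⟩) = lastFirst h (Sum.inl 0) := rfl
      have e2 : lastFirst h (Sum.inl 1) = lastFirst h' (Sum.inl 0) := rfl
      rw [e1, blockPerm_inl, Equiv.swap_apply_left, e2, blockPerm_inl, finRotate_of_lt (by omega)]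
      rfl
    · obtain rfl : b = k + 1 := by omega
      have e1 : lastFirst h'' (Sum.inr ⟨k + 1, hb⟩) = lastFirst h (Sum.inl 1) := rfl
      have e2 : lastFirst h (Sum.inl 0) = lastFirst h' (Sum.inr ⟨k, by omega⟩) := rfl
      rw [e1, blockPerm_inl, Equiv.swap_apply_right, e2, blockPerm_inr, finRotate_last',
        finRotate_last']
      rfl

variable {V : Type*} [AddCommGroup V] [Module ℂ V] {n : ℕ} (f : Equiv.Perm (Fin n) → V)

/-- The value of a class function of `S_n` on the antisymmetrizer of `S_m` times a `k`-cycle. -/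
noncomputable def antisymCycle (m k : ℕ) (h : k + m = n) : V :=
  (m.factorial : ℂ)⁻¹ • ∑ π : Equiv.Perm (Fin m), (Equiv.Perm.sign π : ℤ) •
    f (blockPerm (lastFirst h) (π, finRotate k))

/-- The analogue of `antisymCycle` where `S_{m+1}` acts on one of the indices in the cycle. -/
noncomputable def antisymOverlap (m k : ℕ) (h : k + 1 + m = n) : V :=
  (m.factorial : ℂ)⁻¹ • ∑ π : Equiv.Perm (Fin (m + 1)), (Equiv.Perm.sign π : ℤ) •
    f (blockPerm (lastFirst (show k + (m + 1) = n by omega)) (π, 1) *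
      blockPerm (lastFirst h) (1, finRotate (k + 1)))

variable {f}

/-- The overlapping block has a single element, so both sides are the value at a cycle. -/
theorem antisymOverlap_zero (k : ℕ) (h : k + 1 + 0 = n) :
    antisymOverlap f 0 k h = antisymCycle f 0 (k + 1) h := by
  have : Subsingleton (Equiv.Perm (Fin (0 + 1))) :=
    inferInstanceAs (Subsingleton (Equiv.Perm (Fin 1)))
  rw [antisymOverlap, antisymCycle, Fintype.sum_subsingleton _ 1, Fintype.sum_subsingleton _ 1,
    ← Prod.one_eq_mk, map_one, map_one, map_one, one_mul]

/-- The permutations of the overlapping block are split into cosets of the stabilizer of the index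
shared with the cycle. The trivial coset decouples from the cycle. Each of the other m + 1 cosets
contributes a transposition through the shared index, which, after conjugation, lengthens the cycle
and costs a sign. -/
theorem antisymOverlap_succ (hf : ∀ a b, f (a * b) = f (b * a)) (m k : ℕ)
    (h : k + 1 + (m + 1) = n) (h' : k + 1 + 1 + m = n) :
    antisymOverlap f (m + 1) k h = antisymCycle f (m + 1) (k + 1) h -
      antisymOverlap f m (k + 1) h' := by
  have h0 : k + (m + 2) = n := by omega
  let C := blockPerm (lastFirst h) (1, finRotate (k + 1))
  let g : Equiv.Perm (Fin (m + 2)) → Equiv.Perm (Fin n) := fun π => blockPerm (lastFirst h0) (π, 1)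
  have hg : ∀ a b, g (a * b) = g a * g b := fun a b => by simp only [g]; rw [← map_mul]; simp
  let j : Equiv.Perm (Fin (m + 1)) → Equiv.Perm (Fin n) := fun π => blockPerm (lastFirst h) (π, 1)
  have hj : ∀ a b, j (a * b) = j a * j b := fun a b => by simp only [j]; rw [← map_mul]; simp
  -- The stabilizer of the shared index, which is number 0 inside the block of m + 2 indices.
  let up : Equiv.Perm (Fin (m + 1)) → Equiv.Perm (Fin (m + 2)) := fun e =>
    Equiv.Perm.decomposeFin.symm (0, e)
  have hup : ∀ e, g (up e) = j e := fun e => blockPerm_decomposeFin_zero h0 h e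
  have hCj : ∀ e, C * j e = j e * C := fun e => blockPerm_commute _ _ _
  have hdec : ∀ p e, Equiv.Perm.decomposeFin.symm (p, e) = Equiv.swap 0 p * up e := by
    intro p e
    ext1 i
    rw [Equiv.Perm.mul_apply]
    refine Fin.cases ?_ (fun i => ?_) i
    · simp [up]
    · simp [up, Equiv.Perm.decomposeFin_symm_apply_succ]
  -- All transpositions through the shared index are conjugate, under the stabilizer, to the one
  -- with its neighbour. For p = 0 the conjugating element is trivial.
  have hswap : ∀ p : Fin (m + 1), (Equiv.swap 0 p.succ : Equiv.Perm (Fin (m + 2))) =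
      up (Equiv.swap 0 p) * Equiv.swap 0 1 * up (Equiv.swap 0 p) := by
    intro p
    have h1 : up (Equiv.swap 0 p) = Equiv.swap 1 p.succ := by
      ext1 i
      refine Fin.cases ?_ (fun i => ?_) i
      · rw [Equiv.swap_apply_of_ne_of_ne (by simp) (Fin.succ_ne_zero _).symm]
        simp [up]
      · rw [Equiv.Perm.decomposeFin_symm_apply_succ, Equiv.swap_self, Equiv.refl_apply,
          ← Fin.succ_zero_eq_one, (Fin.succ_injective _).swap_apply]
    have h2 : (Equiv.swap 1 p.succ : Equiv.Perm (Fin (m + 2)))⁻¹ = Equiv.swap 1 p.succ :=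
      Equiv.swap_inv _ _
    rw [h1]
    conv_rhs => rw [← h2]
    rw [h2]
    conv_rhs => enter [2]; rw [← h2]
    rw [← Equiv.swap_apply_apply, Equiv.swap_apply_left,
      Equiv.swap_apply_of_ne_of_ne (by simp) (Fin.succ_ne_zero _).symm]
  -- With t the conjugating transposition and s the neighbour swap, f(t s t e C) = f(t e t C s),
  -- because f is invariant under cyclic permutation of factors and C commutes with the stabilizer;
  -- C s is the longer cycle.
  have hterm : ∀ p : Fin (m + 1), ∀ e, f (g (Equiv.Perm.decomposeFin.symm (p.succ, e)) * C) =
      f (j (Equiv.swap 0 p * e * Equiv.swap 0 p) *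
        blockPerm (lastFirst h') (1, finRotate (k + 2))) := by
    intro p e
    rw [hdec, hswap, hg, hg, hg, hup, hup, hj, hj, ← blockPerm_finRotate_succ h0 h h']
    change f (j _ * g _ * j _ * j e * C) = f (j _ * j e * j _ * (C * g _))
    set t := j (Equiv.swap 0 p)
    set s := g (Equiv.swap 0 1)
    rw [show t * s * t * j e * C = t * (s * t * j e * C) by simp only [mul_assoc], hf,
      show s * t * j e * C * t = s * (t * j e * (C * t)) by simp only [mul_assoc], hf,
      hCj]
    simp only [mul_assoc]
    rfl
  -- The m + 1 equal contributions of the nontrivial cosets turn the normalization 1/(m+1)! into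
  -- 1/m!.
  have hfac : ((m + 1).factorial : ℂ)⁻¹ * ((m + 1 : ℕ) : ℂ) = (m.factorial : ℂ)⁻¹ := by
    have h1 : ((m + 1 : ℕ) : ℂ) ≠ 0 := by exact_mod_cast m.succ_ne_zero
    have h2 : (m.factorial : ℂ) ≠ 0 := by exact_mod_cast m.factorial_ne_zero
    rw [Nat.factorial_succ, Nat.cast_mul]
    field_simp
  have hsum : ∑ π : Equiv.Perm (Fin (m + 2)), (Equiv.Perm.sign π : ℤ) • f (g π * C) =
      ∑ e : Equiv.Perm (Fin (m + 1)), (Equiv.Perm.sign e : ℤ) • f (j e * C) -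
      ((m + 1 : ℕ) : ℂ) • ∑ e : Equiv.Perm (Fin (m + 1)), (Equiv.Perm.sign e : ℤ) •
        f (j e * blockPerm (lastFirst h') (1, finRotate (k + 2))) := by
    rw [← Equiv.sum_comp Equiv.Perm.decomposeFin.symm, Fintype.sum_prod_type, Fin.sum_univ_succ,
      sub_eq_add_neg]
    congr 1
    · refine Finset.sum_congr rfl fun e _ => ?_
      rw [Equiv.Perm.decomposeFin.symm_sign, if_pos rfl, one_mul]
      change _ • f (g (up e) * C) = _
      rw [hup]
    · have h1 : ∀ p : Fin (m + 1), ∑ e : Equiv.Perm (Fin (m + 1)),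
          (Equiv.Perm.sign (Equiv.Perm.decomposeFin.symm (p.succ, e)) : ℤ) •
            f (g (Equiv.Perm.decomposeFin.symm (p.succ, e)) * C) =
          - ∑ e : Equiv.Perm (Fin (m + 1)), (Equiv.Perm.sign e : ℤ) •
            f (j e * blockPerm (lastFirst h') (1, finRotate (k + 2))) := by
        intro p
        rw [← Finset.sum_neg_distrib]
        -- Conjugation by the transposition permutes the summation index and preserves its sign, so
        -- the contribution of a coset does not depend on p.
        refine Fintype.sum_equiv ((Equiv.mulLeft (Equiv.swap 0 p)).trans
          (Equiv.mulRight (Equiv.swap 0 p))) _ _ fun e => ?_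
        rw [hterm, Equiv.Perm.decomposeFin.symm_sign, if_neg (Fin.succ_ne_zero p)]
        have h2 : Equiv.Perm.sign (Equiv.swap 0 p * e * Equiv.swap 0 p) = Equiv.Perm.sign e := by
          rw [Equiv.Perm.sign_mul, Equiv.Perm.sign_mul, mul_comm, ← mul_assoc, Int.units_mul_self,
            one_mul]
        simp only [Equiv.trans_apply, Equiv.coe_mulLeft, Equiv.coe_mulRight, h2]
        simp
      simp only [h1]
      rw [Finset.sum_const, Finset.card_univ, Fintype.card_fin, smul_neg,
        ← Nat.cast_smul_eq_nsmul ℂ]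
  have hcyc : antisymCycle f (m + 1) (k + 1) h = ((m + 1).factorial : ℂ)⁻¹ •
      ∑ e : Equiv.Perm (Fin (m + 1)), (Equiv.Perm.sign e : ℤ) • f (j e * C) := by
    simp only [antisymCycle, j, C, blockPerm_mul]
  rw [hcyc, antisymOverlap]
  change _ • ∑ π : Equiv.Perm (Fin (m + 2)), (Equiv.Perm.sign π : ℤ) • f (g π * C) = _
  rw [hsum, smul_sub, smul_smul, hfac]
  rfl

/-- Iteration of `antisymOverlap_succ`: each step passes one index from the block to the cycle and
changes the sign. -/
theorem antisymOverlap_eq_sum (hf : ∀ a b, f (a * b) = f (b * a)) (m k : ℕ) (h : k + 1 + m = n) :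
    antisymOverlap f m k h = ∑ j : Fin (m + 1), ((-1) ^ (j : ℕ) : ℤ) •
      antisymCycle f (m - j) (k + 1 + j) (by omega) := by
  have hcongr : ∀ m k m' k' (h : k + m = n) (h' : k' + m' = n), m = m' → k = k' →
      antisymCycle f m k h = antisymCycle f m' k' h' := by
    rintro m k _ _ _ _ rfl rfl; rfl
  induction m generalizing k with
  | zero => simpa using antisymOverlap_zero k h
  | succ m ih =>
    rw [antisymOverlap_succ hf m k h (by omega), ih (k + 1) (by omega), Fin.sum_univ_succ (n := m + 1),
      sub_eq_add_neg, ← Finset.sum_neg_distrib]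
    congr 1
    · simp
    · refine Finset.sum_congr rfl fun j _ => ?_
      have e1 : (-1 : ℤ) ^ (j.succ : ℕ) = -(-1) ^ (j : ℕ) := by
        rw [Fin.val_succ, pow_succ, mul_neg_one]
      rw [← neg_smul, e1]
      congr 1
      have e2 := Fin.val_succ j
      have e3 := j.isLt
      exact hcongr _ _ _ _ (by omega) (by omega) (by omega) (by omega)

/-- Newton's formula for class functions of the symmetric group. -/
theorem newton_classFunction (hf : ∀ a b, f (a * b) = f (b * a)) {m : ℕ} (h : m + 1 = n) :
    (m.factorial : ℂ)⁻¹ • ∑ π : Equiv.Perm (Fin n), (Equiv.Perm.sign π : ℤ) • f π =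
      ∑ j : Fin (m + 1), ((-1) ^ (j : ℕ) : ℤ) • antisymCycle f (m - j) (j + 1) (by omega) := by
  subst h
  have hcongr : ∀ m' k m'' k' (h : k + m' = m + 1) (h' : k' + m'' = m + 1), m' = m'' → k = k' →
      antisymCycle f m' k h = antisymCycle f m'' k' h' := by
    rintro m' k _ _ _ _ rfl rfl; rfl
  -- For k = 0 the cycle is a trivial 1-cycle and the overlapping block is everything, so the left
  -- side is the full alternating sum.
  have h1 := antisymOverlap_eq_sum hf m 0 (by omega)
  rw [antisymOverlap] at h1
  have h2 : ∀ π : Equiv.Perm (Fin (m + 1)),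
      blockPerm (lastFirst (show 0 + (m + 1) = m + 1 by omega)) (π, 1) *
        blockPerm (lastFirst (show 0 + 1 + m = m + 1 by omega)) (1, finRotate (0 + 1)) = π := by
    intro π
    have h3 : finRotate (0 + 1) = 1 := finRotate_one
    rw [h3, ← Prod.one_eq_mk, map_one, mul_one]
    ext1 i
    have h4 : ∀ i, lastFirst (show 0 + (m + 1) = m + 1 by omega) (Sum.inl i) = i := fun i => by
      rw [lastFirst_inl]; ext; simp
    conv_lhs => rw [← h4 i, blockPerm_inl, h4]
  simp only [h2] at h1
  rw [h1]
  refine Finset.sum_congr rfl fun j _ => ?_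
  congr 1
  exact hcongr _ _ _ _ _ _ rfl (by omega)

end classFunctions

/-! ### The unsigned rotation computes the Adams operation. -/

section newton

variable {A : Type w} {X : Type u} [TopologicalSpace X]

/-- The class in `ℂ ⊗ GK` of an element of `GK`. -/
noncomputable def cclass : GK.{u, v, w} A X →+ ℂ ⊗[ℤ] GK.{u, v, w} A X :=
  (TensorProduct.mk ℤ ℂ (GK.{u, v, w} A X) 1).toAddMonoidHom

theorem smul_cclass (c : ℂ) (x : GK.{u, v, w} A X) : c • cclass x = c ⊗ₜ[ℤ] x := by
  simp [cclass, TensorProduct.smul_tmul']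

theorem IsIdemInvariant.map {R V W : Type*} [Ring R] [AddCommGroup V] [AddCommGroup W] {ν : R → V}
    (h : IsIdemInvariant ν) (φ : V →+ W) : IsIdemInvariant fun a => φ (ν a) where
  add e f he hf hef hfe := by rw [h.add e f he hf hef hfe, map_add]
  comm a b hab hba := by rw [h.comm a b hab hba]

theorem GK.tensorLeft_of [AddMonoid A] (E F : GBundle.{u, v, w} A X) :
    GK.tensorLeft F (GK.of E) = GK.of (tensor F E) :=
  DFunLike.congr_fun (Algebra.GrothendieckAddGroup.lift.symm_apply_apply _) (IsoClass.mk E)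

theorem GK.pullback_of {Y : Type u} [TopologicalSpace Y] (φ : X → Y) (hφ : Continuous φ)
    (E : GBundle.{u, v, w} A Y) :
    GK.pullback φ hφ (GK.of E) = GK.of (GradedK.pullback φ hφ E) :=
  DFunLike.congr_fun (Algebra.GrothendieckAddGroup.lift.symm_apply_apply _) (IsoClass.mk E)

variable [AddCommMonoid A]

theorem finRotate_pow_self (n : ℕ) : finRotate n ^ n = 1 := by
  rcases n with _ | _ | n
  · rfl
  · exact Subsingleton.elim (α := Equiv.Perm (Fin 1)) _ _
  · have h := isCycle_finRotate.orderOf (f := finRotate (n + 2))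
    rw [support_finRotate, Finset.card_univ, Fintype.card_fin] at h
    have h1 := pow_orderOf_eq_one (finRotate (n + 2))
    rwa [h] at h1

/-- The rotation of the factors of the tensor power, in the group algebra. -/
noncomputable def rot (n : ℕ) : MonoidAlgebra ℂ (Equiv.Perm (Fin n)) :=
  MonoidAlgebra.of ℂ _ (finRotate n)

theorem rot_pow (n : ℕ) : rot n ^ n = 1 := by
  rw [rot, ← map_pow, finRotate_pow_self, map_one]

/-- The sum of the eigenbundles of the unsigned rotation of `E^{⊗ n}`, weighted with the
eigenvalues. -/
noncomputable def rotClass (n : ℕ) (E : GBundle.{u, v, w} A X) : ℂ ⊗[ℤ] GK.{u, v, w} A X :=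
  ∑ ξ ∈ Polynomial.nthRootsFinset n (1 : ℂ),
    ξ • cclass (idemClass (tpow n E) (permAlg n E (eigenIdem n (rot n) ξ)))

/-- Concatenation identifies the image of a product of block idempotents with the tensor product of
the images, and the image of the antisymmetrizer is the exterior power. This is the source of the
products Λ^m ψ^k in Newton's formula. -/
theorem idemClass_block (E : GBundle.{u, v, w} A X) {m k n : ℕ} (e : Fin m ⊕ Fin k ≃ Fin n)
    {b : MonoidAlgebra ℂ (Equiv.Perm (Fin k))} (hb : IsIdempotentElem b) :
    idemClass (tpow n E) (permAlg n E (blockAlgLeft e (antisym m) * blockAlgRight e b)) =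
      GK.tensorLeft (exteriorPow E m) (idemClass (tpow k E) (permAlg k E b)) := by
  have hb' := hb.map (permAlg k E)
  have hab : IsIdempotentElem (blockAlgLeft e (antisym m) * blockAlgRight e b) := by
    rw [IsIdempotentElem, mul_assoc, ← mul_assoc (blockAlgRight e b), ← blockAlg_comm, mul_assoc,
      ((hb.map (blockAlgRight e)).eq), ← mul_assoc,
      ((isIdempotentElem_antisym m).map (blockAlgLeft e)).eq]
  have hbb : ∀ x v, permLin (E.fiber x) k b (permLin (E.fiber x) k b v) =
      permLin (E.fiber x) k b v := fun x v => EndB.idem hb' x v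
  -- The factor with `b` is unfolded to an actual subbundle so that it can be tensored with the
  -- exterior power; the left side is then folded back into an idempotent class.
  rw [idemClass, idemClass, dif_pos hb', GK.tensorLeft_of, ← idemClass]
  have hsub := EndB.range_isSubbundle hb'
  have hf := ((altMap_isHom E m).tensor ((permAlg k E b).2.codRestrict hsub
    fun x v => ⟨v, rfl⟩)).comp (concat_symm_isHom e E)
  have hg := (concat_isHom e E).comp ((toTensorPower_smul_isHom E m).tensor
    (subbundle_subtype_isHom _ _ hsub))
  refine idemClass_eq_of (hab.map (permAlg n E)) hf hg (fun x v => ?_) fun x v => ?_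
  · have h1 : TensorProduct.map
          ((m.factorial : ℂ)⁻¹ • exteriorPower.toTensorPower ℂ (E.fiber x) m)
          (LinearMap.range (permLin (E.fiber x) k b)).subtype ∘ₗ
        TensorProduct.map (altMap (E.fiber x) m)
          ((permLin (E.fiber x) k b).codRestrict (LinearMap.range (permLin (E.fiber x) k b))
            fun v => ⟨v, rfl⟩) =
        TensorProduct.map (permLin (E.fiber x) m (antisym m)) (permLin (E.fiber x) k b) := by
      rw [← TensorProduct.map_comp]
      exact congrArg₂ TensorProduct.map (LinearMap.ext fun v => toTensorPower_smul_altMap v)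
        (LinearMap.ext fun v => rfl)
    have h2 := LinearMap.congr_fun (concat_permLin (V := E.fiber x) e (antisym m) b)
      ((concat (E.fiber x) e).symm v)
    rw [← h1] at h2
    refine h2.trans (congrArg (permLin (E.fiber x) n _) ?_)
    exact (concat (E.fiber x) e).apply_symm_apply v
  · have h1 : TensorProduct.map (altMap (E.fiber x) m)
          ((permLin (E.fiber x) k b).codRestrict (LinearMap.range (permLin (E.fiber x) k b))
            fun v => ⟨v, rfl⟩) ∘ₗ
        TensorProduct.map
          ((m.factorial : ℂ)⁻¹ • exteriorPower.toTensorPower ℂ (E.fiber x) m)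
          (LinearMap.range (permLin (E.fiber x) k b)).subtype = LinearMap.id := by
      rw [← TensorProduct.map_comp, ← TensorProduct.map_id]
      refine congrArg₂ TensorProduct.map (LinearMap.ext fun v => altMap_toTensorPower_smul v)
        (LinearMap.ext fun v => ?_)
      obtain ⟨_, v, rfl⟩ := v
      exact Subtype.ext (hbb x v)
    refine Eq.trans ?_ (LinearMap.congr_fun h1 v)
    refine congrArg (TensorProduct.map (altMap (E.fiber x) m)
          ((permLin (E.fiber x) k b).codRestrict (LinearMap.range (permLin (E.fiber x) k b))
            fun v => ⟨v, rfl⟩)) ?_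
    exact (concat (E.fiber x) e).symm_apply_apply _

/-- Multiplication by the class of `F` on `ℂ ⊗ GK`. -/
noncomputable def tensorLeftC (F : GBundle.{u, v, w} A X) :
    ℂ ⊗[ℤ] GK.{u, v, w} A X →ₗ[ℂ] ℂ ⊗[ℤ] GK.{u, v, w} A X :=
  (GK.tensorLeft F).toIntLinearMap.baseChange ℂ

theorem tensorLeftC_cclass (F : GBundle.{u, v, w} A X) (x : GK.{u, v, w} A X) :
    tensorLeftC F (cclass x) = cclass (GK.tensorLeft F x) :=
  LinearMap.baseChange_tmul _ _ _

/-- The trace on the group algebra of `S_n` whose value on an idempotent `a` is the class of the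
image of `a` in `E^{⊗ n}`. -/
theorem exists_permTrace (n : ℕ) (E : GBundle.{u, v, w} A X) :
    ∃ τ : MonoidAlgebra ℂ (Equiv.Perm (Fin n)) →ₗ[ℂ] ℂ ⊗[ℤ] GK.{u, v, w} A X,
      (∀ a b, τ (a * b) = τ (b * a)) ∧ ∀ e, IsIdempotentElem e →
        τ e = cclass (idemClass (tpow n E) (permAlg n E e)) := by
  -- The hypothesis of Maschke's theorem, giving semisimplicity of the group algebra.
  have : NeZero (Nat.card (Equiv.Perm (Fin n)) : ℂ) :=
    ⟨by exact_mod_cast Nat.card_pos.ne'⟩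
  have h : IsIdemInvariant fun a : MonoidAlgebra ℂ (Equiv.Perm (Fin n)) =>
      cclass (idemClass (tpow n E) (permAlg n E a)) := by
    constructor
    · intro a b ha hb hab hba
      rw [map_add, (idemClass_isIdemInvariant (tpow n E)).add _ _ (ha.map (permAlg n E))
        (hb.map (permAlg n E)) (by rw [← map_mul, hab, map_zero])
        (by rw [← map_mul, hba, map_zero]), map_add]
    · intro a b hab hba
      have h1 := hab.map (permAlg n E)
      have h2 := hba.map (permAlg n E)
      rw [map_mul] at h1 h2
      rw [map_mul, map_mul, (idemClass_isIdemInvariant (tpow n E)).comm _ _ h1 h2]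
  exact h.exists_trace

/-- The rotation is replaced by its spectral decomposition. Each term is then ξ times a product of
commuting idempotents, on which τ is known by hypothesis. -/
theorem sum_smul_cclass_block {n : ℕ} {E : GBundle.{u, v, w} A X}
    {τ : MonoidAlgebra ℂ (Equiv.Perm (Fin n)) →ₗ[ℂ] ℂ ⊗[ℤ] GK.{u, v, w} A X}
    (hτ : ∀ e, IsIdempotentElem e → τ e = cclass (idemClass (tpow n E) (permAlg n E e)))
    {m k : ℕ} (hk : 0 < k) (e : Fin m ⊕ Fin k ≃ Fin n) :
    τ (blockAlgLeft e (antisym m) * blockAlgRight e (rot k)) =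
      tensorLeftC (exteriorPow E m) (rotClass k E) := by
  have h1 := sum_smul_eigenIdem hk (rot_pow k)
  conv_lhs => rw [← h1]
  rw [rotClass, map_sum, map_sum, Finset.mul_sum, map_sum]
  refine Finset.sum_congr rfl fun ξ hξ => ?_
  have hid := isIdempotentElem_eigenIdem hk (rot_pow k) ((Polynomial.mem_nthRootsFinset hk _).1 hξ)
  have hab : IsIdempotentElem (blockAlgLeft e (antisym m) *
      blockAlgRight e (eigenIdem k (rot k) ξ)) := by
    rw [IsIdempotentElem, mul_assoc, ← mul_assoc (blockAlgRight e _), ← blockAlg_comm, mul_assoc,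
      ((hid.map (blockAlgRight e)).eq), ← mul_assoc,
      ((isIdempotentElem_antisym m).map (blockAlgLeft e)).eq]
  rw [map_smul, mul_smul_comm, map_smul, map_smul, hτ _ hab, idemClass_block E e hid,
    tensorLeftC_cclass]

theorem rotClass_eq {n : ℕ} {E : GBundle.{u, v, w} A X}
    {τ : MonoidAlgebra ℂ (Equiv.Perm (Fin n)) →ₗ[ℂ] ℂ ⊗[ℤ] GK.{u, v, w} A X}
    (hτ : ∀ e, IsIdempotentElem e → τ e = cclass (idemClass (tpow n E) (permAlg n E e)))
    (hn : 0 < n) : rotClass n E = τ (rot n) := by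
  conv_rhs => rw [← sum_smul_eigenIdem hn (rot_pow n)]
  rw [map_sum, rotClass]
  refine Finset.sum_congr rfl fun ξ hξ => ?_
  rw [map_smul, hτ _ (isIdempotentElem_eigenIdem hn (rot_pow n)
    ((Polynomial.mem_nthRootsFinset hn _).1 hξ))]

theorem antisymCycle_zero {n : ℕ} {V : Type*} [AddCommGroup V] [Module ℂ V]
    (f : Equiv.Perm (Fin n) → V) (h : n + 0 = n) :
    antisymCycle f 0 n h = f (finRotate n) := by
  have h2 : blockPerm (lastFirst h) (1, finRotate n) = finRotate n := by
    ext1 i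
    have h4 : ∀ i, lastFirst h (Sum.inr i) = i := fun i => rfl
    conv_lhs => rw [← h4 i, blockPerm_inr, h4]
  rw [antisymCycle, Fintype.sum_unique]
  have h3 : (default : Equiv.Perm (Fin 0)) = 1 := Subsingleton.elim _ _
  rw [h3, h2]
  simp

/-- By linearity of τ; this passes from the combinatorial expression in Newton's formula to the
trace of a product of block elements. -/
theorem antisymCycle_eq {n : ℕ} {V : Type*} [AddCommGroup V] [Module ℂ V]
    {τ : MonoidAlgebra ℂ (Equiv.Perm (Fin n)) →ₗ[ℂ] V}
    {m k : ℕ} (h : k + m = n) :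
    antisymCycle (fun π => τ (MonoidAlgebra.of ℂ _ π)) m k h =
      τ (blockAlgLeft (lastFirst h) (antisym m) * blockAlgRight (lastFirst h) (rot k)) := by
  rw [antisym, map_smul, smul_mul_assoc, map_smul, map_sum, Finset.sum_mul, map_sum, antisymCycle]
  congr 1
  refine Finset.sum_congr rfl fun π _ => ?_
  rw [map_smul, smul_mul_assoc, map_smul, blockAlgLeft_of, rot, blockAlgRight_of, ← map_mul,
    blockPerm_mul, Int.cast_smul_eq_zsmul]

/-- The unsigned rotation of the factors of `E^{⊗ n}` computes the Adams operation. -/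
theorem rotClass_eq_adams (E : GBundle.{u, v, w} A X) (n : ℕ) (hn : 0 < n) :
    rotClass n E = cclass (adams E n) := by
  induction n using Nat.strong_induction_on with
  | _ n ih =>
  obtain ⟨m, rfl⟩ : ∃ m, n = m + 1 := ⟨n - 1, by omega⟩
  obtain ⟨τ, hcomm, hτ⟩ := exists_permTrace (m + 1) E
  have hN := newton_classFunction (f := fun π => τ (MonoidAlgebra.of ℂ _ π))
    (fun a b => by
      rw [map_mul (MonoidAlgebra.of ℂ (Equiv.Perm (Fin (m + 1)))),
        map_mul (MonoidAlgebra.of ℂ (Equiv.Perm (Fin (m + 1)))), hcomm]) (rfl : m + 1 = m + 1)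
  -- The left side of Newton's formula is (m + 1) times the trace of the antisymmetrizer of S_{m+1},
  -- the factor coming from (m+1)!/m!.
  have hL : (m.factorial : ℂ)⁻¹ • ∑ π : Equiv.Perm (Fin (m + 1)), (Equiv.Perm.sign π : ℤ) •
      τ (MonoidAlgebra.of ℂ _ π) = ((m + 1 : ℕ) : ℂ) • cclass (GK.of (exteriorPow E (m + 1))) := by
    have hfac : (m.factorial : ℂ)⁻¹ = ((m + 1 : ℕ) : ℂ) * ((m + 1).factorial : ℂ)⁻¹ := by
      have h1 : ((m + 1 : ℕ) : ℂ) ≠ 0 := by exact_mod_cast m.succ_ne_zero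
      have h2 : (m.factorial : ℂ) ≠ 0 := by exact_mod_cast m.factorial_ne_zero
      rw [Nat.factorial_succ, Nat.cast_mul]
      field_simp
    rw [← idemClass_antisym, ← hτ _ (isIdempotentElem_antisym _), antisym, map_smul, map_sum,
      hfac, mul_smul]
    congr 2
    refine Finset.sum_congr rfl fun π _ => ?_
    rw [map_smul, Int.cast_smul_eq_zsmul]
  -- Cycles shorter than m + 1 are covered by the induction hypothesis.
  have hZ : ∀ (j : Fin m), antisymCycle (fun π => τ (MonoidAlgebra.of ℂ _ π)) (m - j) (j + 1)
      (by omega) = cclass (GK.tensorLeft (exteriorPow E (m - j)) (adams E (j + 1))) := by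
    intro j
    rw [antisymCycle_eq, sum_smul_cclass_block hτ (Nat.succ_pos _), ih _ (by omega) (by omega),
      tensorLeftC_cclass]
  have hcongr : ∀ m' k m'' k' (h : k + m' = m + 1) (h' : k' + m'' = m + 1), m' = m'' → k = k' →
      antisymCycle (fun π => τ (MonoidAlgebra.of ℂ _ π)) m' k h =
        antisymCycle (fun π => τ (MonoidAlgebra.of ℂ _ π)) m'' k' h' := by
    rintro m' k _ _ _ _ rfl rfl; rfl
  -- The longest cycle leaves no index to the antisymmetrizer; this term is the unknown.
  have hlast : antisymCycle (fun π => τ (MonoidAlgebra.of ℂ _ π)) (m - m) (m + 1)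
      (by omega) = rotClass (m + 1) E := by
    rw [hcongr _ _ 0 (m + 1) _ rfl (by omega) rfl, antisymCycle_zero, rotClass_eq hτ hn, rot]
  rw [hL, Fin.sum_univ_castSucc] at hN
  simp only [Fin.val_castSucc, Fin.val_last] at hN
  rw [hlast, Finset.sum_congr rfl fun j _ => congrArg _ (hZ j)] at hN
  have hsq : ((-1) ^ m * (-1) ^ m : ℤ) = 1 := by rw [← mul_pow]; simp
  have hA : adams E (m + 1) = ((-1) ^ m * (m + 1) : ℤ) • GK.of (exteriorPow E (m + 1)) +
      ∑ i : Fin m, ((-1) ^ (i : ℕ) : ℤ) •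
        GK.tensorLeft (exteriorPow E (i + 1)) (adams E (m - i)) := by rw [adams]
  -- The recursion defining `adams` is ordered by the exterior power and Newton's formula by the
  -- cycle length; the reversal i = m - 1 - j matches them and produces the sign -(-1)^m.
  have hS : ∑ i : Fin m, ((-1) ^ (i : ℕ) : ℤ) •
        GK.tensorLeft (exteriorPow E (i + 1)) (adams E (m - i)) =
      -((-1) ^ m : ℤ) • ∑ j : Fin m, ((-1) ^ (j : ℕ) : ℤ) •
        GK.tensorLeft (exteriorPow E (m - j)) (adams E (j + 1)) := by
    rw [Finset.smul_sum, ← Equiv.sum_comp Fin.revPerm]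
    refine Finset.sum_congr rfl fun j _ => ?_
    have hj := j.isLt
    have e1 : (Fin.revPerm j : ℕ) = m - (j + 1) := by simp [Fin.val_rev]
    have e2 : m - (j + 1) + 1 = m - j := by omega
    have e3 : m - (m - (j + 1)) = j + 1 := by omega
    rw [e1, e2, e3, smul_smul]
    congr 1
    obtain ⟨c, hc⟩ : ∃ c, m = j + 1 + c := ⟨m - (j + 1), by omega⟩
    have e4 : m - (j + 1) = c := by omega
    rw [e4]
    have hp : (-1 : ℤ) ^ m = (-1) ^ (j + 1 + c : ℕ) := congrArg _ hc
    rw [hp, pow_add, pow_succ]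
    have : ((-1) ^ (j : ℕ) * (-1) ^ (j : ℕ) : ℤ) = 1 := by rw [← mul_pow]; simp
    linear_combination (-(-1) ^ c) * this
  have h1 : rotClass (m + 1) E = ((-1) ^ m : ℤ) • (((-1) ^ m : ℤ) • rotClass (m + 1) E) := by
    rw [smul_smul, hsq, one_smul]
  rw [h1, ← sub_eq_iff_eq_add'.2 hN, hA, hS, map_add, map_zsmul, map_zsmul, map_sum, smul_sub,
    mul_smul, sub_eq_add_neg]
  simp only [map_zsmul, neg_smul]
  congr 2
  rw [← Int.cast_smul_eq_zsmul ℂ ((m : ℤ) + 1)]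
  push_cast
  rfl

end newton

/-! ### Reduction of localized classes to idempotents of the signed rotation. -/

section gradedRotation

variable {A : Type w} {X : Type u} [TopologicalSpace X]

/-- The endomorphism of the pullback of `V` to a space over `M^g` given by the action of `g`. -/
def EqBundle.fixedEnd {M : Type u} [TopologicalSpace M] {G : Type*} [Group G] {α : G →* (M ≃ₜ M)}
    (V : EqBundle.{u, v, w} A α) (g : G) (φ : X → FixedPts α g) (hφ : Continuous φ) :
    EndB (pullback φ hφ (V.restrictFixed g)) :=
  ⟨fun x => V.fixedAct g (φ x), (V.fixedAct_isHom g).pullback φ hφ⟩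

theorem EndB.eigenIdem_apply {E : GBundle.{u, v, w} A X} (T : EndB E) (m : ℕ) (ξ : ℂ) (x : X) :
    (eigenIdem m T ξ).1 x = eigenIdem m (T.1 x) ξ :=
  map_eigenIdem ((Pi.evalAlgHom ℂ (fun x => Module.End ℂ (E.fiber x)) x).comp (EndB E).val) m T ξ

theorem EqBundle.fixedEnd_pow {M : Type u} [TopologicalSpace M] {G : Type*} [Group G]
    {α : G →* (M ≃ₜ M)} (V : EqBundle.{u, v, w} A α) (g : G) (φ : X → FixedPts α g)
    (hφ : Continuous φ) : V.fixedEnd g φ hφ ^ orderOf g = 1 :=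
  Subtype.ext (funext fun x => V.fixedAct_pow_orderOf g (φ x))

theorem eigenIdem_apply_of_eq {V : Type*} [AddCommGroup V] [Module ℂ V] {T : Module.End ℂ V}
    {m : ℕ} (hm : 0 < m) {ξ : ℂ} (hξ : ξ ^ m = 1) {v : V} (hv : T v = ξ • v) :
    eigenIdem m T ξ v = v := by
  have hξ0 : ξ ≠ 0 := by
    rintro rfl
    rw [zero_pow hm.ne'] at hξ
    exact zero_ne_one hξ
  have hpow : ∀ k : ℕ, (T ^ k) v = ξ ^ k • v := by
    intro k
    induction k with
    | zero => simp
    | succ k ih => rw [pow_succ, Module.End.mul_apply, hv, map_smul, ih, smul_smul, pow_succ']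
  have h6 : ∀ k, (ξ⁻¹) ^ k • (T ^ k) v = v := by
    intro k
    rw [hpow, smul_smul, ← mul_pow, inv_mul_cancel₀ hξ0, one_pow, one_smul]
  simp only [eigenIdem, LinearMap.smul_apply, LinearMap.sum_apply, h6, Finset.sum_const,
    Finset.card_range]
  rw [← Nat.cast_smul_eq_nsmul ℂ, smul_smul, inv_mul_cancel₀ (by exact_mod_cast hm.ne'), one_smul]

/-- The averaging projector and the inclusion of the eigenbundle split the spectral idempotent, and
both pull back. Hence the eigenbundle need not be compared with a new choice of frames on the
source. -/
theorem pullback_eigenbundle {M : Type u} [TopologicalSpace M] {G : Type*} [Group G] [Finite G]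
    {α : G →* (M ≃ₜ M)} (V : EqBundle.{u, v, w} A α) (g : G) (φ : X → FixedPts α g)
    (hφ : Continuous φ) {ξ : ℂ} (hξ : ξ ^ orderOf g = 1) :
    GK.of (pullback φ hφ (V.eigenbundle g ξ)) = idemClass (pullback φ hφ (V.restrictFixed g))
      (eigenIdem (orderOf g) (V.fixedEnd g φ hφ) ξ) := by
  have hm : 0 < orderOf g := orderOf_pos g
  let T : EndB (V.restrictFixed g) := ⟨V.fixedAct g, V.fixedAct_isHom g⟩
  have hT : ∀ y, T.1 y ^ orderOf g = 1 := V.fixedAct_pow_orderOf g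
  have hW : ∀ y v, (eigenIdem (orderOf g) T ξ).1 y v ∈
      Module.End.eigenspace (V.fixedAct g y) ξ := by
    intro y v
    rw [Module.End.mem_eigenspace_iff, EndB.eigenIdem_apply]
    exact LinearMap.congr_fun (mul_eigenIdem hm (hT y) hξ) v
  have hsub := eigenspace_isSubbundle _ _ (V.fixedAct_isHom g) (orderOf_pos g)
      (V.fixedAct_pow_orderOf g) ξ
  have hf := ((eigenIdem (orderOf g) T ξ).2.codRestrict hsub hW).pullback φ hφ
  have hg := (subbundle_subtype_isHom _ _ hsub).pullback φ hφ
  refine (idemClass_eq_of (isIdempotentElem_eigenIdem hm (V.fixedEnd_pow g φ hφ) hξ) hf hg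
    (fun x v => ?_) (fun x v => ?_)).symm
  · exact (LinearMap.congr_fun (EndB.eigenIdem_apply T (orderOf g) ξ (φ x)) v).trans
      (LinearMap.congr_fun (EndB.eigenIdem_apply (V.fixedEnd g φ hφ) (orderOf g) ξ x) v).symm
  · have h1 : T.1 (φ x) v.1 = ξ • v.1 := Module.End.mem_eigenspace_iff.1 v.2
    refine Subtype.ext ?_
    refine (LinearMap.congr_fun (EndB.eigenIdem_apply T (orderOf g) ξ (φ x)) v.1).trans ?_
    exact eigenIdem_apply_of_eq hm hξ h1

/-- Exchange of the tensor factors `ℂ` and `GK`. -/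
noncomputable def tensorSwap : ℂ ⊗[ℤ] GK.{u, v, w} A X →ₗ[ℤ] GK.{u, v, w} A X ⊗[ℤ] ℂ :=
  (TensorProduct.comm ℤ ℂ (GK.{u, v, w} A X)).toLinearMap

theorem tensorSwap_smul_cclass (ξ : ℂ) (a : GK.{u, v, w} A X) :
    tensorSwap (ξ • cclass a) = a ⊗ₜ[ℤ] ξ := by
  rw [smul_cclass]; rfl

theorem tensorSwap_cclass (a : GK.{u, v, w} A X) : tensorSwap (cclass a) = a ⊗ₜ[ℤ] (1 : ℂ) := rfl

theorem pullbackC_phi {M : Type u} [TopologicalSpace M] {G : Type*} [Group G] [Finite G]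
    {α : G →* (M ≃ₜ M)} (V : EqBundle.{u, v, w} A α) (g : G) (φ : X → FixedPts α g)
    (hφ : Continuous φ) :
    GK.pullbackC φ hφ (phi g V) = tensorSwap (∑ ξ ∈ Polynomial.nthRootsFinset (orderOf g) (1 : ℂ),
      ξ • cclass (idemClass (pullback φ hφ (V.restrictFixed g))
        (eigenIdem (orderOf g) (V.fixedEnd g φ hφ) ξ))) := by
  rw [phi, map_sum, map_sum]
  refine Finset.sum_congr rfl fun ξ hξ => ?_
  rw [tensorSwap_smul_cclass, ← pullback_eigenbundle V g φ hφ
    ((Polynomial.mem_nthRootsFinset (orderOf_pos g) _).1 hξ), ← GK.pullback_of φ hφ]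
  rfl

variable [AddCommMonoid A] (par : A →+ ZMod 2)

theorem orderOf_finRotate {n : ℕ} (hn : 0 < n) : orderOf (finRotate n) = n := by
  rcases n with _ | _ | n
  · omega
  · have : finRotate (0 + 1) = 1 := finRotate_one
    rw [this, orderOf_one]
  · have h := isCycle_finRotate.orderOf (f := finRotate (n + 2))
    rwa [support_finRotate, Finset.card_univ, Fintype.card_fin] at h

/-- The graded rotation of the factors of `E^{⊗ n}`, with the Koszul sign. -/
noncomputable def koszulRot (n : ℕ) (E : GBundle.{u, v, w} A X) : EndB (tpow n E) :=
  ⟨fun x => boxAct par E (fun (_ : Fin n) x => x) (finRotate n) (y := x) (z := x) fun _ => rfl,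
    ((tensorPow par n E).fixedEnd (finRotate n) (toFixed (finRotate n))
      (continuous_toFixed (finRotate n))).2⟩

theorem koszulRot_pow {n : ℕ} (hn : 0 < n) (E : GBundle.{u, v, w} A X) :
    koszulRot par n E ^ n = 1 := by
  have h := (tensorPow par n E).fixedEnd_pow (finRotate n) (toFixed (finRotate n))
      (continuous_toFixed (finRotate n))
  rw [orderOf_finRotate hn] at h
  exact h

/-- The sum of the eigenbundles of the graded rotation of `E^{⊗ n}`, weighted with the
eigenvalues. -/
noncomputable def koszulRotClass (n : ℕ) (E : GBundle.{u, v, w} A X) : ℂ ⊗[ℤ] GK.{u, v, w} A X :=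
  ∑ ξ ∈ Polynomial.nthRootsFinset n (1 : ℂ),
    ξ • cclass (idemClass (tpow n E) (eigenIdem n (koszulRot par n E) ξ))

theorem pullbackC_phi_tensorPow {n : ℕ} (hn : 0 < n) (E : GBundle.{u, v, w} A X) :
    GK.pullbackC (toFixed (finRotate n)) (continuous_toFixed (finRotate n))
      (phi (finRotate n) (tensorPow par n E)) = tensorSwap (koszulRotClass par n E) := by
  refine (pullbackC_phi _ _ _ _).trans ?_
  rw [orderOf_finRotate hn]
  rfl

/-- Along the diagonal, the external power and its action restrict definitionally to the tensor
power with the signed rotation. Both halves of identity 1 therefore reduce to the same class. -/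
theorem pullbackC_phi_extTensorPow {n : ℕ} (hn : 0 < n) (E : GBundle.{u, v, w} A X) :
    GK.pullbackC (diag n (finRotate n)) (continuous_diag n (finRotate n))
      (phi (finRotate n) (extTensorPow par n E)) = tensorSwap (koszulRotClass par n E) := by
  refine (pullbackC_phi _ _ _ _).trans ?_
  rw [orderOf_finRotate hn]
  rfl

end gradedRotation

/-! ### Vanishing of eigenvalue-weighted sums under a twist by a root of unity. -/

section twisted

variable {R V : Type*} [Ring R] [Algebra ℂ R] [AddCommGroup V] [Module ℂ V] {ν : R → V}

theorem sum_nthRoots_mul {n : ℕ} (hn : 0 < n) {c : ℂ} (hc : c ^ n = 1) (f : ℂ → V) :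
    ∑ ξ ∈ Polynomial.nthRootsFinset n (1 : ℂ), f (c * ξ) =
      ∑ ξ ∈ Polynomial.nthRootsFinset n (1 : ℂ), f ξ := by
  have hc0 : c ≠ 0 := by
    rintro rfl
    rw [zero_pow hn.ne'] at hc
    exact zero_ne_one hc
  refine Finset.sum_bij' (fun ξ _ => c * ξ) (fun ξ _ => c⁻¹ * ξ) ?_ ?_ ?_ ?_ fun _ _ => rfl
  · intro ξ hξ
    rw [Polynomial.mem_nthRootsFinset hn] at hξ ⊢
    rw [mul_pow, hc, hξ, one_mul]
  · intro ξ hξ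
    rw [Polynomial.mem_nthRootsFinset hn] at hξ ⊢
    rw [mul_pow, inv_pow, hc, hξ, inv_one, one_mul]
  · intro ξ _; field_simp
  · intro ξ _; field_simp

/-- The eigenvalue-weighted invariant of `T` vanishes on a summand on which `T` is conjugate to a
nontrivial multiple of itself. -/
theorem IsIdemInvariant.sum_smul_eq_zero (h : IsIdemInvariant ν) {n : ℕ} (hn : 0 < n)
    {T Q S S' : R} (hT : T ^ n = 1) (hQ : IsIdempotentElem Q) (hQT : Commute Q T)
    (hQS : Commute Q S') (hS' : S' * S = 1) (hS : S * S' = 1) {c : ℂ} (hc : c ^ n = 1)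
    (hc1 : c ≠ 1) (hST : S * T * Q = c • (T * S * Q)) :
    ∑ ξ ∈ Polynomial.nthRootsFinset n (1 : ℂ), ξ • ν (eigenIdem n T ξ * Q) = 0 := by
  have hc0 : c ≠ 0 := by
    rintro rfl
    rw [zero_pow hn.ne'] at hc
    exact zero_ne_one hc
  have hpow : ∀ j : ℕ, S * T ^ j * Q = c ^ j • (T ^ j * S * Q) := by
    intro j
    induction j with
    | zero => simp
    | succ j ih =>
      calc S * T ^ (j + 1) * Q = S * T ^ j * Q * T := by
            rw [pow_succ, mul_assoc, mul_assoc, ← hQT.eq, mul_assoc, mul_assoc]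
        _ = c ^ j • (T ^ j * (S * T * Q)) := by
            rw [ih, smul_mul_assoc, mul_assoc, mul_assoc, hQT.eq]
            simp only [mul_assoc]
        _ = _ := by
            rw [hST, mul_smul_comm, smul_smul, ← pow_succ, pow_succ T]
            simp only [mul_assoc]
  -- Replacing T by c T in the averaging projector amounts to replacing ξ by c⁻¹ ξ.
  have hconj : ∀ ξ, S * eigenIdem n T ξ * Q = eigenIdem n T (c⁻¹ * ξ) * S * Q := by
    intro ξ
    simp only [eigenIdem, mul_smul_comm, smul_mul_assoc, Finset.mul_sum, Finset.sum_mul, hpow]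
    congr 1
    refine Finset.sum_congr rfl fun j _ => ?_
    rw [smul_smul, mul_inv, inv_inv, mul_pow, mul_comm]
  have hid : ∀ ξ, ξ ^ n = 1 → IsIdempotentElem (eigenIdem n T ξ * Q) := fun ξ hξ =>
    IsIdempotentElem.mul_of_commute (commute_eigenIdem hQT n ξ).symm
      (isIdempotentElem_eigenIdem hn hT hξ) hQ
  have hν : ∀ ξ, ξ ^ n = 1 → ν (eigenIdem n T ξ * Q) = ν (eigenIdem n T (c⁻¹ * ξ) * Q) := by
    intro ξ hξ
    -- The two idempotents are ab and ba for a = S' and b = S times the first one, hence have the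
    -- same invariant.
    have h1 : S' * (S * (eigenIdem n T ξ * Q)) = eigenIdem n T ξ * Q := by
      rw [← mul_assoc, hS', one_mul]
    have h2 : S * (eigenIdem n T ξ * Q) * S' = eigenIdem n T (c⁻¹ * ξ) * Q := by
      rw [← mul_assoc, hconj, mul_assoc, hQS.eq, mul_assoc, ← mul_assoc S, hS, one_mul]
    rw [← h1, ← h2]
    refine h.comm _ _ ?_ ?_
    · rw [h1]; exact hid ξ hξ
    · rw [h2]; exact hid _ (by rw [mul_pow, inv_pow, hc, hξ, inv_one, one_mul])
  set s := ∑ ξ ∈ Polynomial.nthRootsFinset n (1 : ℂ), ξ • ν (eigenIdem n T ξ * Q) with hs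
  -- Reindexing the roots by c changes the weight by the factor c and, by the previous step, leaves
  -- the invariants unchanged.
  have key : s = c • s := by
    conv_lhs => rw [hs]
    rw [← sum_nthRoots_mul hn hc, hs, Finset.smul_sum]
    refine Finset.sum_congr rfl fun ξ hξ => ?_
    rw [Polynomial.mem_nthRootsFinset hn] at hξ
    rw [hν (c * ξ) (by rw [mul_pow, hc, hξ, one_mul]), inv_mul_cancel_left₀ hc0, mul_smul]
  have : (1 - c) • s = 0 := by rw [sub_smul, one_smul, ← key, sub_self]
  exact (smul_eq_zero.1 this).resolve_left (sub_ne_zero.2 hc1.symm)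

end twisted

/-! ### Cancellation of the mixed parity patterns. -/

section parityDecomposition

variable {R V : Type*} [Ring R] [Algebra ℂ R] [AddCommGroup V] [Module ℂ V] {ν : R → V} {n : ℕ}

/-- The number of odd entries. -/
def oddCount (ε : Fin n → ZMod 2) : ℕ := ∑ i, (ε i).val

/-- The sum of the positions of the odd entries. -/
def oddWeight (ε : Fin n → ZMod 2) : ℕ := ∑ i : Fin n, (i : ℕ) * (ε i).val

theorem ZMod2_val_le_one (a : ZMod 2) : a.val ≤ 1 := Nat.lt_succ_iff.1 (ZMod.val_lt a)

theorem oddCount_le (ε : Fin n → ZMod 2) : oddCount ε ≤ n :=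
  (Finset.sum_le_card_nsmul _ _ 1 fun i _ => ZMod2_val_le_one (ε i)).trans (by simp)

theorem oddCount_comp (ε : Fin n → ZMod 2) (σ : Equiv.Perm (Fin n)) :
    oddCount (fun i => ε (σ i)) = oddCount ε :=
  Equiv.sum_comp σ fun i => (ε i).val

theorem oddCount_eq_zero {ε : Fin n → ZMod 2} : oddCount ε = 0 ↔ ε = fun _ => 0 := by
  simp [oddCount, funext_iff]

theorem oddCount_eq {ε : Fin n → ZMod 2} : oddCount ε = n ↔ ε = fun _ => 1 := by
  constructor
  · intro h
    have h1 : ∑ i : Fin n, (1 - (ε i).val) = 0 := by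
      have h2 : ∑ i : Fin n, (1 - (ε i).val) + oddCount ε = n := by
        rw [oddCount, ← Finset.sum_add_distrib]
        rw [Finset.sum_congr rfl fun i _ => Nat.sub_add_cancel (ZMod2_val_le_one (ε i))]
        simp
      omega
    funext i
    have h2 := Finset.sum_eq_zero_iff.1 h1 i (Finset.mem_univ i)
    have h3 := ZMod2_val_le_one (ε i)
    exact ZMod.val_injective 2 (by rw [ZMod.val_one]; omega)
  · rintro rfl
    simp [oddCount, ZMod.val_one]

/-- Rotation raises every position by one modulo n, so the sum of the odd positions changes modulo n
by the number of odd entries. -/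
theorem pow_oddWeight {ζ : ℂ} (hζ : ζ ^ n = 1) (ε : Fin n → ZMod 2) :
    ζ ^ oddWeight ε = ζ ^ oddCount ε * ζ ^ oddWeight fun i => ε (finRotate n i) := by
  have h1 : ∀ i : Fin n, ζ ^ (finRotate n i : ℕ) = ζ * ζ ^ (i : ℕ) := by
    intro i
    obtain ⟨m, rfl⟩ : ∃ m, n = m + 1 := ⟨n - 1, by have := i.isLt; omega⟩
    rcases eq_or_ne i (Fin.last m) with rfl | h
    · rw [finRotate_last, Fin.val_zero, pow_zero, Fin.val_last, ← pow_succ', hζ]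
    · rw [coe_finRotate_of_ne_last h, pow_succ']
  rw [oddWeight, oddWeight, ← Equiv.sum_comp (finRotate n), ← Finset.prod_pow_eq_pow_sum,
    ← Finset.prod_pow_eq_pow_sum, ← oddCount_comp ε (finRotate n), oddCount,
    ← Finset.prod_pow_eq_pow_sum, ← Finset.prod_mul_distrib]
  refine Finset.prod_congr rfl fun i _ => ?_
  rw [pow_mul, h1, mul_pow, pow_mul]

/-- An idempotent invariant, weighted with the eigenvalues of a signed rotation of the summands in a
decomposition with `2 ^ n` summands, depends only on the two invariant summands. -/
theorem IsIdemInvariant.sum_smul_signedRotation (h : IsIdemInvariant ν) (hn : 0 < n)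
    {T ρ : R} (hT : T ^ n = 1) {q : (Fin n → ZMod 2) → R}
    (hqq : ∀ ε ε', q ε * q ε' = if ε = ε' then q ε else 0) (hq1 : ∑ ε, q ε = 1)
    (hρ : ∀ ε, q ε * ρ = ρ * q fun i => ε (finRotate n i)) {s : (Fin n → ZMod 2) → ℂ}
    (hTs : T = ∑ ε, s ε • (ρ * q ε)) :
    ∑ ξ ∈ Polynomial.nthRootsFinset n (1 : ℂ), ξ • ν (eigenIdem n T ξ) =
      ∑ ξ ∈ Polynomial.nthRootsFinset n (1 : ℂ), ξ • ν (eigenIdem n T ξ * q fun _ => 0) +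
        ∑ ξ ∈ Polynomial.nthRootsFinset n (1 : ℂ), ξ • ν (eigenIdem n T ξ * q fun _ => 1) := by
  classical
  -- The scalars in T do not affect how it permutes the summands, so T obeys the same intertwining
  -- relation as the unsigned ρ.
  have hqT : ∀ ε, q ε * T = T * q fun i => ε (finRotate n i) := by
    intro ε
    rw [hTs, Finset.mul_sum, Finset.sum_mul]
    refine Finset.sum_congr rfl fun ε' _ => ?_
    rw [mul_smul_comm, smul_mul_assoc, ← mul_assoc, hρ, mul_assoc, mul_assoc, hqq, hqq]
    by_cases h1 : (fun i => ε (finRotate n i)) = ε'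
    · rw [if_pos h1, if_pos h1.symm, h1]
    · rw [if_neg h1, if_neg (Ne.symm h1)]
  -- Projector onto the patterns with exactly k odd entries. This number is invariant under
  -- rotation, so T commutes with it.
  let Q : ℕ → R := fun k => ∑ ε, if oddCount ε = k then q ε else 0
  have hqQ : ∀ ε k, q ε * Q k = if oddCount ε = k then q ε else 0 := by
    intro ε k
    simp only [Q, Finset.mul_sum]
    rw [Finset.sum_eq_single ε]
    · rw [mul_ite, hqq, if_pos rfl, mul_zero]
    · intro ε' _ h1
      rw [mul_ite, hqq, if_neg h1.symm, mul_zero, ite_self]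
    · simp
  have hQQ : ∀ k l, Q k * Q l = if k = l then Q k else 0 := by
    intro k l
    change (∑ ε, if oddCount ε = k then q ε else 0) * Q l = _
    rw [Finset.sum_mul]
    simp only [ite_mul, zero_mul, hqQ]
    split_ifs with h1
    · subst h1
      exact Finset.sum_congr rfl fun ε _ => by split_ifs <;> rfl
    · refine Finset.sum_eq_zero fun ε _ => ?_
      split_ifs with h2 h3
      · exact (h1 (h2.symm.trans h3)).elim
      · rfl
      · rfl
  have hQT : ∀ k, Commute (Q k) T := by
    intro k
    change (∑ ε, if oddCount ε = k then q ε else 0) * T =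
      T * ∑ ε, if oddCount ε = k then q ε else 0
    rw [Finset.sum_mul, Finset.mul_sum]
    rw [← Equiv.sum_comp ((finRotate n).arrowCongr (Equiv.refl (ZMod 2)))]
    refine Finset.sum_congr rfl fun ε _ => ?_
    have h1 : (fun i => (finRotate n).arrowCongr (Equiv.refl (ZMod 2)) ε (finRotate n i)) = ε :=
      funext fun i => congrArg ε ((finRotate n).symm_apply_apply i)
    have h2 := oddCount_comp ((finRotate n).arrowCongr (Equiv.refl (ZMod 2)) ε) (finRotate n)
    rw [h1] at h2
    rw [ite_mul, hqT, h1, ← h2, zero_mul, mul_ite, mul_zero]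
  have hQ1 : ∑ k ∈ Finset.range (n + 1), Q k = 1 := by
    simp only [Q]
    rw [Finset.sum_comm, ← hq1]
    refine Finset.sum_congr rfl fun ε _ => ?_
    rw [Finset.sum_ite_eq, if_pos (Finset.mem_range.2 (Nat.lt_succ_of_le (oddCount_le ε)))]
  have hsplit : ∀ ξ ∈ Polynomial.nthRootsFinset n (1 : ℂ), ξ • ν (eigenIdem n T ξ) =
      ∑ k ∈ Finset.range (n + 1), ξ • ν (eigenIdem n T ξ * Q k) := by
    intro ξ hξ
    have hid := isIdempotentElem_eigenIdem hn hT ((Polynomial.mem_nthRootsFinset hn _).1 hξ)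
    have hc : ∀ k, Commute (Q k) (eigenIdem n T ξ) := fun k => commute_eigenIdem (hQT k) n ξ
    rw [← Finset.smul_sum, ← h.sum]
    · rw [← Finset.mul_sum, hQ1, mul_one]
    · intro k
      exact IsIdempotentElem.mul_of_commute (hc k).symm hid (by
        rw [IsIdempotentElem, hQQ, if_pos rfl])
    · intro k l hkl
      rw [mul_assoc, ← mul_assoc (Q k), (hc k).eq, mul_assoc, hQQ, if_neg hkl, mul_zero, mul_zero]
  rw [Finset.sum_congr rfl hsplit, Finset.sum_comm]
  obtain ⟨ζ, hζ⟩ : ∃ ζ : ℂ, IsPrimitiveRoot ζ n :=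
    ⟨_, Complex.isPrimitiveRoot_exp n hn.ne'⟩
  have hζ0 : ζ ≠ 0 := hζ.ne_zero hn.ne'
  -- The twisting operator: by `pow_oddWeight`, conjugation by S multiplies T by ζ^k on the image of
  -- `Q k`.
  let S : R := ∑ ε, ζ ^ oddWeight ε • q ε
  let S' : R := ∑ ε, (ζ ^ oddWeight ε)⁻¹ • q ε
  have hSq : ∀ ε, S * q ε = ζ ^ oddWeight ε • q ε := by
    intro ε
    simp only [S, Finset.sum_mul, smul_mul_assoc, hqq, smul_ite, smul_zero]
    rw [Finset.sum_ite_eq' Finset.univ ε, if_pos (Finset.mem_univ _)]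
  have hqS : ∀ ε, q ε * S = ζ ^ oddWeight ε • q ε := by
    intro ε
    simp only [S, Finset.mul_sum, mul_smul_comm, hqq, smul_ite, smul_zero]
    rw [Finset.sum_ite_eq Finset.univ ε, if_pos (Finset.mem_univ _)]
  have hSS' : S * S' = 1 := by
    simp only [S', Finset.mul_sum, mul_smul_comm, hSq, smul_smul]
    rw [← hq1]
    exact Finset.sum_congr rfl fun ε _ => by
      rw [inv_mul_cancel₀ (pow_ne_zero _ hζ0), one_smul]
  have hS'S : S' * S = 1 := by
    simp only [S', Finset.sum_mul, smul_mul_assoc, hqS, smul_smul]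
    rw [← hq1]
    exact Finset.sum_congr rfl fun ε _ => by
      rw [inv_mul_cancel₀ (pow_ne_zero _ hζ0), one_smul]
  have hQS' : ∀ k, Commute (Q k) S' := by
    intro k
    refine Commute.sum_right _ _ _ fun ε _ => Commute.smul_right ?_ _
    refine Commute.sum_left _ _ _ fun ε' _ => ?_
    split_ifs
    · rw [commute_iff_eq, hqq, hqq]
      by_cases h1 : ε = ε'
      · rw [h1]
      · rw [if_neg h1, if_neg (Ne.symm h1)]
    · exact Commute.zero_left _
  -- The twist is nontrivial exactly because ζ is primitive and 0 < k < n. The values k = 0 and k =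
  -- n each leave a single constant pattern.
  have hvanish : ∀ k, k ≠ 0 → k < n →
      ∑ ξ ∈ Polynomial.nthRootsFinset n (1 : ℂ), ξ • ν (eigenIdem n T ξ * Q k) = 0 := by
    intro k hk hkn
    refine h.sum_smul_eq_zero hn hT (by rw [IsIdempotentElem, hQQ, if_pos rfl]) (hQT k) (hQS' k)
      hS'S hSS' (c := ζ ^ k) (by rw [← pow_mul, mul_comm, pow_mul, hζ.pow_eq_one, one_pow])
      (hζ.pow_ne_one_of_pos_of_lt hk hkn) ?_
    have h1 : ∀ ε, S * (T * q fun i => ε (finRotate n i)) =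
        ζ ^ oddCount ε • (T * (S * q fun i => ε (finRotate n i))) := by
      intro ε
      rw [hSq, mul_smul_comm, smul_smul, ← pow_oddWeight hζ.pow_eq_one, ← hqT, ← mul_assoc, hSq,
        smul_mul_assoc]
    have h2 : ∀ ε, S * (T * q ε) = ζ ^ oddCount ε • (T * (S * q ε)) := by
      intro ε
      have h3 : (fun i => ε ((finRotate n)⁻¹ (finRotate n i))) = ε :=
        funext fun i => congrArg ε ((finRotate n).symm_apply_apply i)
      have h4 := h1 fun i => ε ((finRotate n)⁻¹ i)
      rwa [h3, oddCount_comp] at h4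
    simp only [Q, Finset.mul_sum, Finset.smul_sum, mul_assoc]
    refine Finset.sum_congr rfl fun ε _ => ?_
    split_ifs with h3
    · rw [h2, h3]
    · simp
  have hQ0 : Q 0 = q fun _ => 0 := by
    simp only [Q, oddCount_eq_zero]
    rw [Finset.sum_ite_eq' Finset.univ, if_pos (Finset.mem_univ _)]
  have hQn : Q n = q fun _ => 1 := by
    simp only [Q, oddCount_eq]
    rw [Finset.sum_ite_eq' Finset.univ, if_pos (Finset.mem_univ _)]
  rw [Finset.sum_range_succ, Finset.sum_eq_single_of_mem 0 (Finset.mem_range.2 hn)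
    (fun k hk hk0 => hvanish k hk0 (Finset.mem_range.1 hk)), hQ0, hQn]

end parityDecomposition

/-! ### From the signed rotation to the graded Adams operation. -/

section parityParts

variable {A : Type w} {X : Type u} [TopologicalSpace X] [AddCommMonoid A] (par : A →+ ZMod 2)

/-- When all entries are odd each inversion contributes -1, so the Koszul sign is the ordinary sign.
-/
theorem koszulSign_one_eq_sign {n : ℕ} (σ : Equiv.Perm (Fin n)) :
    koszulSign σ (fun _ => 1) = Equiv.Perm.sign σ := by
  rw [Equiv.Perm.sign_eq_prod_prod_Ioi, koszulSign, Fintype.prod_prod_type]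
  push_cast
  refine Finset.prod_congr rfl fun i _ => ?_
  rw [← Finset.prod_subset (Finset.subset_univ (Finset.Ioi i))]
  · refine Finset.prod_congr rfl fun j hj => ?_
    have h1 := Finset.mem_Ioi.1 hj
    have h2 : σ i ≠ σ j := fun h => h1.ne (σ.injective h)
    rcases lt_or_gt_of_ne h2 with h3 | h3
    · simp [h1, h3, h3.not_gt]
    · simp [h1, h3, h3.not_gt, ZMod.val_one]
  · intro j _ hj
    rw [Finset.mem_Ioi] at hj
    simp [hj]

theorem koszulSign_zero {n : ℕ} (σ : Equiv.Perm (Fin n)) : koszulSign σ (fun _ => 0) = 1 := by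
  simp [koszulSign]

/-- If g intertwines T with c ρ, then the ξ-projector of T corresponds to the c⁻¹ ξ-projector of ρ.
-/
theorem eigenIdem_comp {M N : Type*} [AddCommGroup M] [Module ℂ M] [AddCommGroup N] [Module ℂ N]
    {T : Module.End ℂ M} {ρ : Module.End ℂ N} {g : N →ₗ[ℂ] M} {c : ℂ}
    (h : T ∘ₗ g = c • (g ∘ₗ ρ)) (n : ℕ) (ξ : ℂ) :
    eigenIdem n T ξ ∘ₗ g = g ∘ₗ eigenIdem n ρ (c⁻¹ * ξ) := by
  have hp : ∀ j : ℕ, ∀ v, (T ^ j) (g v) = c ^ j • g ((ρ ^ j) v) := by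
    intro j
    induction j with
    | zero => simp
    | succ j ih =>
      intro v
      have h1 := LinearMap.congr_fun h v
      simp only [LinearMap.comp_apply, LinearMap.smul_apply] at h1
      rw [pow_succ, Module.End.mul_apply, h1, map_smul, ih, smul_smul, ← pow_succ', pow_succ ρ,
        Module.End.mul_apply]
  ext v
  simp only [eigenIdem, LinearMap.comp_apply, LinearMap.smul_apply, LinearMap.sum_apply, hp,
    map_smul, map_sum, smul_smul, mul_inv, inv_inv, mul_pow]
  congr 1
  exact Finset.sum_congr rfl fun j _ => by rw [mul_comm]

/-- The tensor product of endomorphisms. -/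
noncomputable def tpowEnd {n : ℕ} {E : GBundle.{u, v, w} A X} (f : Fin n → EndB E) :
    EndB (tpow n E) :=
  ⟨fun x => PiTensorProduct.map fun i => (f i).1 x, IsHom.tpow fun i => (f i).2⟩

/-- The projector of `E^{⊗ n}` onto the part where the factors have the given parities. -/
noncomputable def parityEnd {n : ℕ} (E : GBundle.{u, v, w} A X) (ε : Fin n → ZMod 2) :
    EndB (tpow n E) :=
  tpowEnd fun i => ⟨parityProj par E (ε i), parityProj_isHom par E (ε i)⟩

theorem parityEnd_mul {n : ℕ} (E : GBundle.{u, v, w} A X) (ε ε' : Fin n → ZMod 2) :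
    parityEnd par E ε * parityEnd par E ε' = if ε = ε' then parityEnd par E ε else 0 := by
  refine Subtype.ext (funext fun x => ?_)
  have h1 : PiTensorProduct.map (fun i => parityProj par E (ε i) x) ∘ₗ
      PiTensorProduct.map (fun i => parityProj par E (ε' i) x) =
      if ε = ε' then PiTensorProduct.map (fun i => parityProj par E (ε i) x) else 0 := by
    refine PiTensorProduct.ext (MultilinearMap.ext fun v => ?_)
    simp only [LinearMap.compMultilinearMap_apply, LinearMap.comp_apply, PiTensorProduct.map_tprod,
      parityProj_parityProj]
    split_ifs with h
    · subst h
      simp [PiTensorProduct.map_tprod]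
    · obtain ⟨i, hi⟩ := Function.ne_iff.1 h
      rw [LinearMap.zero_apply]
      exact MultilinearMap.map_coord_zero _ i (if_neg hi)
  refine h1.trans ?_
  split_ifs <;> rfl

theorem sum_parityEnd {n : ℕ} (E : GBundle.{u, v, w} A X) :
    ∑ ε : Fin n → ZMod 2, parityEnd par E ε = 1 := by
  refine Subtype.ext (funext fun x => ?_)
  have h1 : ∑ ε : Fin n → ZMod 2, PiTensorProduct.map (fun i => parityProj par E (ε i) x) =
      LinearMap.id := by
    refine PiTensorProduct.ext (MultilinearMap.ext fun v => ?_)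
    simp only [LinearMap.compMultilinearMap_apply, LinearMap.sum_apply, PiTensorProduct.map_tprod]
    rw [← MultilinearMap.map_sum (PiTensorProduct.tprod ℂ)
      (fun i (ε : ZMod 2) => parityProj par E ε x (v i))]
    exact congrArg _ (funext fun i => sum_parityProj par E _ _)
  refine Eq.trans ?_ h1
  rw [AddSubmonoidClass.coe_finsetSum, Finset.sum_apply]
  rfl

/-- Rotating the factors rotates the parity pattern. Together with `koszulRot_eq` this puts the
signed rotation into the form needed for the cancellation of mixed patterns. -/
theorem parityEnd_rot {n : ℕ} (E : GBundle.{u, v, w} A X) (ε : Fin n → ZMod 2) :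
    parityEnd par E ε * permAlg n E (rot n) =
      permAlg n E (rot n) * parityEnd par E fun i => ε (finRotate n i) := by
  refine Subtype.ext (funext fun x => ?_)
  have h1 : PiTensorProduct.map (fun i => parityProj par E (ε i) x) ∘ₗ
      permLin (E.fiber x) n (rot n) = permLin (E.fiber x) n (rot n) ∘ₗ
      PiTensorProduct.map (fun i => parityProj par E (ε (finRotate n i)) x) := by
    rw [rot, permLin_of]
    refine PiTensorProduct.ext (MultilinearMap.ext fun v => ?_)
    simp only [LinearMap.compMultilinearMap_apply, LinearMap.comp_apply, PiTensorProduct.map_tprod,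
      permMap_tprod]
    exact congrArg _ (funext fun i => congrArg
      (fun j => parityProj par E (ε j) x (v ((finRotate n)⁻¹ i)))
      ((finRotate n).apply_symm_apply i).symm)
  exact h1

theorem koszulRot_eq {n : ℕ} (E : GBundle.{u, v, w} A X) :
    koszulRot par n E = ∑ ε : Fin n → ZMod 2, (koszulSign (finRotate n) ε : ℂ) •
      (permAlg n E (rot n) * parityEnd par E ε) := by
  refine Subtype.ext (funext fun x => ?_)
  rw [AddSubmonoidClass.coe_finsetSum, Finset.sum_apply]
  refine Finset.sum_congr rfl fun ε _ => ?_
  have h1 : PiTensorProduct.map (fun _ : Fin n => (LinearMap.id : E.fiber x →ₗ[ℂ] E.fiber x)) ∘ₗ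
      permMap (finRotate n) = permLin (E.fiber x) n (rot n) := by
    rw [rot, permLin_of, PiTensorProduct.map_id, LinearMap.id_comp]
  have h2 := congrArg (fun f => (koszulSign (finRotate n) ε : ℂ) • (f ∘ₗ
    PiTensorProduct.map fun i => parityProj par E (ε i) x)) h1
  exact h2

/-- On a constant pattern the Koszul sign is a constant c, so the signed rotation is c times the
unsigned rotation of the tensor power of one parity part, and its eigenvalues are multiplied by c.
-/
theorem idemClass_eigenIdem_parityEnd {n : ℕ} (hn : 0 < n) (E : GBundle.{u, v, w} A X) (δ : ZMod 2)
    {c : ℂ} (hc : c = koszulSign (finRotate n) (fun _ => δ)) (hcn : c ^ n = 1) {ξ : ℂ}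
    (hξ : ξ ^ n = 1) :
    idemClass (tpow n E) (eigenIdem n (koszulRot par n E) ξ * parityEnd par E fun _ => δ) =
      idemClass (tpow n (parityPart par E δ))
        (permAlg n (parityPart par E δ) (eigenIdem n (rot n) (c⁻¹ * ξ))) := by
  set F := parityPart par E δ with hF
  have hsub := parityPart_isSubbundle par E δ
  let pr : ∀ x, E.fiber x →ₗ[ℂ] LinearMap.range (parityProj par E δ x) := fun x =>
    (parityProj par E δ x).codRestrict _ fun v => ⟨v, rfl⟩
  let incl : ∀ x, LinearMap.range (parityProj par E δ x) →ₗ[ℂ] E.fiber x := fun x =>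
    (LinearMap.range (parityProj par E δ x)).subtype
  have hpr : IsHom E F pr := (parityProj_isHom par E δ).codRestrict hsub fun x v => ⟨v, rfl⟩
  have hincl : IsHom F E incl := subbundle_subtype_isHom _ _ hsub
  have hf : IsHom (tpow n E) (tpow n F) fun x => PiTensorProduct.map fun _ => pr x :=
    IsHom.tpow fun _ => hpr
  have hg : IsHom (tpow n F) (tpow n E) fun x => PiTensorProduct.map fun _ => incl x :=
    IsHom.tpow fun _ => hincl
  have hgf : ∀ x, (PiTensorProduct.map fun _ : Fin n => incl x) ∘ₗ
      (PiTensorProduct.map fun _ => pr x) = (parityEnd par E fun _ => δ).1 x := fun x =>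
    (PiTensorProduct.map_comp _ _).symm
  have hfg : ∀ x, (PiTensorProduct.map fun _ : Fin n => pr x) ∘ₗ
      (PiTensorProduct.map fun _ => incl x) = LinearMap.id := by
    intro x
    rw [← PiTensorProduct.map_comp, ← PiTensorProduct.map_id]
    refine congrArg _ (funext fun i => LinearMap.ext fun v => ?_)
    obtain ⟨_, v, rfl⟩ := v
    refine Subtype.ext ?_
    exact (parityProj_parityProj par E δ δ x v).trans (if_pos rfl)
  -- Only pure tensors need checking; all their factors have parity δ, so `boxAct_tprod` gives the
  -- single sign c.
  have hTg : ∀ x, (koszulRot par n E).1 x ∘ₗ (PiTensorProduct.map fun _ : Fin n => incl x) =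
      c • ((PiTensorProduct.map fun _ : Fin n => incl x) ∘ₗ
        permLin (LinearMap.range (parityProj par E δ x)) n (rot n)) := by
    intro x
    rw [rot, permLin_of]
    refine PiTensorProduct.ext (MultilinearMap.ext fun v => ?_)
    refine (congrArg ((koszulRot par n E).1 x) (PiTensorProduct.map_tprod _ v)).trans ?_
    refine (boxAct_tprod par E (fun (_ : Fin n) x => x) (finRotate n) (y := x) (z := x)
      (fun _ => rfl) (fun _ => δ) _ fun i => ?_).trans ?_
    · obtain ⟨_, v, hv⟩ := v i
      subst hv
      exact (parityProj_parityProj par E δ δ x v).trans (if_pos rfl)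
    · refine Eq.trans ?_ (congrArg (fun w => c • PiTensorProduct.map (fun _ => incl x) w)
        (permMap_tprod (finRotate n) v).symm)
      rw [PiTensorProduct.map_tprod, hc]
      rfl
  have hTg' := fun x => eigenIdem_comp (hTg x) n ξ
  have hc0 : c ≠ 0 := by
    rintro rfl
    rw [zero_pow hn.ne'] at hcn
    exact zero_ne_one hcn
  have hξ' : (c⁻¹ * ξ) ^ n = 1 := by rw [mul_pow, inv_pow, hcn, hξ, inv_one, one_mul]
  have hcomm : Commute (parityEnd par E fun _ : Fin n => δ) (koszulRot par n E) := by
    have h1 : ∀ ε : Fin n → ZMod 2, parityEnd par E (fun _ : Fin n => δ) *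
        (permAlg n E (rot n) * parityEnd par E ε) =
        permAlg n E (rot n) * parityEnd par E ε * parityEnd par E (fun _ : Fin n => δ) := by
      intro ε
      rw [← mul_assoc, parityEnd_rot, mul_assoc, mul_assoc, parityEnd_mul, parityEnd_mul]
      by_cases h : (fun _ => δ) = ε
      · rw [if_pos h, if_pos h.symm, h]
      · rw [if_neg h, if_neg (Ne.symm h)]
    rw [koszulRot_eq]
    exact Commute.sum_right _ _ _ fun ε _ => Commute.smul_right (h1 ε) _
  have hid1 : IsIdempotentElem (eigenIdem n (koszulRot par n E) ξ * parityEnd par E fun _ => δ) :=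
    IsIdempotentElem.mul_of_commute (commute_eigenIdem hcomm n ξ).symm
      (isIdempotentElem_eigenIdem hn (koszulRot_pow par hn E) hξ)
      (by rw [IsIdempotentElem, parityEnd_mul, if_pos rfl])
  have hid2 : IsIdempotentElem (permAlg n F (eigenIdem n (rot n) (c⁻¹ * ξ))) :=
    (isIdempotentElem_eigenIdem hn (rot_pow n) hξ').map (permAlg n F)
  -- One map projects each factor to the parity part and then applies the spectral projector of the
  -- unsigned rotation; the other is the inclusion. Their composites are the two idempotents.
  refine idemClass_comm hid1 hid2
    ((permLin_isHom F (eigenIdem n (rot n) (c⁻¹ * ξ))).comp hf) hg (fun x v => ?_) fun x v => ?_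
  · have h1 := LinearMap.congr_fun (hTg' x) (PiTensorProduct.map (fun _ => pr x) v)
    rw [← map_eigenIdem] at h1
    refine (Eq.symm h1).trans ?_
    have h2 := LinearMap.congr_fun (EndB.eigenIdem_apply (koszulRot par n E) n ξ x)
      ((parityEnd par E fun _ => δ).1 x v)
    refine Eq.trans ?_ h2.symm
    exact congrArg (fun w : (tpow n E).fiber x => eigenIdem n ((koszulRot par n E).1 x) ξ w)
      (LinearMap.congr_fun (hgf x) v)
  · exact congrArg (permLin (LinearMap.range (parityProj par E δ x)) n
      (eigenIdem n (rot n) (c⁻¹ * ξ))) (LinearMap.congr_fun (hfg x) v)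

theorem koszulRotClass_eq {n : ℕ} (hn : 0 < n) (E : GBundle.{u, v, w} A X) :
    koszulRotClass par n E = cclass (gradedAdams par n E) := by
  have hν : IsIdemInvariant fun a : EndB (tpow n E) => cclass (idemClass (tpow n E) a) :=
    (idemClass_isIdemInvariant (tpow n E)).map cclass
  have hpart : ∀ (δ : ZMod 2) (c : ℂ), c = koszulSign (finRotate n) (fun _ => δ) → c ^ n = 1 →
      ∑ ξ ∈ Polynomial.nthRootsFinset n (1 : ℂ), ξ • cclass (idemClass (tpow n E)
        (eigenIdem n (koszulRot par n E) ξ * parityEnd par E fun _ => δ)) =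
      c • cclass (adams (parityPart par E δ) n) := by
    intro δ c hc hcn
    have hc0 : c ≠ 0 := by
      rintro rfl
      rw [zero_pow hn.ne'] at hcn
      exact zero_ne_one hcn
    rw [← rotClass_eq_adams _ n hn, rotClass, Finset.smul_sum, ← sum_nthRoots_mul hn hcn]
    refine Finset.sum_congr rfl fun ξ hξ => ?_
    rw [Polynomial.mem_nthRootsFinset hn] at hξ
    rw [idemClass_eigenIdem_parityEnd par hn E δ hc hcn (by rw [mul_pow, hcn, hξ, one_mul]),
      inv_mul_cancel_left₀ hc0, mul_smul]
  -- After cancellation only the two constant patterns remain. The even one has c = 1, the odd one c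
  -- = (-1)^(n-1), the sign of an n-cycle.
  rw [koszulRotClass, hν.sum_smul_signedRotation hn (koszulRot_pow par hn E) (parityEnd_mul par E)
    (sum_parityEnd par E) (parityEnd_rot par E) (koszulRot_eq par E),
    hpart 0 1 (by rw [koszulSign_zero, Int.cast_one]) (one_pow n),
    hpart 1 ((-1) ^ (n - 1)) (by rw [koszulSign_one_eq_sign, sign_finRotate]; simp) ?_, one_smul,
    gradedAdams, map_add, map_zsmul, ← Int.cast_smul_eq_zsmul ℂ]
  · simp
  -- c is an n-th root of unity because n(n - 1) is even.
  · rw [← pow_mul, mul_comm]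
    exact (Nat.even_mul_pred_self n).neg_one_pow

end parityParts

/-! ### Tensor product isomorphisms and multiplication operators on GK. -/

section tensorIsos

variable {A : Type w} {X : Type u} [TopologicalSpace X] [AddCommMonoid A]
  {E E' F F' G : GBundle.{u, v, w} A X}

theorem GK.hom_ext {B : Type*} [AddCommGroup B] {f g : GK.{u, v, w} A X →+ B}
    (h : ∀ E, f (GK.of E) = g (GK.of E)) : f = g := by
  apply Algebra.GrothendieckAddGroup.lift.symm.injective
  ext e
  obtain ⟨E⟩ := e
  exact h E

theorem altMap_map {V W : Type*} [AddCommGroup V] [Module ℂ V] [AddCommGroup W] [Module ℂ W]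
    (f : V →ₗ[ℂ] W) (k : ℕ) (a : ⨂[ℂ] _ : Fin k, V) :
    altMap W k (PiTensorProduct.map (fun _ => f) a) = exteriorPower.map k f (altMap V k a) := by
  have : altMap W k ∘ₗ PiTensorProduct.map (fun _ => f) = exteriorPower.map k f ∘ₗ altMap V k := by
    refine PiTensorProduct.ext (MultilinearMap.ext fun v => ?_)
    simp only [LinearMap.compMultilinearMap_apply, LinearMap.comp_apply, PiTensorProduct.map_tprod,
      altMap_tprod, exteriorPower.map_apply_ιMulti]
    rfl
  exact LinearMap.congr_fun this a

/-- The exterior power is a natural retract of the tensor power, where the statement is already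
known. -/
theorem IsHom.exteriorPow {f : ∀ x, E.fiber x →ₗ[ℂ] F.fiber x} (hf : IsHom E F f) (k : ℕ) :
    IsHom (exteriorPow E k) (exteriorPow F k) fun x => exteriorPower.map k (f x) := by
  refine ((altMap_isHom F k).comp ((IsHom.tpow fun _ => hf).comp
    (toTensorPower_smul_isHom E k))).congr fun x v => Eq.symm ?_
  refine (altMap_map (f x) k _).trans ?_
  exact congrArg (exteriorPower.map k (f x)) (altMap_toTensorPower_smul v)

theorem Iso.of_inverse {f : ∀ x, E.fiber x →ₗ[ℂ] F.fiber x} {g : ∀ x, F.fiber x →ₗ[ℂ] E.fiber x}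
    (hf : IsHom E F f) (hg : IsHom F E g) (hgf : ∀ x v, g x (f x v) = v)
    (hfg : ∀ x v, f x (g x v) = v) : Iso E F :=
  ⟨fun x => LinearEquiv.ofLinearMap (f x) (g x) (LinearMap.ext (hfg x)) (LinearMap.ext (hgf x)),
    hf, hg⟩

theorem Iso.exteriorPow (h : Iso E F) (k : ℕ) : Iso (exteriorPow E k) (exteriorPow F k) := by
  obtain ⟨f, hf, hf'⟩ := h
  have key : ∀ {V W : Type v} [AddCommGroup V] [Module ℂ V] [AddCommGroup W] [Module ℂ W]
      (f : V ≃ₗ[ℂ] W) (a : ⋀[ℂ]^k V),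
      exteriorPower.map k f.symm.toLinearMap (exteriorPower.map k f.toLinearMap a) = a := by
    intro V W _ _ _ _ f a
    rw [← LinearMap.comp_apply, ← exteriorPower.map_comp]
    simp
  exact Iso.of_inverse (hf.exteriorPow k) (hf'.exteriorPow k) (fun x v => key (f x) v)
    fun x v => key (f x).symm v

theorem Iso.tensor_congr_right (h : Iso E E') (F : GBundle.{u, v, w} A X) :
    Iso (tensor E F) (tensor E' F) := by
  obtain ⟨f, h, h'⟩ := h
  refine ⟨fun x => TensorProduct.congr (f x) (LinearEquiv.refl ℂ _),
    (h.tensor (IsHom.id F)).congr fun x v => rfl, (h'.tensor (IsHom.id F)).congr fun x v => rfl⟩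

theorem GK.tensorLeft_congr (h : Iso E E') : GK.tensorLeft E = GK.tensorLeft E' :=
  GK.hom_ext fun G => by
    rw [GK.tensorLeft_of, GK.tensorLeft_of, GK.of_eq (h.tensor_congr_right G)]

theorem Iso.tensor_leftComm (E F G : GBundle.{u, v, w} A X) :
    Iso (tensor E (tensor F G)) (tensor F (tensor E G)) :=
  ⟨fun x => TensorProduct.leftComm ℂ (E.fiber x) (F.fiber x) (G.fiber x),
    IsHom.of_frame (fun _ i => (i.2.1, (i.1, i.2.2))) (fun _ _ _ _ _ => rfl)
      fun _ _ => add_left_comm _ _ _,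
    IsHom.of_frame (fun _ i => (i.2.1, (i.1, i.2.2))) (fun _ _ _ _ _ => rfl)
      fun _ _ => add_left_comm _ _ _⟩

/-- No ring structure on `GK` is introduced; products are handled as compositions of multiplication
operators, and this commutativity is what later allows polynomials in them. -/
theorem GK.tensorLeft_comm (E F : GBundle.{u, v, w} A X) (a : GK.{u, v, w} A X) :
    GK.tensorLeft E (GK.tensorLeft F a) = GK.tensorLeft F (GK.tensorLeft E a) :=
  DFunLike.congr_fun (GK.hom_ext (f := (GK.tensorLeft E).comp (GK.tensorLeft F))
    (g := (GK.tensorLeft F).comp (GK.tensorLeft E)) fun G => by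
      simp only [AddMonoidHom.comp_apply, GK.tensorLeft_of]
      exact GK.of_eq (Iso.tensor_leftComm E F G)) a

theorem Iso.tensor_assoc (E F G : GBundle.{u, v, w} A X) :
    Iso (tensor (tensor E F) G) (tensor E (tensor F G)) :=
  ⟨fun x => TensorProduct.assoc ℂ (E.fiber x) (F.fiber x) (G.fiber x),
    IsHom.of_frame (fun _ i => (i.1.1, (i.1.2, i.2))) (fun _ _ _ _ _ => rfl)
      fun _ _ => add_assoc _ _ _,
    IsHom.of_frame (fun _ i => ((i.1, i.2.1), i.2.2)) (fun _ _ _ _ _ => rfl)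
      fun _ _ => (add_assoc _ _ _).symm⟩

theorem GK.tensorLeft_tensor (E F : GBundle.{u, v, w} A X) (a : GK.{u, v, w} A X) :
    GK.tensorLeft (tensor E F) a = GK.tensorLeft E (GK.tensorLeft F a) :=
  DFunLike.congr_fun (GK.hom_ext (f := GK.tensorLeft (tensor E F))
    (g := (GK.tensorLeft E).comp (GK.tensorLeft F)) fun G => by
      simp only [AddMonoidHom.comp_apply, GK.tensorLeft_of]
      exact GK.of_eq (Iso.tensor_assoc E F G)) a

theorem Iso.directSum_tensor (E F G : GBundle.{u, v, w} A X) :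
    Iso (tensor (directSum E F) G) (directSum (tensor E G) (tensor F G)) := by
  refine Iso.of_inverse (((IsHom.fst (E := E) (F := F)).tensor (IsHom.id G)).prod
      ((IsHom.snd (E := E) (F := F)).tensor (IsHom.id G)))
    ((((IsHom.inl (E := E) (F := F)).tensor (IsHom.id G)).comp IsHom.fst).add
      (((IsHom.inr (E := E) (F := F)).tensor (IsHom.id G)).comp IsHom.snd)) ?_ ?_
  · intro x (v : (E.fiber x × F.fiber x) ⊗[ℂ] G.fiber x)
    change TensorProduct.map (LinearMap.inl ℂ _ _) LinearMap.id
        (TensorProduct.map (LinearMap.fst ℂ _ _) LinearMap.id v) +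
      TensorProduct.map (LinearMap.inr ℂ _ _) LinearMap.id
        (TensorProduct.map (LinearMap.snd ℂ _ _) LinearMap.id v) = v
    rw [← LinearMap.comp_apply, ← LinearMap.comp_apply, ← TensorProduct.map_comp,
      ← TensorProduct.map_comp, ← LinearMap.add_apply, LinearMap.comp_id,
      ← TensorProduct.map_add_left, show LinearMap.inl ℂ (E.fiber x) (F.fiber x) ∘ₗ LinearMap.fst ℂ _ _ +
      LinearMap.inr ℂ _ _ ∘ₗ LinearMap.snd ℂ _ _ = LinearMap.id from LinearMap.ext fun v => by simp]
    simp
  · rintro x ⟨(v₁ : E.fiber x ⊗[ℂ] G.fiber x), (v₂ : F.fiber x ⊗[ℂ] G.fiber x)⟩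
    have h1 : ∀ {V₁ V₂ W : Type v} [AddCommGroup V₁] [Module ℂ V₁] [AddCommGroup V₂] [Module ℂ V₂]
        [AddCommGroup W] [Module ℂ W] (f : W →ₗ[ℂ] V₁) (g : V₂ →ₗ[ℂ] W)
        (v : V₂ ⊗[ℂ] G.fiber x), TensorProduct.map f LinearMap.id
          (TensorProduct.map g LinearMap.id v) = TensorProduct.map (f ∘ₗ g) LinearMap.id v := by
      intro V₁ V₂ W _ _ _ _ _ _ f g v
      rw [← LinearMap.comp_apply, ← TensorProduct.map_comp, LinearMap.comp_id]
    refine Prod.ext ?_ ?_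
    · change TensorProduct.map (LinearMap.fst ℂ _ _) LinearMap.id
        (TensorProduct.map (LinearMap.inl ℂ _ _) LinearMap.id v₁ +
          TensorProduct.map (LinearMap.inr ℂ _ _) LinearMap.id v₂) = v₁
      rw [map_add, h1, h1]
      simp
    · change TensorProduct.map (LinearMap.snd ℂ _ _) LinearMap.id
        (TensorProduct.map (LinearMap.inl ℂ _ _) LinearMap.id v₁ +
          TensorProduct.map (LinearMap.inr ℂ _ _) LinearMap.id v₂) = v₂
      rw [map_add, h1, h1]
      simp

theorem GK.tensorLeft_directSum (E F : GBundle.{u, v, w} A X) :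
    GK.tensorLeft (directSum E F) = GK.tensorLeft E + GK.tensorLeft F :=
  GK.hom_ext fun G => by
    rw [AddMonoidHom.add_apply, GK.tensorLeft_of, GK.tensorLeft_of, GK.tensorLeft_of,
      ← GK.of_directSum]
    exact GK.of_eq (Iso.directSum_tensor E F G)

theorem Iso.of_subsingleton (hE : ∀ x, Subsingleton (E.fiber x)) (hF : ∀ x, Subsingleton (F.fiber x)) :
    Iso E F :=
  Iso.of_inverse IsHom.zero IsHom.zero (fun x _ => (hE x).elim _ _) fun x _ => (hF x).elim _ _

theorem GK.tensorLeft_of_subsingleton (hE : ∀ x, Subsingleton (E.fiber x)) :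
    GK.tensorLeft E = 0 :=
  GK.hom_ext fun G => by
    rw [GK.tensorLeft_of, AddMonoidHom.zero_apply, ← GK.of_zero]
    have h : ∀ x, Subsingleton (E.fiber x ⊗[ℂ] G.fiber x) := fun x => by
      have := hE x
      infer_instance
    exact GK.of_eq (Iso.of_subsingleton h fun x => inferInstanceAs (Subsingleton PUnit))

theorem Iso.tpow_zero (E F : GBundle.{u, v, w} A X) : Iso (tpow 0 E) (tpow 0 F) := by
  have h : ∀ {V W : Type v} [AddCommGroup V] [Module ℂ V] [AddCommGroup W] [Module ℂ W]
      (v : Fin 0 → V) (w : Fin 0 → W),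
      (PiTensorProduct.isEmptyEquiv (R := ℂ) (s := fun _ : Fin 0 => V) (Fin 0) ≪≫ₗ
        (PiTensorProduct.isEmptyEquiv (R := ℂ) (s := fun _ : Fin 0 => W) (Fin 0)).symm)
        (PiTensorProduct.tprod ℂ v) = PiTensorProduct.tprod ℂ w := by
    intro V W _ _ _ _ v w
    rw [LinearEquiv.trans_apply, LinearEquiv.symm_apply_eq]
    simp
  refine ⟨fun x => PiTensorProduct.isEmptyEquiv (R := ℂ) (s := fun _ : Fin 0 => E.fiber x) (Fin 0) ≪≫ₗ
    (PiTensorProduct.isEmptyEquiv (R := ℂ) (s := fun _ : Fin 0 => F.fiber x) (Fin 0)).symm,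
    IsHom.of_frame (fun _ _ i => i.elim0) (fun p i x _ _ => h _ _) fun _ _ => rfl,
    IsHom.of_frame (fun _ _ i => i.elim0) (fun p i x _ _ => h _ _) fun _ _ => rfl⟩

theorem isEmptyEquiv_tprod {V : Type*} [AddCommGroup V] [Module ℂ V] (v : Fin 0 → V) :
    PiTensorProduct.isEmptyEquiv (R := ℂ) (s := fun _ : Fin 0 => V) (Fin 0)
      (PiTensorProduct.tprod ℂ v) = 1 := by
  simp

theorem Iso.tpow_zero_tensor (E G : GBundle.{u, v, w} A X) : Iso (tensor (tpow 0 E) G) G := by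
  refine ⟨fun x => TensorProduct.congr
    (PiTensorProduct.isEmptyEquiv (R := ℂ) (s := fun _ : Fin 0 => E.fiber x) (Fin 0))
    (LinearEquiv.refl ℂ (G.fiber x)) ≪≫ₗ TensorProduct.lid ℂ (G.fiber x),
    IsHom.of_frame (fun _ i => i.2) (fun p i x _ _ => ?_) fun _ _ => zero_add _,
    IsHom.of_frame (fun _ i => (fun j => j.elim0, i)) (fun p i x _ _ => ?_) fun _ _ => (zero_add _).symm⟩
  · change (PiTensorProduct.isEmptyEquiv (R := ℂ) (s := fun _ : Fin 0 => E.fiber x) (Fin 0)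
      (PiTensorProduct.tprod ℂ _)) • G.frame p i.2 x = _
    rw [isEmptyEquiv_tprod, one_smul]
  · have h1 : (TensorProduct.congr
      (PiTensorProduct.isEmptyEquiv (R := ℂ) (s := fun _ : Fin 0 => E.fiber x) (Fin 0))
      (LinearEquiv.refl ℂ (G.fiber x)) ≪≫ₗ TensorProduct.lid ℂ (G.fiber x)).symm (G.frame p i x) =
        (PiTensorProduct.tprod ℂ fun j : Fin 0 => j.elim0) ⊗ₜ G.frame p i x := by
      rw [LinearEquiv.symm_apply_eq, LinearEquiv.trans_apply, TensorProduct.congr_tmul,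
        isEmptyEquiv_tprod]
      simp
    refine h1.trans ?_
    exact congrArg (fun v => PiTensorProduct.tprod ℂ v ⊗ₜ[ℂ] G.frame p i x)
      (Subsingleton.elim _ _)

theorem Iso.tensor_comm (E F : GBundle.{u, v, w} A X) : Iso (tensor E F) (tensor F E) :=
  ⟨fun x => TensorProduct.comm ℂ (E.fiber x) (F.fiber x),
    IsHom.of_frame (fun _ i => (i.2, i.1)) (fun _ _ _ _ _ => rfl) fun _ _ => add_comm _ _,
    IsHom.of_frame (fun _ i => (i.2, i.1)) (fun _ _ _ _ _ => rfl) fun _ _ => add_comm _ _⟩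

/-- The antisymmetrizer of the trivial group is 1, so the retraction of the tensor power onto the
exterior power is an isomorphism. -/
theorem Iso.exteriorPow_zero (E : GBundle.{u, v, w} A X) :
    Iso (GradedK.exteriorPow E 0) (tpow 0 E) := by
  refine Iso.of_inverse (toTensorPower_smul_isHom E 0) (altMap_isHom E 0)
    (fun x v => altMap_toTensorPower_smul v) fun x v => ?_
  refine (toTensorPower_smul_altMap v).trans ?_
  have h : antisym 0 = 1 := by
    rw [antisym, Fintype.sum_unique]
    have h3 : (default : Equiv.Perm (Fin 0)) = 1 := Subsingleton.elim _ _
    rw [h3]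
    simp [MonoidAlgebra.one_def]
  rw [h, map_one]
  rfl

/-- The class of the trivial line bundle of degree `0`. -/
noncomputable def GK.unit : GK.{u, v, w} A X := GK.of (tpow 0 (zeroBundle A X))

theorem GK.tensorLeft_exteriorPow_zero (E : GBundle.{u, v, w} A X) (a : GK.{u, v, w} A X) :
    GK.tensorLeft (exteriorPow E 0) a = a := by
  refine DFunLike.congr_fun (GK.hom_ext (f := GK.tensorLeft (exteriorPow E 0))
    (g := AddMonoidHom.id _) fun G => ?_) a
  rw [GK.tensorLeft_of, AddMonoidHom.id_apply]
  exact GK.of_eq (((Iso.exteriorPow_zero E).tensor_congr_right G).trans (Iso.tpow_zero_tensor E G))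

/-- Recovers a class from its multiplication operator, so that identities between operators yield
identities in `GK`. -/
theorem GK.tensorLeft_unit (E : GBundle.{u, v, w} A X) : GK.tensorLeft E GK.unit = GK.of E := by
  rw [GK.unit, GK.tensorLeft_of]
  exact GK.of_eq ((Iso.tensor_comm _ _).trans (Iso.tpow_zero_tensor _ E))

theorem tpow_one_isHom (E : GBundle.{u, v, w} A X) : IsHom (tpow 1 E) E fun x =>
    (PiTensorProduct.subsingletonEquiv (R := ℂ) (s := fun _ : Fin 1 => E.fiber x) 0).toLinearMap := by
  refine IsHom.of_frame (fun _ i => i 0) (fun p i x _ _ => ?_) fun p i => ?_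
  · exact PiTensorProduct.subsingletonEquiv_apply_tprod (R := ℂ) (s := fun _ : Fin 1 => E.fiber x)
      0 _
  · exact Fin.sum_univ_one fun j => E.deg p (i j)

theorem tpow_one_symm_isHom (E : GBundle.{u, v, w} A X) : IsHom E (tpow 1 E) fun x =>
    (PiTensorProduct.subsingletonEquiv (R := ℂ)
      (s := fun _ : Fin 1 => E.fiber x) 0).symm.toLinearMap := by
  have h : ∀ {V : Type v} [AddCommGroup V] [Module ℂ V] (v : V),
      (PiTensorProduct.subsingletonEquiv (R := ℂ) (s := fun _ : Fin 1 => V) 0).symm v =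
        PiTensorProduct.tprod ℂ fun _ => v := by
    intro V _ _ v
    rw [LinearEquiv.symm_apply_eq]
    simp
  exact IsHom.of_frame (fun _ i _ => i) (fun p i x _ _ => h _)
    fun p i => (Fin.sum_univ_one fun _ => E.deg p i).symm

theorem Iso.tpow_one (E : GBundle.{u, v, w} A X) : Iso (tpow 1 E) E :=
  ⟨fun x => PiTensorProduct.subsingletonEquiv (R := ℂ) (s := fun _ : Fin 1 => E.fiber x) 0,
    tpow_one_isHom E, tpow_one_symm_isHom E⟩

theorem Iso.tensor_tpow_succ (n : ℕ) (E : GBundle.{u, v, w} A X) :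
    Iso (tensor E (tpow n E)) (tpow (n + 1) E) :=
  ((Iso.tpow_one E).symm.tensor_congr_right _).trans
    (Iso.tensor_tpow (finSumFinEquiv.trans (finCongr (add_comm 1 n))) E)

end tensorIsos

/-! ### Exterior powers of the sum of a vector space and a line. -/

section wedge

variable {V L : Type*} [AddCommGroup V] [Module ℂ V] [AddCommGroup L] [Module ℂ L]

/-- The splitting of the indices into the first one and the others. -/
def headTail (k : ℕ) : Fin 1 ⊕ Fin k ≃ Fin (k + 1) := finSumFinEquiv.trans (finCongr (add_comm 1 k))

theorem headTail_inl {k : ℕ} (i : Fin 1) : headTail k (Sum.inl i) = 0 := by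
  ext; simp [headTail]

theorem headTail_inr {k : ℕ} (i : Fin k) : headTail k (Sum.inr i) = i.succ := by
  ext; simp [headTail]

/-- The map `l ⊗ v_1 ∧ ⋯ ∧ v_k ↦ l ∧ v_1 ∧ ⋯ ∧ v_k`. -/
noncomputable def wedgeMap (V L : Type*) [AddCommGroup V] [Module ℂ V] [AddCommGroup L]
    [Module ℂ L] (k : ℕ) : L ⊗[ℂ] (⋀[ℂ]^k V) →ₗ[ℂ] ⋀[ℂ]^(k + 1) (V × L) :=
  altMap (V × L) (k + 1) ∘ₗ (concat (V × L) (headTail k)).toLinearMap ∘ₗ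
    TensorProduct.map
      ((PiTensorProduct.subsingletonEquiv (R := ℂ) (s := fun _ : Fin 1 => V × L) 0).symm.toLinearMap ∘ₗ
        LinearMap.inr ℂ V L)
      (PiTensorProduct.map (fun _ => LinearMap.inl ℂ V L) ∘ₗ
        ((k.factorial : ℂ)⁻¹ • exteriorPower.toTensorPower ℂ V k))

/-- The contraction `⋀^{k+1} (V × L) → L ⊗ ⋀^k V` that is inverse to `wedgeMap` on its image. -/
noncomputable def unwedgeMap (V L : Type*) [AddCommGroup V] [Module ℂ V] [AddCommGroup L]
    [Module ℂ L] (k : ℕ) : ⋀[ℂ]^(k + 1) (V × L) →ₗ[ℂ] L ⊗[ℂ] (⋀[ℂ]^k V) :=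
  (k.factorial : ℂ)⁻¹ • (TensorProduct.map
      (LinearMap.snd ℂ V L ∘ₗ
        (PiTensorProduct.subsingletonEquiv (R := ℂ) (s := fun _ : Fin 1 => V × L) 0).toLinearMap)
      (altMap V k ∘ₗ PiTensorProduct.map (fun _ => LinearMap.fst ℂ V L)) ∘ₗ
    (concat (V × L) (headTail k)).symm.toLinearMap ∘ₗ
    exteriorPower.toTensorPower ℂ (V × L) (k + 1))

theorem altMap_surjective (k : ℕ) : Function.Surjective (altMap V k) := fun a =>
  ⟨_, altMap_toTensorPower_smul a⟩

theorem exteriorPower_ιMulti_perm {k : ℕ} (v : Fin k → V) (σ : Equiv.Perm (Fin k)) :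
    (Equiv.Perm.sign σ : ℤ) • exteriorPower.ιMulti ℂ k (fun i => v (σ i)) =
      exteriorPower.ιMulti ℂ k v := by
  have := (exteriorPower.ιMulti ℂ k (M := V)).map_perm v σ
  rw [show (fun i => v (σ i)) = v ∘ σ from rfl, this, Units.smul_def, smul_smul,
    ← Units.val_mul, Int.units_mul_self, Units.val_one, one_smul]

/-- The definition passes through tensor powers so that continuity in families comes for free. The
k! terms of the antisymmetrized tensor all give the same wedge, which the factor 1/k! compensates.
-/
theorem wedgeMap_ιMulti (k : ℕ) (l : L) (v : Fin k → V) :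
    wedgeMap V L k (l ⊗ₜ exteriorPower.ιMulti ℂ k v) =
      exteriorPower.ιMulti ℂ (k + 1) (Fin.cons (0, l) fun i => (v i, 0)) := by
  have h1 : ∀ w : Fin k → V, (altMap (V × L) (k + 1) ∘ₗ (concat (V × L) (headTail k)).toLinearMap)
      ((PiTensorProduct.subsingletonEquiv (R := ℂ) (s := fun _ : Fin 1 => V × L) 0).symm (0, l) ⊗ₜ
        PiTensorProduct.map (fun _ => LinearMap.inl ℂ V L) (PiTensorProduct.tprod ℂ w)) =
      exteriorPower.ιMulti ℂ (k + 1) (Fin.cons (0, l) fun i => (w i, 0)) := by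
    intro w
    have h2 : (PiTensorProduct.subsingletonEquiv (R := ℂ) (s := fun _ : Fin 1 => V × L) 0).symm
        (0, l) = PiTensorProduct.tprod ℂ fun _ => ((0, l) : V × L) := by
      rw [LinearEquiv.symm_apply_eq]; simp
    rw [PiTensorProduct.map_tprod, h2, LinearMap.comp_apply, LinearEquiv.coe_coe, concat_tprod,
      altMap_tprod]
    congr 1
    funext i
    obtain ⟨j | j, rfl⟩ := (headTail k).surjective i
    · rw [Equiv.symm_apply_apply, headTail_inl, Fin.cons_zero]; rfl
    · rw [Equiv.symm_apply_apply, headTail_inr, Fin.cons_succ]; rfl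
  have h0 : wedgeMap V L k (l ⊗ₜ exteriorPower.ιMulti ℂ k v) =
      (altMap (V × L) (k + 1) ∘ₗ (concat (V × L) (headTail k)).toLinearMap)
        ((PiTensorProduct.subsingletonEquiv (R := ℂ) (s := fun _ : Fin 1 => V × L) 0).symm (0, l) ⊗ₜ
          PiTensorProduct.map (fun _ => LinearMap.inl ℂ V L) ((k.factorial : ℂ)⁻¹ •
            exteriorPower.toTensorPower ℂ V k (exteriorPower.ιMulti ℂ k v))) := rfl
  rw [h0, exteriorPower.toTensorPower_apply_ιMulti, map_smul, map_sum, TensorProduct.tmul_smul,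
    map_smul, TensorProduct.tmul_sum, map_sum]
  have h3 : ∀ σ : Equiv.Perm (Fin k), (altMap (V × L) (k + 1) ∘ₗ
      (concat (V × L) (headTail k)).toLinearMap)
      ((PiTensorProduct.subsingletonEquiv (R := ℂ) (s := fun _ : Fin 1 => V × L) 0).symm (0, l) ⊗ₜ
        PiTensorProduct.map (fun _ => LinearMap.inl ℂ V L)
          (Equiv.Perm.sign σ • PiTensorProduct.tprod ℂ fun i => v (σ i))) =
      exteriorPower.ιMulti ℂ (k + 1) (Fin.cons (0, l) fun i => (v i, 0)) := by
    intro σ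
    rw [Units.smul_def, ← Int.cast_smul_eq_zsmul ℂ, map_smul, TensorProduct.tmul_smul, map_smul, h1]
    refine (Int.cast_smul_eq_zsmul ℂ (Equiv.Perm.sign σ : ℤ) (exteriorPower.ιMulti ℂ (k + 1)
      (Fin.cons (0, l) fun i => (v (σ i), 0) : Fin (k + 1) → V × L))).trans ?_
    -- A permutation of the last k slots, extended by fixing slot 0, keeps its sign.
    have h4 := exteriorPower_ιMulti_perm (Fin.cons (0, l) fun i => (v i, 0) : Fin (k + 1) → V × L)
      (Equiv.Perm.decomposeFin.symm (0, σ))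
    rw [Equiv.Perm.decomposeFin.symm_sign, if_pos rfl, one_mul] at h4
    rw [← h4]
    congr 2
    funext i
    refine Fin.cases ?_ (fun i => ?_) i
    · simp
    · rw [Equiv.Perm.decomposeFin_symm_apply_succ]; simp
  rw [Finset.sum_congr rfl fun σ _ => h3 σ, Finset.sum_const, Finset.card_univ, Fintype.card_perm,
    Fintype.card_fin, ← Nat.cast_smul_eq_nsmul ℂ, smul_smul, inv_mul_cancel₀
    (by exact_mod_cast k.factorial_ne_zero), one_smul]

theorem unwedgeMap_ιMulti (k : ℕ) (v : Fin (k + 1) → V × L) :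
    unwedgeMap V L k (exteriorPower.ιMulti ℂ (k + 1) v) = (k.factorial : ℂ)⁻¹ •
      ∑ σ : Equiv.Perm (Fin (k + 1)), (Equiv.Perm.sign σ : ℤ) • ((v (σ 0)).2 ⊗ₜ[ℂ]
        exteriorPower.ιMulti ℂ k fun i => (v (σ i.succ)).1) := by
  rw [unwedgeMap, LinearMap.smul_apply, LinearMap.comp_apply, LinearMap.comp_apply,
    exteriorPower.toTensorPower_apply_ιMulti, map_sum, map_sum]
  congr 1
  refine Finset.sum_congr rfl fun σ _ => ?_
  rw [Units.smul_def, map_zsmul, map_zsmul]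
  congr 1
  rw [LinearEquiv.coe_coe, concat_symm_tprod, TensorProduct.map_tmul, LinearMap.comp_apply,
    LinearMap.comp_apply, PiTensorProduct.map_tprod, altMap_tprod, LinearEquiv.coe_coe,
    PiTensorProduct.subsingletonEquiv_apply_tprod]
  simp only [headTail_inl, headTail_inr]
  rfl

theorem unwedgeMap_wedgeMap (k : ℕ) (a : L ⊗[ℂ] (⋀[ℂ]^k V)) :
    unwedgeMap V L k (wedgeMap V L k a) = a := by
  have : unwedgeMap V L k ∘ₗ wedgeMap V L k = LinearMap.id := by
    refine TensorProduct.ext (LinearMap.ext fun l => exteriorPower.linearMap_ext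
      (AlternatingMap.ext fun v => ?_))
    change unwedgeMap V L k (wedgeMap V L k (l ⊗ₜ exteriorPower.ιMulti ℂ k v)) =
      l ⊗ₜ exteriorPower.ιMulti ℂ k v
    -- Permutations are sorted by the image of 0. Those fixing 0 give k! equal terms; any other puts
    -- a vector of V into the slot projected to L and contributes zero.
    rw [wedgeMap_ιMulti, unwedgeMap_ιMulti, ← Equiv.sum_comp Equiv.Perm.decomposeFin.symm,
      Fintype.sum_prod_type, Fin.sum_univ_succ, Finset.sum_eq_zero (s := Finset.univ (α := Fin k)),
      add_zero]
    · have h1 : ∀ σ : Equiv.Perm (Fin k),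
          (Equiv.Perm.sign (Equiv.Perm.decomposeFin.symm (0, σ)) : ℤ) •
          (((Fin.cons (0, l) fun i => (v i, 0) : Fin (k + 1) → V × L)
            (Equiv.Perm.decomposeFin.symm (0, σ) 0)).2 ⊗ₜ[ℂ]
            exteriorPower.ιMulti ℂ k fun i : Fin k =>
              ((Fin.cons (0, l) fun i => (v i, 0) : Fin (k + 1) → V × L)
                (Equiv.Perm.decomposeFin.symm (0, σ) i.succ)).1) =
          l ⊗ₜ[ℂ] exteriorPower.ιMulti ℂ k v := by
        intro σ
        rw [Equiv.Perm.decomposeFin.symm_sign, if_pos rfl, one_mul,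
          ← exteriorPower_ιMulti_perm v σ, TensorProduct.tmul_smul]
        congr 1
      rw [Finset.sum_congr rfl fun σ _ => h1 σ, Finset.sum_const, Finset.card_univ,
        Fintype.card_perm, Fintype.card_fin, ← Nat.cast_smul_eq_nsmul ℂ, smul_smul, inv_mul_cancel₀
        (by exact_mod_cast k.factorial_ne_zero), one_smul]
    · intro p _
      refine Finset.sum_eq_zero fun σ _ => ?_
      rw [Equiv.Perm.decomposeFin_symm_apply_zero, Fin.cons_succ]
      simp
  exact LinearMap.congr_fun this a

theorem map_fst_wedgeMap (k : ℕ) (a : L ⊗[ℂ] (⋀[ℂ]^k V)) :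
    exteriorPower.map (k + 1) (LinearMap.fst ℂ V L) (wedgeMap V L k a) = 0 := by
  have : exteriorPower.map (k + 1) (LinearMap.fst ℂ V L) ∘ₗ wedgeMap V L k = 0 := by
    refine TensorProduct.ext (LinearMap.ext fun l => exteriorPower.linearMap_ext
      (AlternatingMap.ext fun v => ?_))
    change exteriorPower.map (k + 1) _ (wedgeMap V L k (l ⊗ₜ exteriorPower.ιMulti ℂ k v)) = 0
    rw [wedgeMap_ιMulti, exteriorPower.map_apply_ιMulti]
    exact (exteriorPower.ιMulti ℂ (k + 1)).map_coord_zero 0 rfl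
  exact LinearMap.congr_fun this a

theorem unwedgeMap_map_inl (k : ℕ) (a : ⋀[ℂ]^(k + 1) V) :
    unwedgeMap V L k (exteriorPower.map (k + 1) (LinearMap.inl ℂ V L) a) = 0 := by
  have : unwedgeMap V L k ∘ₗ exteriorPower.map (k + 1) (LinearMap.inl ℂ V L) = 0 := by
    refine exteriorPower.linearMap_ext (AlternatingMap.ext fun v => ?_)
    change unwedgeMap V L k (exteriorPower.map (k + 1) _ (exteriorPower.ιMulti ℂ (k + 1) v)) = 0
    rw [exteriorPower.map_apply_ιMulti, unwedgeMap_ιMulti]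
    simp
  exact LinearMap.congr_fun this a

theorem map_fst_map_inl (k : ℕ) (a : ⋀[ℂ]^k V) :
    exteriorPower.map k (LinearMap.fst ℂ V L) (exteriorPower.map k (LinearMap.inl ℂ V L) a) = a := by
  rw [← LinearMap.comp_apply, ← exteriorPower.map_comp]
  simp

theorem map_fst_add {k : ℕ} (b : ⋀[ℂ]^(k + 1) V) (c : L ⊗[ℂ] (⋀[ℂ]^k V)) :
    exteriorPower.map (k + 1) (LinearMap.fst ℂ V L)
      (exteriorPower.map (k + 1) (LinearMap.inl ℂ V L) b + wedgeMap V L k c) = b := by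
  rw [map_add, map_fst_map_inl, map_fst_wedgeMap, add_zero]

theorem unwedgeMap_add {k : ℕ} (b : ⋀[ℂ]^(k + 1) V) (c : L ⊗[ℂ] (⋀[ℂ]^k V)) :
    unwedgeMap V L k
      (exteriorPower.map (k + 1) (LinearMap.inl ℂ V L) b + wedgeMap V L k c) = c := by
  rw [map_add, unwedgeMap_map_inl, unwedgeMap_wedgeMap, zero_add]

/-- The relations make the sum of the inclusions injective with an explicit left inverse. Equality
of dimensions makes it surjective, so the left inverse is two-sided. -/
theorem decomposition_of_finrank {M₁ M₂ N : Type*} [AddCommGroup M₁] [Module ℂ M₁]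
    [AddCommGroup M₂] [Module ℂ M₂] [AddCommGroup N] [Module ℂ N] [FiniteDimensional ℂ M₁]
    [FiniteDimensional ℂ M₂] [FiniteDimensional ℂ N] {i₁ : M₁ →ₗ[ℂ] N} {i₂ : M₂ →ₗ[ℂ] N}
    {p₁ : N →ₗ[ℂ] M₁} {p₂ : N →ₗ[ℂ] M₂} (h₁₁ : ∀ a, p₁ (i₁ a) = a) (h₁₂ : ∀ a, p₁ (i₂ a) = 0)
    (h₂₁ : ∀ a, p₂ (i₁ a) = 0) (h₂₂ : ∀ a, p₂ (i₂ a) = a)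
    (h : Module.finrank ℂ M₁ + Module.finrank ℂ M₂ = Module.finrank ℂ N) (a : N) :
    i₁ (p₁ a) + i₂ (p₂ a) = a := by
  have hψφ : ∀ b, (p₁.prod p₂) ((i₁.coprod i₂) b) = b := by
    rintro ⟨b, c⟩
    simp [h₁₁, h₁₂, h₂₁, h₂₂]
  obtain ⟨b, rfl⟩ := (LinearMap.injective_iff_surjective_of_finrank_eq_finrank
    ((Module.finrank_prod (R := ℂ)).trans h)).1 (Function.LeftInverse.injective hψφ) a
  have h1 := congrArg (i₁.coprod i₂) (hψφ b)
  simpa using h1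

/-- The decomposition of the exterior powers of `V × L` for a line `L`. -/
theorem exteriorPower_prod_line [FiniteDimensional ℂ V] (hL : Module.finrank ℂ L = 1) (k : ℕ)
    (a : ⋀[ℂ]^(k + 1) (V × L)) :
    exteriorPower.map (k + 1) (LinearMap.inl ℂ V L)
        (exteriorPower.map (k + 1) (LinearMap.fst ℂ V L) a) +
      wedgeMap V L k (unwedgeMap V L k a) = a := by
  have : FiniteDimensional ℂ L := FiniteDimensional.of_finrank_pos (by omega)
  refine decomposition_of_finrank (map_fst_map_inl (k + 1)) (map_fst_wedgeMap k)
    (unwedgeMap_map_inl k) (unwedgeMap_wedgeMap k) ?_ a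
  -- The dimension count is Pascal's rule for binomial coefficients.
  rw [Module.finrank_tensorProduct, exteriorPower.finrank_eq, exteriorPower.finrank_eq,
    exteriorPower.finrank_eq, Module.finrank_prod, hL, one_mul, Nat.choose_succ_succ, add_comm]

end wedge

/-! ### Adding a line bundle to a bundle. -/

section lines

variable {A : Type w} {X : Type u} [TopologicalSpace X]

theorem GBundle.finiteDimensional (E : GBundle.{u, v, w} A X) (x : X) :
    FiniteDimensional ℂ (E.fiber x) := by
  refine Module.Finite.of_surjective
    (∑ i, (LinearMap.proj i : (E.idx x → ℂ) →ₗ[ℂ] ℂ).smulRight (E.frame x i x)) fun v =>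
      ⟨fun i => E.coord x i x v, ?_⟩
  simpa using E.sum_coord_frame x x (E.mem_dom x) v

theorem IsLine.finrank {L : GBundle.{u, v, w} A X} {d : A} (hL : IsLine L d) (x : X) :
    Module.finrank ℂ (L.fiber x) = 1 := by
  obtain ⟨i, hi⟩ := Fintype.card_eq_one_iff.1 (hL x).1
  refine finrank_eq_one (L.frame x i x) (fun h => ?_) fun v => ⟨L.coord x i x v, ?_⟩
  · have h1 := L.coord_frame_self x x (L.mem_dom x) i
    rw [h, map_zero] at h1
    exact zero_ne_one h1
  · have h1 := L.sum_coord_frame x x (L.mem_dom x) v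
    rwa [Fintype.sum_eq_single i fun j hj => (hj (hi j)).elim] at h1

variable [AddCommMonoid A]

/-- The fibrewise decomposition is assembled from bundle homomorphisms, so it remains only to cite
the linear algebra. This recursion is the one satisfied by elementary symmetric polynomials when a
variable is added. -/
theorem Iso.exteriorPow_directSum_line (F : GBundle.{u, v, w} A X) {L : GBundle.{u, v, w} A X}
    {d : A} (hL : IsLine L d) (k : ℕ) :
    Iso (GradedK.exteriorPow (directSum F L) (k + 1))
      (directSum (GradedK.exteriorPow F (k + 1)) (tensor L (GradedK.exteriorPow F k))) := by
  have hw : IsHom (tensor L (GradedK.exteriorPow F k)) (GradedK.exteriorPow (directSum F L) (k + 1))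
      fun x => wedgeMap (F.fiber x) (L.fiber x) k :=
    (altMap_isHom (directSum F L) (k + 1)).comp ((concat_isHom (headTail k) (directSum F L)).comp
      (((tpow_one_symm_isHom (directSum F L)).comp IsHom.inr).tensor
        ((IsHom.tpow fun _ => IsHom.inl).comp (toTensorPower_smul_isHom F k))))
  have hu : IsHom (GradedK.exteriorPow (directSum F L) (k + 1)) (tensor L (GradedK.exteriorPow F k))
      fun x => unwedgeMap (F.fiber x) (L.fiber x) k :=
    (((IsHom.snd.comp (tpow_one_isHom (directSum F L))).tensor
      ((altMap_isHom F k).comp (IsHom.tpow fun _ => IsHom.fst))).comp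
        ((concat_symm_isHom (headTail k) (directSum F L)).comp
          (toTensorPower_isHom (directSum F L) (k + 1)))).smul _
  refine Iso.of_inverse ((IsHom.fst.exteriorPow (k + 1)).prod hu)
    (((IsHom.inl.exteriorPow (k + 1)).comp IsHom.fst).add (hw.comp IsHom.snd)) (fun x v => ?_) ?_
  · have := F.finiteDimensional x
    exact exteriorPower_prod_line (hL.finrank x) k v
  · rintro x ⟨(b : ⋀[ℂ]^(k + 1) (F.fiber x)), (c : L.fiber x ⊗[ℂ] ⋀[ℂ]^k (F.fiber x))⟩
    refine Prod.ext ?_ ?_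
    · exact map_fst_add b c
    · exact unwedgeMap_add b c

theorem GK.tensorLeft_exteriorPow_directSum_line (F : GBundle.{u, v, w} A X)
    {L : GBundle.{u, v, w} A X} {d : A} (hL : IsLine L d) (k : ℕ) (a : GK.{u, v, w} A X) :
    GK.tensorLeft (exteriorPow (directSum F L) (k + 1)) a =
      GK.tensorLeft (exteriorPow F (k + 1)) a +
        GK.tensorLeft L (GK.tensorLeft (exteriorPow F k) a) := by
  rw [GK.tensorLeft_congr (Iso.exteriorPow_directSum_line F hL k), GK.tensorLeft_directSum,
    AddMonoidHom.add_apply, GK.tensorLeft_tensor]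

end lines

/-! ### Newton's identities for commuting elements of a ring. -/

section newtonIdentities

theorem esymm_zero {R : Type*} [CommSemiring R] (s : Multiset R) : s.esymm 0 = 1 := by
  simp [Multiset.esymm]

theorem esymm_cons_succ {R : Type*} [CommSemiring R] (a : R) (s : Multiset R) (k : ℕ) :
    (a ::ₘ s).esymm (k + 1) = s.esymm (k + 1) + a * s.esymm k := by
  simp [Multiset.esymm, Multiset.powersetCard_cons, Multiset.sum_map_mul_left]

/-- Newton's identity for the power sums of a finite family. -/
theorem newton_esymm {R κ : Type*} [CommRing R] (s : Finset κ) (f : κ → R) (m : ℕ) :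
    ∑ j ∈ s, f j ^ (m + 1) = ((-1) ^ m * (m + 1) : ℤ) • (s.val.map f).esymm (m + 1) +
      ∑ i : Fin m, ((-1) ^ (i : ℕ) : ℤ) •
        ((s.val.map f).esymm (i + 1) * ∑ j ∈ s, f j ^ (m - i)) := by
  have he : ∀ k, MvPolynomial.aeval (fun j : s => f j) (MvPolynomial.esymm s ℤ k) =
      (s.val.map f).esymm k := by
    intro k
    rw [MvPolynomial.aeval_esymm_eq_multiset_esymm]
    congr 1
    exact Multiset.attach_map_val' s.val f
  have hp : ∀ k, MvPolynomial.aeval (fun j : s => f j) (MvPolynomial.psum s ℤ k) =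
      ∑ j ∈ s, f j ^ k := by
    intro k
    rw [MvPolynomial.psum, map_sum]
    simp only [map_pow, MvPolynomial.aeval_X]
    exact Finset.sum_coe_sort s fun j => f j ^ k
  have h := congrArg (MvPolynomial.aeval fun j : s => f j)
    (MvPolynomial.psum_eq_mul_esymm_sub_sum s ℤ (m + 1) m.succ_pos)
  rw [hp, map_sub, map_mul, map_mul, he, map_sum] at h
  simp only [map_mul, map_pow, map_neg, map_one, he, hp, map_natCast] at h
  rw [h, sub_eq_add_neg, ← Finset.sum_neg_distrib]
  congr 1
  · rw [zsmul_eq_mul]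
    push_cast
    ring
  -- The two end terms of the antidiagonal are excluded by the open interval, and the index is
  -- shifted by one to match the sum over `Fin m`.
  · rw [Finset.sum_filter, Finset.Nat.sum_antidiagonal_eq_sum_range_succ_mk, Finset.sum_range_succ,
      Finset.sum_range_succ', if_neg (by simp), if_neg (by simp), add_zero, add_zero,
      ← Fin.sum_univ_eq_sum_range fun i => if i + 1 ∈ Set.Ioo 0 (m + 1) then
        -((-1) ^ (i + 1) * (s.val.map f).esymm (i + 1) * ∑ j ∈ s, f j ^ (m + 1 - (i + 1))) else 0]
    refine Finset.sum_congr rfl fun i _ => ?_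
    rw [if_pos ⟨by omega, by omega⟩, Nat.add_sub_add_right, zsmul_eq_mul]
    push_cast
    ring

open scoped IsMulCommutative in
/-- Pairwise commuting elements of a ring are the values of a homomorphism from a commutative
polynomial ring. -/
theorem exists_ringHom_of_commute {R κ : Type*} [Ring R] (a : κ → R) (h : ∀ i j, Commute (a i) (a j)) :
    ∃ φ : MvPolynomial κ ℤ →+* R, ∀ j, φ (MvPolynomial.X j) = a j := by
  -- The subring generated by commuting elements is commutative, so polynomials can be evaluated
  -- there.
  obtain ⟨S, hS, ha⟩ : ∃ S : Subring R, IsMulCommutative S ∧ ∀ j, a j ∈ S :=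
    ⟨Subring.closure (Set.range a),
      Subring.isMulCommutative_closure (by rintro _ ⟨i, rfl⟩ _ ⟨j, rfl⟩; exact h i j),
      fun j => Subring.subset_closure ⟨j, rfl⟩⟩
  refine ⟨S.subtype.comp (MvPolynomial.aeval fun j => (⟨a j, ha j⟩ : S)).toRingHom, fun j => ?_⟩
  simp

end newtonIdentities

/-! ### Additivity of even and odd parts. -/

section parityAdditive

variable {A : Type w} {X : Type u} [TopologicalSpace X] [AddCommMonoid A] (par : A →+ ZMod 2)
  {E F : GBundle.{u, v, w} A X}

/-- A homomorphism preserves degrees, hence parities; the parity projector is therefore natural,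
which gives functoriality and additivity of the parity parts. -/
theorem parityProj_hom {f : ∀ x, E.fiber x →ₗ[ℂ] F.fiber x} (hf : IsHom E F f) (ε : ZMod 2) (x : X)
    (v : E.fiber x) : parityProj par F ε x (f x v) = f x (parityProj par E ε x v) := by
  have : parityProj par F ε x ∘ₗ f x = f x ∘ₗ parityProj par E ε x := by
    refine E.linearMap_ext fun i => ?_
    rw [LinearMap.comp_apply, LinearMap.comp_apply, parityProj_frame par E ε (E.mem_dom x),
      ← F.sum_coord_frame x x (F.mem_dom x) (f x (E.frame x i x)), map_sum]
    have h : ∀ j, parityProj par F ε x (F.coord x j x (f x (E.frame x i x)) • F.frame x j x) =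
        if par (E.deg x i) = ε then F.coord x j x (f x (E.frame x i x)) • F.frame x j x else 0 := by
      intro j
      rw [map_smul, parityProj_frame par F ε (F.mem_dom x)]
      by_cases hij : E.deg x i = F.deg x j
      · rw [hij, smul_ite, smul_zero]
      · rw [hf.deg x x x ⟨E.mem_dom x, F.mem_dom x⟩ i j hij, zero_smul, zero_smul, ite_self]
    rw [Finset.sum_congr rfl fun j _ => h j]
    split_ifs
    · exact F.sum_coord_frame x x (F.mem_dom x) _
    · simp
  exact LinearMap.congr_fun this v

theorem parityPart_iso (h : Iso E F) (ε : ZMod 2) :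
    Iso (parityPart par E ε) (parityPart par F ε) := by
  obtain ⟨f, hf, hf'⟩ := h
  refine Iso.subbundle_congr _ _ hf hf' ?_ ?_ (fun x v _ => (f x).symm_apply_apply v)
    fun x v _ => (f x).apply_symm_apply v
  · rintro x _ ⟨v, rfl⟩
    exact ⟨f x v, parityProj_hom par hf ε x v⟩
  · rintro x _ ⟨v, rfl⟩
    exact ⟨(f x).symm v, parityProj_hom par hf' ε x v⟩

theorem parityPart_directSum (E F : GBundle.{u, v, w} A X) (ε : ZMod 2) :
    Iso (parityPart par (directSum E F) ε) (directSum (parityPart par E ε) (parityPart par F ε)) := by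
  have hE := parityPart_isSubbundle par E ε
  have hF := parityPart_isSubbundle par F ε
  have hpp : ∀ (G : GBundle.{u, v, w} A X) x v,
      parityProj par G ε x (parityProj par G ε x v) = parityProj par G ε x v := fun G x v => by
    rw [parityProj_parityProj, if_pos rfl]
  refine Iso.subbundle_iso (parityPart_isSubbundle par (directSum E F) ε)
    ((((parityProj_isHom par E ε).codRestrict hE fun x v => ⟨v, rfl⟩).comp IsHom.fst).prod
      (((parityProj_isHom par F ε).codRestrict hF fun x v => ⟨v, rfl⟩).comp IsHom.snd))
    ((IsHom.inl.comp ((subbundle_subtype_isHom E _ hE).comp IsHom.fst)).add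
      (IsHom.inr.comp ((subbundle_subtype_isHom F _ hF).comp IsHom.snd))) ?_ ?_ ?_
  · rintro x ⟨⟨_, v, rfl⟩, ⟨_, v', rfl⟩⟩
    refine Submodule.add_mem _ ⟨LinearMap.inl ℂ _ _ v, ?_⟩ ⟨LinearMap.inr ℂ _ _ v', ?_⟩
    · exact parityProj_hom par IsHom.inl ε x v
    · exact parityProj_hom par IsHom.inr ε x v'
  · rintro x _ ⟨v, rfl⟩
    have h1 := parityProj_hom par (IsHom.fst (E := E) (F := F)) ε x v
    have h2 := parityProj_hom par (IsHom.snd (E := E) (F := F)) ε x v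
    refine Prod.ext ?_ ?_
    · change parityProj par E ε x (parityProj par (directSum E F) ε x v).1 + 0 =
        (parityProj par (directSum E F) ε x v).1
      rw [add_zero]
      refine (congrArg (parityProj par E ε x) h1.symm).trans ?_
      exact (hpp E x _).trans h1
    · change 0 + parityProj par F ε x (parityProj par (directSum E F) ε x v).2 =
        (parityProj par (directSum E F) ε x v).2
      rw [zero_add]
      refine (congrArg (parityProj par F ε x) h2.symm).trans ?_
      exact (hpp F x _).trans h2
  · rintro x ⟨⟨_, v, rfl⟩, ⟨_, v', rfl⟩⟩
    refine Prod.ext (Subtype.ext ?_) (Subtype.ext ?_)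
    · change parityProj par E ε x (parityProj par E ε x v + 0) = parityProj par E ε x v
      rw [add_zero, hpp]
    · change parityProj par F ε x (0 + parityProj par F ε x v') = parityProj par F ε x v'
      rw [zero_add, hpp]

/-- The part of parity `ε`, on isomorphism classes. -/
noncomputable def IsoClass.parityPart (ε : ZMod 2) :
    IsoClass.{u, v, w} A X →+ IsoClass.{u, v, w} A X where
  toFun := Quotient.lift (fun E => IsoClass.mk (GradedK.parityPart par E ε))
    fun _ _ h => IsoClass.sound (parityPart_iso par h ε)
  map_zero' := by
    refine IsoClass.sound (Iso.of_subsingleton (fun x => ?_)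
      fun x => inferInstanceAs (Subsingleton PUnit))
    have : Subsingleton ((zeroBundle.{u, v, w} A X).fiber x) :=
      inferInstanceAs (Subsingleton PUnit)
    exact inferInstanceAs
      (Subsingleton (LinearMap.range (parityProj par (zeroBundle.{u, v, w} A X) ε x)))
  map_add' := by
    rintro ⟨E⟩ ⟨F⟩
    exact IsoClass.sound (parityPart_directSum par E F ε)

theorem IsoClass.parityPart_mk (ε : ZMod 2) (E : GBundle.{u, v, w} A X) :
    IsoClass.parityPart par ε (IsoClass.mk E) = IsoClass.mk (GradedK.parityPart par E ε) := rfl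

theorem IsLine.parityProj_eq {L : GBundle.{u, v, w} A X} {d : A} (hL : IsLine L d) (ε : ZMod 2)
    (x : X) : parityProj par L ε x = if par d = ε then LinearMap.id else 0 := by
  refine L.linearMap_ext fun i => ?_
  rw [parityProj_frame par L ε (L.mem_dom x), (hL x).2]
  split_ifs <;> rfl

/-- A homogeneous line has a single parity, so its parity projector is the identity or zero. -/
theorem IsLine.mk_parityPart {L : GBundle.{u, v, w} A X} {d : A} (hL : IsLine L d) (ε : ZMod 2) :
    IsoClass.mk (parityPart par L ε) = if par d = ε then IsoClass.mk L else 0 := by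
  split_ifs with h
  · refine IsoClass.sound (Iso.subbundle_iso (parityPart_isSubbundle par L ε) (IsHom.id L)
      (IsHom.id L) (fun x v => ⟨v, ?_⟩) (fun _ _ _ => rfl) fun _ _ => rfl)
    rw [hL.parityProj_eq, if_pos h]
  · refine IsoClass.sound (Iso.of_subsingleton (fun x => ?_)
      fun x => inferInstanceAs (Subsingleton PUnit))
    have h1 : Subsingleton (LinearMap.range (parityProj par L ε x)) := by
      rw [hL.parityProj_eq, if_neg h, LinearMap.range_zero]
      infer_instance
    exact h1

end parityAdditive

/-! ### Adams operations of sums of line bundles. -/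

section adamsLines

variable {A : Type w} {X : Type u} [TopologicalSpace X] [AddCommMonoid A] (par : A →+ ZMod 2)

/-- Equality in the monoid of isomorphism classes is isomorphism, whereas equality in `GK` would
only give stable isomorphism. Hence the hypotheses on sums of lines are phrased with `IsoClass`. -/
theorem Iso.of_mk_eq {E F : GBundle.{u, v, w} A X} (h : IsoClass.mk E = IsoClass.mk F) :
    Iso E F := Quotient.exact h

/-- The exterior powers of a sum of line bundles. -/
theorem tensorLeft_exteriorPow_eq_esymm {κ : Type*} {L : κ → GBundle.{u, v, w} A X} {d : κ → A}
    (hL : ∀ j, IsLine (L j) (d j))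
    {φ : MvPolynomial κ ℤ →+* AddMonoid.End (GK.{u, v, w} A X)}
    (hφ : ∀ j, φ (MvPolynomial.X j) = GK.tensorLeft (L j)) (s : Finset κ)
    (F : GBundle.{u, v, w} A X) (hF : IsoClass.mk F = ∑ j ∈ s, IsoClass.mk (L j)) (k : ℕ) :
    GK.tensorLeft (exteriorPow F k) = φ ((s.val.map MvPolynomial.X).esymm k) := by
  classical
  induction s using Finset.induction_on generalizing F k with
  | empty =>
    have hF0 : Iso F (zeroBundle A X) := Iso.of_mk_eq hF
    rw [GK.tensorLeft_congr (hF0.exteriorPow k)]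
    rcases k with _ | k
    · rw [esymm_zero, map_one]
      exact AddMonoidHom.ext fun a => GK.tensorLeft_exteriorPow_zero _ a
    -- There are no variables, so the positive symmetric polynomials vanish, as do the positive
    -- exterior powers of the zero bundle.
    · have h0 : ((0 : Multiset κ).map (MvPolynomial.X (R := ℤ))).esymm (k + 1) = 0 := by
        simp [Multiset.esymm, Multiset.powersetCard_zero_right]
      refine (GK.tensorLeft_of_subsingleton fun x => ?_).trans ?_
      · have key : ∀ (V : Type v) [AddCommGroup V] [Module ℂ V] [Subsingleton V],
            Subsingleton (⋀[ℂ]^(k + 1) V) := by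
          intro V _ _ _
          refine ⟨fun a b => ?_⟩
          obtain ⟨a, rfl⟩ := altMap_surjective (k + 1) a
          obtain ⟨b, rfl⟩ := altMap_surjective (k + 1) b
          have h1 : altMap V (k + 1) = 0 := by
            refine PiTensorProduct.ext (MultilinearMap.ext fun v => ?_)
            refine (altMap_tprod v).trans ?_
            exact (exteriorPower.ιMulti ℂ (k + 1)).map_coord_zero 0 (Subsingleton.elim _ _)
          rw [h1, LinearMap.zero_apply, LinearMap.zero_apply]
        exact key PUnit
      · exact ((congrArg φ h0).trans (map_zero φ)).symm
  | insert j s hj ih =>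
    -- A representative of the partial sum; F is then isomorphic to its direct sum with one more
    -- line.
    obtain ⟨F', hF'⟩ : ∃ F', IsoClass.mk F' = ∑ j ∈ s, IsoClass.mk (L j) := Quotient.exists_rep _
    rw [Finset.sum_insert hj, ← hF', add_comm] at hF
    have hFF : Iso F (directSum F' (L j)) := Iso.of_mk_eq hF
    rw [GK.tensorLeft_congr (hFF.exteriorPow k), Finset.insert_val_of_notMem hj, Multiset.map_cons]
    rcases k with _ | k
    · rw [esymm_zero, map_one]
      exact AddMonoidHom.ext fun a => GK.tensorLeft_exteriorPow_zero _ a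
    -- Both sides obey the same recursion in the number of lines.
    · rw [esymm_cons_succ, map_add, map_mul, ← ih F' hF', ← ih F' hF', hφ]
      exact AddMonoidHom.ext fun a => GK.tensorLeft_exteriorPow_directSum_line F' (hL j) k a

/-- The Adams operations of a sum of line bundles. -/
theorem adams_eq_sum {κ : Type*} {L : κ → GBundle.{u, v, w} A X} {d : κ → A}
    (hL : ∀ j, IsLine (L j) (d j)) (s : Finset κ)
    (F : GBundle.{u, v, w} A X) (hF : IsoClass.mk F = ∑ j ∈ s, IsoClass.mk (L j)) {n : ℕ}
    (hn : 0 < n) : adams F n = ∑ j ∈ s, GK.of (tpow n (L j)) := by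
  obtain ⟨φ, hφ⟩ := exists_ringHom_of_commute
    (R := AddMonoid.End (GK.{u, v, w} A X)) (fun j => GK.tensorLeft (L j))
    fun i j => AddMonoidHom.ext fun a => GK.tensorLeft_comm (L i) (L j) a
  have he := tensorLeft_exteriorPow_eq_esymm hL hφ s F hF
  -- A polynomial in the lines acts as an operator and is evaluated on the class of the trivial
  -- line. Symmetric polynomials become classes of exterior powers, powers of variables become
  -- tensor powers.
  let Φ : MvPolynomial κ ℤ →+ GK.{u, v, w} A X :=
    (AddMonoidHom.eval GK.unit).comp φ.toAddMonoidHom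
  have hmul : ∀ k p, Φ ((s.val.map MvPolynomial.X).esymm k * p) =
      GK.tensorLeft (exteriorPow F k) (Φ p) := by
    intro k p
    change φ _ GK.unit = _
    rw [map_mul, ← he]
    rfl
  have hone : ∀ k, Φ ((s.val.map MvPolynomial.X).esymm k) = GK.of (exteriorPow F k) := by
    intro k
    change φ _ GK.unit = _
    rw [← he]
    exact GK.tensorLeft_unit _
  have hpow : ∀ k j, Φ (MvPolynomial.X j ^ k) = GK.of (tpow k (L j)) := by
    intro k j
    induction k with
    | zero =>
      change φ _ GK.unit = _
      rw [pow_zero, map_one]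
      exact GK.of_eq (Iso.tpow_zero _ _)
    | succ k ih =>
      change φ _ GK.unit = _
      rw [pow_succ', map_mul, hφ]
      change GK.tensorLeft (L j) (Φ (MvPolynomial.X j ^ k)) = _
      rw [ih, GK.tensorLeft_of]
      exact GK.of_eq (Iso.tensor_tpow_succ k (L j))
  -- Power sums satisfy Newton's identities, and their image under Φ is the recursion defining
  -- `adams`.
  have key : ∀ n, 0 < n → adams F n = Φ (∑ j ∈ s, MvPolynomial.X j ^ n) := by
    intro n
    induction n using Nat.strong_induction_on with
    | _ n ih =>
    intro hn
    obtain ⟨m, rfl⟩ : ∃ m, n = m + 1 := ⟨n - 1, by omega⟩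
    rw [adams, newton_esymm, map_add, map_zsmul, map_sum, hone]
    congr 1
    refine Finset.sum_congr rfl fun i _ => ?_
    rw [map_zsmul, hmul, ih (m - i) (by omega) (by omega)]
  rw [key n hn, map_sum]
  exact Finset.sum_congr rfl fun j _ => hpow n j

/-- The graded Adams operations of a sum of graded line bundles. -/
theorem gradedAdams_sum_line {n : ℕ} (hn : 0 < n) {r : ℕ} (L : Fin r → GBundle.{u, v, w} A X)
    {d : Fin r → A} {E : GBundle.{u, v, w} A X} (hL : ∀ j, IsLine (L j) (d j))
    (hE : IsoClass.mk E = ∑ j, IsoClass.mk (L j)) :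
    gradedAdams par n E = ∑ j, ((-1) ^ ((n - 1) * (par (d j)).val) : ℤ) •
      GK.of (tensorPow par n (L j)).toGBundle := by
  have hpart : ∀ ε, adams (parityPart par E ε) n =
      ∑ j, if par (d j) = ε then GK.of (tpow n (L j)) else 0 := by
    intro ε
    rw [← Finset.sum_filter]
    refine adams_eq_sum hL _ _ ?_ hn
    -- The part of parity ε of E is the sum of exactly those lines whose degree has parity ε.
    rw [← IsoClass.parityPart_mk, hE, map_sum, Finset.sum_filter]
    exact Finset.sum_congr rfl fun j _ => (hL j).mk_parityPart par ε
  rw [gradedAdams, hpart, hpart, Finset.smul_sum, ← Finset.sum_add_distrib]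
  refine Finset.sum_congr rfl fun j _ => ?_
  change _ = _ • GK.of (tpow n (L j))
  generalize par (d j) = δ
  obtain rfl | rfl : δ = 0 ∨ δ = 1 := by
    fin_cases δ
    · exact Or.inl rfl
    · exact Or.inr rfl
  · simp
  · simp [ZMod.val_one]

end adamsLines

end GradedK

theorem mainTheorem9 {A : Type w} [AddCommGroup A] (par : A →+ ZMod 2)
    {X : Type u} [TopologicalSpace X] (n : ℕ) (hn : 1 ≤ n) :
    -- for every graded vector bundle, both identities in `GK(X) ⊗ ℂ`
    (∀ E : GradedK.GBundle.{u, v, w} A X,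
      GradedK.GK.pullbackC (GradedK.toFixed (finRotate n))
          (GradedK.continuous_toFixed (finRotate n))
          (GradedK.phi (finRotate n) (GradedK.tensorPow par n E)) =
        GradedK.gradedAdams par n E ⊗ₜ[ℤ] (1 : ℂ) ∧
      GradedK.GK.pullbackC (GradedK.diag n (finRotate n))
          (GradedK.continuous_diag n (finRotate n))
          (GradedK.phi (finRotate n) (GradedK.extTensorPow par n E)) =
        GradedK.gradedAdams par n E ⊗ₜ[ℤ] (1 : ℂ)) ∧
    -- the value of the graded Adams operation on a direct sum of graded line bundles
    (∀ (r : ℕ) (L : Fin r → GradedK.GBundle.{u, v, w} A X) (d : Fin r → A)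
      (E : GradedK.GBundle.{u, v, w} A X), (∀ j, GradedK.IsLine (L j) (d j)) →
      GradedK.IsoClass.mk E = ∑ j, GradedK.IsoClass.mk (L j) →
      GradedK.gradedAdams par n E =
        ∑ j, ((-1) ^ ((n - 1) * (par (d j)).val) : ℤ) •
          GradedK.GK.of (GradedK.tensorPow par n (L j)).toGBundle) := by
  refine ⟨fun E => ⟨?_, ?_⟩, fun r L d E hL hE => GradedK.gradedAdams_sum_line par hn L hL hE⟩
  · rw [GradedK.pullbackC_phi_tensorPow par hn, GradedK.koszulRotClass_eq par hn,
      GradedK.tensorSwap_cclass]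
  · rw [GradedK.pullbackC_phi_extTensorPow par hn, GradedK.koszulRotClass_eq par hn,
      GradedK.tensorSwap_cclass]
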